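/- Let $n\ge 3$, $p,q>1$, and put $$F_{SG,1}=\frac{\frac1p+1+q}{pq-1}-\frac{n-1}{2},\qquad F_{SG,2}=\frac{\frac1q+2}{pq-1}-\frac{n-1}{2},\qquad \Gamma_{SG}=\max\{F_{SG,1},F_{SG,2}\}.$$ For $i=1,2$ let $D_i,V_i:\mathbb R^n\to\mathbb R$ be radial, continuous, Hölder continuous near the origin, and such that $$0\le D_i(x)\le \alpha_1(1+|x|)^{-\beta},\qquad 0\le V_i(x)\le \alpha_2(1+|x|)^{-\omega}$$ for some $\alpha_1,\alpha_2\ge 0$, $\beta>1$, $\omega>2$. Let $R>0$ and let $u_0,u_1,v_0,v_1\in C_c^\infty(\mathbb R^n)$ be nonnegative and supported in $\{|x|\le R\}$, with $(u_0,u_1)\ne(0,0)$ and $(v_0,v_1)\neq(0,0)$. For $\varepsilon>0$ consider $$\begin{cases}u_{tt}-\Delta u+D_1(x)u_t+V_1(x)u=|v|^q,\\ v_{tt}-\Delta v+D_2(x)v_t+V_2(x)v=|u_t|^p,\\ (u,u_t)(0,\cdot)=\varepsilon(u_0,u_1),\quad (v,v_t)(0,\cdot)=\varepsilon(v_0,v_1).\end{cases}$$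 A weak solution on $[0,T)$, $0<T\le\infty$, is a pair $u,v\in C([0,T),H^1(\mathbb R^n))\cap C^1([0,T),L^2(\mathbb R^n))$ with $u_t\in L^p_{loc}((0,T)\times\mathbb R^n)$, $v\in L^q_{loc}((0,T)\times\mathbb R^n)$, $u(0)=\varepsilon u_0$, $v(0)=\varepsilon v_0$, $\operatorname{supp}(u,v)\subset\{|x|\le t+R\}$, and such that for every $\Psi\in C_0^\infty([0,T)\times\mathbb R^n)$ the function $|v|^q\Psi$ is integrable on $[0,T)\times\mathbb R^n$ and $$\varepsilon\int u_1\Psi(0,x)\,dx+\varepsilon\int u_0D_1\Psi(0,x)\,dx+\int_0^T\!\!\int|v|^q\Psi\,dx\,dt=\int_0^T\!\!\int\big(-u_t\Psi_t+\nabla u\cdot\nabla\Psi-D_1u\Psi_t+V_1u\Psi\big)\,dx\,dt,$$ and the same holds with $(u,u_0,u_1,D_1,V_1,|v|^q)$ replaced by $(v,v_0,v_1,D_2,V_2,|u_t|^p)$. The lifespan $T_\varepsilon$ is the supremum of all $T$ for which a weak solution on $[0,T)$ exists. Suppose $\Gamma_{SG}\ge 0$. Then every weak solution blows up in finite time: $T_\varepsilon<\infty$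 for every $\varepsilon>0$. Moreover there are constants $\varepsilon_0>0$ and $C>0$, independent of $\varepsilon$ and of the solution, such that for all $\varepsilon\in(0,\varepsilon_0)$ $$T_\varepsilon\le\begin{cases}C\,\varepsilon^{-\Gamma_{SG}^{-1}}, & \Gamma_{SG}>0,\\ \exp\big(C\varepsilon^{-p(pq-1)}\big), & F_{SG,1}=0>F_{SG,2},\\ \exp\big(C\varepsilon^{-q(pq-1)}\big), & F_{SG,2}=0>F_{SG,1},\\ \exp\big(C\varepsilon^{-(pq-1)}\big), & F_{SG,1}=0=F_{SG,2}.\end{cases}$$ -/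

import Mathlib

open MeasureTheory Filter Topology Set
open scoped ENNReal NNReal ContDiff

namespace MixedWave

noncomputable section

/-- The Euclidean space `ℝⁿ`. -/
abbrev Space (n : ℕ) : Type := EuclideanSpace ℝ (Fin n)

/-- `F_{SG,1}(n,p,q) = (1/p + 1 + q)(pq-1)⁻¹ - (n-1)/2`. -/
def FSG1 (n : ℕ) (p q : ℝ) : ℝ := (1 / p + 1 + q) * (p * q - 1)⁻¹ - ((n : ℝ) - 1) / 2

/-- `F_{SG,2}(n,p,q) = (1/q + 2)(pq-1)⁻¹ - (n-1)/2`. -/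
def FSG2 (n : ℕ) (p q : ℝ) : ℝ := (1 / q + 2) * (p * q - 1)⁻¹ - ((n : ℝ) - 1) / 2

/-- `Γ_{SG}(n,p,q) = max {F_{SG,1}(n,p,q), F_{SG,2}(n,p,q)}`. -/
def GammaSG (n : ℕ) (p q : ℝ) : ℝ := max (FSG1 n p q) (FSG2 n p q)

/-- The assumption on each damping and potential coefficient `W`: it is continuous on `ℝⁿ`,
Hölder continuous of some exponent `δ` on the ball `B_δ`, radial, and
`0 ≤ W(x) ≤ a (1+|x|)^{-b}`. -/
structure IsCoefficient {n : ℕ} (a b : ℝ) (W : Space n → ℝ) : Prop where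
  continuous : Continuous W
  holder : ∃ δ : ℝ≥0, 0 < δ ∧ δ ≤ 1 ∧ ∃ K : ℝ≥0,
    HolderOnWith K δ W (Metric.closedBall (0 : Space n) δ)
  radial : ∀ x y : Space n, ‖x‖ = ‖y‖ → W x = W y
  nonneg : ∀ x, 0 ≤ W x
  decay : ∀ x, W x ≤ a * (1 + ‖x‖) ^ (-b)

/-- The assumption on each pair of initial data `(f₀, f₁)`: smooth, nonnegative, supported in
the closed ball `B_R`, and not both identically zero. -/
structure IsData {n : ℕ} (R : ℝ) (f₀ f₁ : Space n → ℝ) : Prop where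
  smooth₀ : ContDiff ℝ ∞ f₀
  smooth₁ : ContDiff ℝ ∞ f₁
  supp₀ : Function.support f₀ ⊆ Metric.closedBall 0 R
  supp₁ : Function.support f₁ ⊆ Metric.closedBall 0 R
  nonneg₀ : ∀ x, 0 ≤ f₀ x
  nonneg₁ : ∀ x, 0 ≤ f₁ x
  nontrivial : f₀ ≠ 0 ∨ f₁ ≠ 0

/-- The time interval `[0,T)`, with `T ∈ [0,∞]`. -/
def timeInterval (T : ℝ≥0∞) : Set ℝ := {t | 0 ≤ t ∧ ENNReal.ofReal t < T}

/-- The space-time slab `[0,T) × ℝⁿ`. -/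
def slab (n : ℕ) (T : ℝ≥0∞) : Set (ℝ × Space n) := {z | z.1 ∈ timeInterval T}

/-- The open space-time slab `(0,T) × ℝⁿ`. -/
def openSlab (n : ℕ) (T : ℝ≥0∞) : Set (ℝ × Space n) :=
  {z | 0 < z.1 ∧ ENNReal.ofReal z.1 < T}

/-- The space-time function `f`, measurable on `[0,T) × ℝⁿ`, is a representative of the
`L²(ℝⁿ)`-valued curve `U` on `[0,T)`. -/
def Represents {n : ℕ} {F : Type*} [NormedAddCommGroup F] (T : ℝ≥0∞)
    (f : ℝ × Space n → F) (U : ℝ → Lp F 2 (volume : Measure (Space n))) : Prop :=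
  AEStronglyMeasurable f (volume.restrict (slab n T)) ∧
    ∀ t ∈ timeInterval T, (fun x => f (t, x)) =ᵐ[volume] U t

/-- `g` is the weak (distributional) gradient of `f` on `ℝⁿ`. -/
def HasWeakGradient {n : ℕ} (f : Space n → ℝ) (g : Space n → Space n) : Prop :=
  ∀ φ : Space n → ℝ, ContDiff ℝ ∞ φ → HasCompactSupport φ →
    ∫ x, f x • gradient φ x = -∫ x, φ x • g x

/-- `w ∈ C([0,T), H¹(ℝⁿ)) ∩ C¹([0,T), L²(ℝⁿ))`, with time derivative `wt` and spatial
gradient `dw`. -/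
def IsEnergyClass {n : ℕ} (T : ℝ≥0∞) (w wt : ℝ × Space n → ℝ)
    (dw : ℝ × Space n → Space n) : Prop :=
  ∃ (U Ut : ℝ → Lp ℝ 2 (volume : Measure (Space n)))
    (dU : ℝ → Lp (Space n) 2 (volume : Measure (Space n))),
    Represents T w U ∧ Represents T wt Ut ∧ Represents T dw dU ∧
    ContinuousOn U (timeInterval T) ∧
    ContinuousOn dU (timeInterval T) ∧
    (∀ t ∈ timeInterval T, HasWeakGradient (fun x => w (t, x)) (fun x => dw (t, x))) ∧
    (∀ t ∈ timeInterval T, HasDerivWithinAt U (Ut t) (timeInterval T) t) ∧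
    ContinuousOn Ut (timeInterval T)

/-- `w ∈ L^r_loc((0,T) × ℝⁿ)` for a real exponent `r ≥ 1`. -/
def IsLocLr {n : ℕ} (T : ℝ≥0∞) (r : ℝ) (w : ℝ × Space n → ℝ) : Prop :=
  AEStronglyMeasurable w (volume.restrict (openSlab n T)) ∧
    LocallyIntegrableOn (fun z => |w z| ^ r) (openSlab n T) volume

/-- Test functions `Ψ ∈ C₀^∞([0,T) × ℝⁿ)`, given as restrictions to `t ≥ 0` of smooth compactly
supported functions on `ℝ × ℝⁿ` whose support lies in `{t < T}`. -/
structure IsTestFunction {n : ℕ} (T : ℝ≥0∞) (Ψ : ℝ × Space n → ℝ) : Prop where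
  smooth : ContDiff ℝ ∞ Ψ
  compact : HasCompactSupport Ψ
  before : ∀ z ∈ tsupport Ψ, ENNReal.ofReal z.1 < T

/-- The time derivative of a space-time function. -/
def dt {n : ℕ} (Ψ : ℝ × Space n → ℝ) (z : ℝ × Space n) : ℝ :=
  deriv (fun s => Ψ (s, z.2)) z.1

/-- The spatial gradient of a space-time function. -/
def dx {n : ℕ} (Ψ : ℝ × Space n → ℝ) (z : ℝ × Space n) : Space n :=
  gradient (fun y => Ψ (z.1, y)) z.2

/-- The weak form of `w_tt - Δw + D(x) w_t + V(x) w = N` on `[0,T) × ℝⁿ`, with data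
`(ε f₀, ε f₁)`; the term with `N` is required to be integrable against every test function. -/
def IsWeakEquation {n : ℕ} (T : ℝ≥0∞) (ε : ℝ) (D V f₀ f₁ : Space n → ℝ)
    (w wt : ℝ × Space n → ℝ) (dw : ℝ × Space n → Space n) (N : ℝ × Space n → ℝ) : Prop :=
  ∀ Ψ : ℝ × Space n → ℝ, IsTestFunction T Ψ →
    IntegrableOn (fun z => N z * Ψ z) (slab n T) volume ∧
    ε * (∫ x, f₁ x * Ψ (0, x)) + ε * (∫ x, f₀ x * D x * Ψ (0, x))
        + (∫ z in slab n T, N z * Ψ z)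
      = -(∫ z in slab n T, wt z * dt Ψ z) + (∫ z in slab n T, inner ℝ (dw z) (dx Ψ z))
        - (∫ z in slab n T, w z * D z.2 * dt Ψ z) + (∫ z in slab n T, V z.2 * w z * Ψ z)

/-- `(u,v)`, with time derivatives `(ut,vt)` and spatial gradients `(du,dv)`, is a weak solution
on `[0,T) × ℝⁿ` of
`u_tt - Δu + D₁ u_t + V₁ u = |v|^q`, `v_tt - Δv + D₂ v_t + V₂ v = |u_t|^p`
with data `ε (u₀,u₁)`, `ε (v₀,v₁)`, supported in `{|x| ≤ t + R}`. -/
structure IsWeakSolution {n : ℕ} (p q : ℝ) (D₁ D₂ V₁ V₂ : Space n → ℝ) (R : ℝ)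
    (u₀ u₁ v₀ v₁ : Space n → ℝ) (ε : ℝ) (T : ℝ≥0∞)
    (u ut : ℝ × Space n → ℝ) (du : ℝ × Space n → Space n)
    (v vt : ℝ × Space n → ℝ) (dv : ℝ × Space n → Space n) : Prop where
  pos : 0 < T
  energy_u : IsEnergyClass T u ut du
  energy_v : IsEnergyClass T v vt dv
  loc_ut : IsLocLr T p ut
  loc_v : IsLocLr T q v
  init_u : ∀ᵐ x : Space n, u (0, x) = ε * u₀ x
  init_v : ∀ᵐ x : Space n, v (0, x) = ε * v₀ x
  eq_u : IsWeakEquation T ε D₁ V₁ u₀ u₁ u ut du (fun z => |v z| ^ q)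
  eq_v : IsWeakEquation T ε D₂ V₂ v₀ v₁ v vt dv (fun z => |ut z| ^ p)
  finite_speed : ∀ t ∈ timeInterval T, ∀ᵐ x : Space n,
    t + R < ‖x‖ → u (t, x) = 0 ∧ v (t, x) = 0

/-- The lifespan `T_ε ∈ [0,∞]`: the supremum of all `T ∈ (0,∞]` such that a weak solution exists
on `[0,T) × ℝⁿ`. -/
def lifespan {n : ℕ} (p q : ℝ) (D₁ D₂ V₁ V₂ : Space n → ℝ) (R : ℝ)
    (u₀ u₁ v₀ v₁ : Space n → ℝ) (ε : ℝ) : ℝ≥0∞ :=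
  sSup {T | ∃ (u ut : ℝ × Space n → ℝ) (du : ℝ × Space n → Space n)
    (v vt : ℝ × Space n → ℝ) (dv : ℝ × Space n → Space n),
    IsWeakSolution p q D₁ D₂ V₁ V₂ R u₀ u₁ v₀ v₁ ε T u ut du v vt dv}

end

end MixedWave

/-! The proof is a test function argument with a whole family of test functions, indexed by a
frequency `lam` in `(0, 1]`. For each `lam` let `φ` be the positive radial solution of `Δφ = (lam² +
lam D + V) φ`, `φ(0) = 1`. Then `exp (-lam t) φ` solves the adjoint linear equation, is at least
`exp (-lam t)`, and is bounded by `(1 + lam |x|) ^ (-(n - 1) / 2) * exp (lam (|x| - t))`, with a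
constant independent of `lam`. This uniform bound (`exists_solution_bound`) comes from the Riccati
equation of the radial logarithmic derivative.

Truncating in time by a profile `E` living on scale `T` leaves, besides harmless terms, the error `D
E' φ`, which has no factor `lam`. A corrector `χ` with `Δχ = (lam² + lam D + V) χ + D φ` removes it:
the test function is `exp (-lam t) (E φ - E' χ)`, and `χ` grows sublinearly relative to `φ` because
`β > 1` (`exists_testPair`). The outcome is one integral inequality per component
(`exists_test_inequality`): the source weighted by `exp (-lam t)`, plus `lam` times the size of the
data, is at most `M lam ^ τ / T` times an integral of the unknown over the shell `T / 2 ≤ t ≤ T` of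
the light cone. Here `τ = 1` when the unknown on the right is the solution itself; choosing the
cutoff so that the test function is a time derivative replaces the solution by its time derivative
and gives `τ = 0`. The system is thus seen as a symmetric pair of inequalities between `u_t`, with
`(r, τ) = (p, 0)`, and `v`, with `(r, τ) = (q, 1)`.

Three choices of frequency are exploited, each followed by Hölder's inequality. At `lam = 1 / T` the
test function is essentially a cutoff, and the power integral of one unknown is controlled by the
shell norm of the other (`exists_low_frequency_estimate`). At `lam = 1` it concentrates near the
boundary of the cone, and the data are controlled by a shell norm
(`exists_high_frequency_estimate`). Composing two low-frequency bounds gives an a priori bound for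
the shell norm; inserting it in the high-frequency bound yields `c ≤ C T ^ (-F)` with `F` equal to
`F_{SG,1}` or `F_{SG,2}`, according to the order of the two components (`exists_data_le`). This
settles the case of a positive exponent.

When the exponent vanishes that bound carries no power of `T`, and a logarithm is gained by
superposing the frequencies `2 ^ (-j)`, `j ≤ J`, at `T = 2 ^ J` (`exists_dyadic_estimate`). The
source integral `b_J` with weight `(1 + t) ^ (-s)` then satisfies `b_J ^ (r r₂) ≤ C J ^ (r r₂ - r₂)
(b_J - b_{J-1})`, and the data are bounded by the same increment (`exists_critical_increment`). A
discrete version of blow-up for an ordinary differential inequality (`exists_discrete_lifespan`)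
bounds `J`, the logarithm of the existence time, by a power of `1 / ε`. If both exponents vanish,
the high-frequency bound of the other component bounds a smaller power of its data by the same
increment, which improves the power of `1 / ε`. -/

namespace MixedWave

/-! ### Radial averages and the radial Laplacian. -/

/-- The average `∫₀¹ σ^{n-1} S(σ s) dσ`, so that `s ↦ s · radAvg n S s` is the radial derivative
of a radial function with Laplacian `S`. -/
noncomputable def radAvg (n : ℕ) (S : ℝ → ℝ) (s : ℝ) : ℝ :=
  ∫ σ in (0 : ℝ)..1, σ ^ (n - 1) * S (σ * s)

theorem continuous_radAvg (n : ℕ) {S : ℝ → ℝ} (hS : Continuous S) : Continuous (radAvg n S) := by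
  unfold radAvg
  apply intervalIntegral.continuous_parametric_intervalIntegral_of_continuous'
  simp only [Function.uncurry_def]
  fun_prop

theorem radAvg_le {n : ℕ} {S : ℝ → ℝ} (hS : Continuous S) {B s : ℝ} (hB : 0 ≤ B)
    (h : ∀ σ ∈ Icc (0 : ℝ) 1, S (σ * s) ≤ B) : radAvg n S s ≤ B := by
  have h1 : radAvg n S s ≤ ∫ σ in (0 : ℝ)..1, B := by
    unfold radAvg
    refine intervalIntegral.integral_mono_on zero_le_one
      (Continuous.intervalIntegrable (by fun_prop) _ _) (by simp) ?_
    intro σ hσ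
    have := h σ hσ
    have h2 : σ ^ (n - 1) ≤ 1 := pow_le_one₀ hσ.1 hσ.2
    have h3 : 0 ≤ σ ^ (n - 1) := pow_nonneg hσ.1 _
    nlinarith
  simpa using h1

theorem radAvg_nonneg {n : ℕ} {S : ℝ → ℝ} {s : ℝ}
    (h : ∀ σ ∈ Icc (0 : ℝ) 1, 0 ≤ S (σ * s)) : 0 ≤ radAvg n S s := by
  unfold radAvg
  refine intervalIntegral.integral_nonneg zero_le_one fun σ hσ => ?_
  exact mul_nonneg (pow_nonneg hσ.1 _) (h σ hσ)

theorem radAvg_sub {n : ℕ} {S S' : ℝ → ℝ} (hS : Continuous S) (hS' : Continuous S') (s : ℝ) :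
    radAvg n S s - radAvg n S' s = radAvg n (fun t => S t - S' t) s := by
  unfold radAvg
  rw [← intervalIntegral.integral_sub (Continuous.intervalIntegrable (by fun_prop) _ _)
    (Continuous.intervalIntegrable (by fun_prop) _ _)]
  congr 1; ext σ; ring

/-- Rescaling turns the average into `s ^ (-n)` times the primitive of `τ ^ (n - 1) * S τ`, and the
quotient rule applies. This is the divergence form `(r ^ (n - 1) F')' = r ^ (n - 1) S` of the radial
Laplacian, written for `a = F' / r`, which stays continuous at the origin. -/
theorem hasDerivAt_radAvg {n : ℕ} (hn : 1 ≤ n) {S : ℝ → ℝ} (hS : Continuous S) {r : ℝ}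
    (hr : 0 < r) :
    HasDerivAt (radAvg n S) ((S r - n * radAvg n S r) / r) r := by
  have key : ∀ s : ℝ, 0 < s →
      radAvg n S s = (∫ τ in (0 : ℝ)..s, τ ^ (n - 1) * S τ) / s ^ n := by
    intro s hs
    have h1 := intervalIntegral.integral_comp_mul_left (a := 0) (b := 1) (c := s)
      (fun τ => τ ^ (n - 1) * S τ) hs.ne'
    simp only [mul_zero, mul_one, smul_eq_mul] at h1
    have h2 : (∫ x in (0 : ℝ)..1, (s * x) ^ (n - 1) * S (s * x)) = s ^ (n - 1) * radAvg n S s := by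
      unfold radAvg
      rw [← intervalIntegral.integral_const_mul]
      congr 1; ext x; rw [mul_pow, mul_comm s x]; ring
    rw [h2] at h1
    obtain ⟨k, rfl⟩ : ∃ k, n = k + 1 := ⟨n - 1, by omega⟩
    simp only [Nat.add_sub_cancel] at *
    rw [eq_div_iff (by positivity)]
    calc radAvg (k + 1) S s * s ^ (k + 1) = s * (s ^ k * radAvg (k + 1) S s) := by ring
      _ = _ := by rw [h1]; field_simp
  have hP : HasDerivAt (fun s => ∫ τ in (0 : ℝ)..s, τ ^ (n - 1) * S τ) (r ^ (n - 1) * S r) r :=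
    intervalIntegral.integral_hasDerivAt_right (Continuous.intervalIntegrable (by fun_prop) _ _)
      (Continuous.stronglyMeasurableAtFilter (by fun_prop) _ _)
      (Continuous.continuousAt (by fun_prop))
  have hq := hP.div (hasDerivAt_pow n r) (by positivity)
  have : radAvg n S =ᶠ[𝓝 r] (fun s => (∫ τ in (0 : ℝ)..s, τ ^ (n - 1) * S τ) / s ^ n) := by
    filter_upwards [lt_mem_nhds hr] with s hs using key s hs
  refine (hq.congr_of_eventuallyEq this).congr_deriv ?_
  rw [key r hr]
  obtain ⟨k, rfl⟩ : ∃ k, n = k + 1 := ⟨n - 1, by omega⟩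
  simp only [Nat.add_sub_cancel]
  have : r ≠ 0 := hr.ne'
  field_simp
  ring

/-- `F(|x|)` is a radial function on `ℝⁿ` with gradient `a(|x|) x` and Laplacian `S(|x|)`. -/
structure IsRadialLaplacian (n : ℕ) (F a S : ℝ → ℝ) : Prop where
  continuous_a : Continuous a
  continuous_S : Continuous S
  hasDerivAt : ∀ r, HasDerivAt F (r * a r) r
  hasDerivAt_a : ∀ r, 0 < r → HasDerivAt a ((S r - n * a r) / r) r

theorem IsRadialLaplacian.continuous {n : ℕ} {F a S : ℝ → ℝ} (h : IsRadialLaplacian n F a S) :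
    Continuous F :=
  continuous_iff_continuousAt.2 fun r => (h.hasDerivAt r).continuousAt

/-! ### Existence of positive radial solutions by a weighted fixed point. -/

section Volterra

variable {G : ℝ → ℝ} {K : ℝ}

theorem integral_mul_exp_sq_le {N r : ℝ} (hN : 0 < N) :
    ∫ s in (0 : ℝ)..r, s * Real.exp (N * s ^ 2) ≤ Real.exp (N * r ^ 2) / (2 * N) := by
  have : ∀ s ∈ uIcc 0 r, HasDerivAt (fun s => Real.exp (N * s ^ 2) / (2 * N))
      (s * Real.exp (N * s ^ 2)) s := by
    intro s _
    have := ((((hasDerivAt_pow 2 s).const_mul N).exp).div_const (2 * N))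
    refine this.congr_deriv ?_
    field_simp
    push_cast; ring
  rw [intervalIntegral.integral_eq_sub_of_hasDerivAt this
    (Continuous.intervalIntegrable (by fun_prop) _ _)]
  have : 0 < Real.exp (N * 0 ^ 2) / (2 * N) := by positivity
  linarith

/-- The Gaussian weight makes the iteration contract globally, whatever the size of `G`: the
primitive of `s * exp (K s²)` carries the factor `1 / (2K)`, which cancels the bound `K` on `G` and
leaves the ratio `1 / 2`. -/
theorem abs_integral_radAvg_le {n : ℕ} (hG : Continuous G) (hK : 0 < K) (hGK : ∀ r, |G r| ≤ K)
    {z : ℝ → ℝ} (hz : Continuous z) {B : ℝ} (hB : 0 ≤ B) (hzB : ∀ r, |z r| ≤ B) {r : ℝ}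
    (hr : 0 ≤ r) :
    |∫ s in (0 : ℝ)..r, s * radAvg n (fun t => G t * (Real.exp (K * t ^ 2) * z t)) s|
      ≤ B / 2 * Real.exp (K * r ^ 2) := by
  have hc : Continuous (fun t => G t * (Real.exp (K * t ^ 2) * z t)) := by fun_prop
  have hc' : Continuous (radAvg n (fun t => G t * (Real.exp (K * t ^ 2) * z t))) :=
    continuous_radAvg n hc
  have hb : ∀ s : ℝ, |radAvg n (fun t => G t * (Real.exp (K * t ^ 2) * z t)) s|
      ≤ K * B * Real.exp (K * s ^ 2) := by
    intro s
    have hpt : ∀ σ ∈ Icc (0 : ℝ) 1, |G (σ * s) * (Real.exp (K * (σ * s) ^ 2) * z (σ * s))|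
        ≤ K * B * Real.exp (K * s ^ 2) := by
      intro σ hσ
      rw [abs_mul, abs_mul, abs_of_pos (Real.exp_pos _)]
      have h1 : Real.exp (K * (σ * s) ^ 2) ≤ Real.exp (K * s ^ 2) := by
        apply Real.exp_le_exp.2
        apply mul_le_mul_of_nonneg_left _ hK.le
        rw [mul_pow]
        have : σ ^ 2 ≤ 1 := pow_le_one₀ hσ.1 hσ.2
        nlinarith [sq_nonneg s]
      calc |G (σ * s)| * (Real.exp (K * (σ * s) ^ 2) * |z (σ * s)|)
          ≤ K * (Real.exp (K * s ^ 2) * B) := by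
            gcongr
            · exact hGK _
            · exact hzB _
        _ = _ := by ring
    rw [abs_le]
    constructor
    · have h2 := radAvg_le (n := n) (S := fun t => -(G t * (Real.exp (K * t ^ 2) * z t))) hc.neg
        (s := s) (B := K * B * Real.exp (K * s ^ 2)) (by positivity)
        (fun σ hσ => (neg_le_abs _).trans (hpt σ hσ))
      have h3 : radAvg n (fun t => -(G t * (Real.exp (K * t ^ 2) * z t))) s
          = -radAvg n (fun t => G t * (Real.exp (K * t ^ 2) * z t)) s := by
        simp [radAvg]
      linarith
    · exact radAvg_le hc (by positivity) (fun σ hσ => (le_abs_self _).trans (hpt σ hσ))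
  calc |∫ s in (0 : ℝ)..r, s * radAvg n (fun t => G t * (Real.exp (K * t ^ 2) * z t)) s|
      ≤ ∫ s in (0 : ℝ)..r, K * B * (s * Real.exp (K * s ^ 2)) := by
        rw [← Real.norm_eq_abs]
        refine intervalIntegral.norm_integral_le_of_norm_le hr ?_
          (Continuous.intervalIntegrable (by fun_prop) _ _)
        refine Eventually.of_forall fun s hs => ?_
        rw [Real.norm_eq_abs, abs_mul, abs_of_pos hs.1]
        have := mul_le_mul_of_nonneg_left (hb s) hs.1.le
        linarith
    _ = K * B * ∫ s in (0 : ℝ)..r, s * Real.exp (K * s ^ 2) :=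
        intervalIntegral.integral_const_mul _ _
    _ ≤ K * B * (Real.exp (K * r ^ 2) / (2 * K)) := by
        gcongr
        exact integral_mul_exp_sq_le hK
    _ = _ := by field_simp

/-- The Volterra operator of the radial equation `Δφ = G φ`, `φ(0) = 1`, conjugated with the
weight `exp (K r²)`. -/
noncomputable def volterra (n : ℕ) (hG : Continuous G) (hK : 0 < K) (hGK : ∀ r, |G r| ≤ K)
    (z : BoundedContinuousFunction ℝ ℝ) : BoundedContinuousFunction ℝ ℝ :=
  BoundedContinuousFunction.ofNormedAddCommGroup
    (fun r => Real.exp (-(K * r ^ 2)) *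
      (1 + ∫ s in (0 : ℝ)..|r|, s * radAvg n (fun t => G t * (Real.exp (K * t ^ 2) * z t)) s))
    (by
      have hc : Continuous (radAvg n (fun t => G t * (Real.exp (K * t ^ 2) * z t))) :=
        continuous_radAvg n (by fun_prop)
      have : Continuous (fun r => ∫ s in (0 : ℝ)..r,
          s * radAvg n (fun t => G t * (Real.exp (K * t ^ 2) * z t)) s) :=
        intervalIntegral.continuous_primitive
          (fun a b => Continuous.intervalIntegrable (by fun_prop) _ _) 0
      have h2 := this.comp continuous_abs
      simp only [Function.comp_def] at h2
      fun_prop)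
    (1 + ‖z‖ / 2)
    (by
      intro r
      have h := abs_integral_radAvg_le (n := n) hG hK hGK z.continuous (norm_nonneg z)
        (fun r => z.norm_coe_le_norm r) (abs_nonneg r)
      rw [sq_abs] at h
      rw [norm_mul, Real.norm_eq_abs, Real.norm_eq_abs, abs_of_pos (Real.exp_pos _)]
      have h3 : 1 ≤ Real.exp (K * r ^ 2) := Real.one_le_exp (by positivity)
      calc Real.exp (-(K * r ^ 2)) * |1 + ∫ s in (0 : ℝ)..|r|,
            s * radAvg n (fun t => G t * (Real.exp (K * t ^ 2) * z t)) s|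
          ≤ Real.exp (-(K * r ^ 2)) *
              (Real.exp (K * r ^ 2) + ‖z‖ / 2 * Real.exp (K * r ^ 2)) := by
            gcongr
            refine (abs_add_le _ _).trans ?_
            rw [abs_one]
            exact add_le_add h3 h
        _ = 1 + ‖z‖ / 2 := by
            rw [Real.exp_neg]; field_simp)

theorem volterra_contracting (n : ℕ) (hG : Continuous G) (hK : 0 < K) (hGK : ∀ r, |G r| ≤ K) :
    ContractingWith (1 / 2) (volterra n hG hK hGK) := by
  refine ⟨by norm_num, LipschitzWith.of_dist_le_mul fun z z' => ?_⟩
  rw [BoundedContinuousFunction.dist_le (by positivity)]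
  intro r
  have h := abs_integral_radAvg_le (n := n) hG hK hGK (z - z').continuous (norm_nonneg (z - z'))
    (fun r => (z - z').norm_coe_le_norm r) (abs_nonneg r)
  rw [sq_abs] at h
  have hc : ∀ z : BoundedContinuousFunction ℝ ℝ,
      Continuous (radAvg n (fun t => G t * (Real.exp (K * t ^ 2) * z t))) :=
    fun z => continuous_radAvg n (by fun_prop)
  have h1 : (∫ s in (0 : ℝ)..|r|, s * radAvg n (fun t => G t * (Real.exp (K * t ^ 2) * z t)) s)
      - (∫ s in (0 : ℝ)..|r|, s * radAvg n (fun t => G t * (Real.exp (K * t ^ 2) * z' t)) s)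
      = ∫ s in (0 : ℝ)..|r|,
        s * radAvg n (fun t => G t * (Real.exp (K * t ^ 2) * (z - z') t)) s := by
    have hz := hc z
    have hz' := hc z'
    rw [← intervalIntegral.integral_sub (Continuous.intervalIntegrable (by fun_prop) _ _)
      (Continuous.intervalIntegrable (by fun_prop) _ _)]
    congr 1; ext s
    rw [← mul_sub, radAvg_sub (by fun_prop) (by fun_prop)]
    congr 2; ext t; simp; ring
  rw [← h1] at h
  rw [Real.dist_eq, dist_eq_norm]
  simp only [volterra, BoundedContinuousFunction.coe_ofNormedAddCommGroup]
  rw [← mul_sub, abs_mul, abs_of_pos (Real.exp_pos _), add_sub_add_left_eq_sub]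
  calc _ ≤ Real.exp (-(K * r ^ 2)) * (‖z - z'‖ / 2 * Real.exp (K * r ^ 2)) := by gcongr
    _ = _ := by
      rw [Real.exp_neg]; push_cast; field_simp

/-- Existence of the positive radial solution of `Δφ = G φ`, `φ(0) = 1`. -/
theorem exists_radial_solution {n : ℕ} (hn : 1 ≤ n) (hG : Continuous G) (hG0 : ∀ r, 0 ≤ G r)
    (hGK : ∃ K, ∀ r, G r ≤ K) :
    ∃ φ a : ℝ → ℝ, IsRadialLaplacian n φ a (fun r => G r * φ r) ∧ φ 0 = 1 ∧
      (∀ r, 0 ≤ r → 1 ≤ φ r) ∧ (∀ r, 0 ≤ r → 0 ≤ a r) := by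
  obtain ⟨K', hK'⟩ := hGK
  obtain ⟨K, hK, hGK⟩ : ∃ K, 0 < K ∧ ∀ r, |G r| ≤ K :=
    ⟨max K' 1, by positivity, fun r => by
      rw [abs_of_nonneg (hG0 r)]; exact (hK' r).trans (le_max_left _ _)⟩
  have hT := volterra_contracting n hG hK hGK
  set z := ContractingWith.fixedPoint _ hT with hzdef
  have hfix : volterra n hG hK hGK z = z := ContractingWith.fixedPoint_isFixedPt hT
  -- The operator preserves nonnegative functions, so its fixed point, the limit of the iterates of
  -- `0`, is nonnegative.
  have hz0 : ∀ r, 0 ≤ z r := by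
    intro r
    have hlim := ContractingWith.tendsto_iterate_fixedPoint hT 0
    have hev : Tendsto (fun k => ((volterra n hG hK hGK)^[k] 0) r) atTop (𝓝 (z r)) :=
      ((continuous_eval_const r).tendsto _).comp hlim
    refine ge_of_tendsto' hev fun k => ?_
    have : ∀ k, ∀ r, 0 ≤ ((volterra n hG hK hGK)^[k] 0) r := by
      intro k
      induction k with
      | zero => intro r; simp
      | succ k ih =>
        intro r
        rw [Function.iterate_succ_apply']
        simp only [volterra, BoundedContinuousFunction.coe_ofNormedAddCommGroup]
        refine mul_nonneg (Real.exp_pos _).le (add_nonneg zero_le_one ?_)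
        refine intervalIntegral.integral_nonneg (abs_nonneg r) fun s hs => ?_
        refine mul_nonneg hs.1 (radAvg_nonneg fun σ _ => ?_)
        exact mul_nonneg (hG0 _) (mul_nonneg (Real.exp_pos _).le (ih _))
    exact this k r
  set a := radAvg n (fun t => G t * (Real.exp (K * t ^ 2) * z t)) with ha
  have hac : Continuous a := continuous_radAvg n (by fun_prop)
  set φ : ℝ → ℝ := fun r => 1 + ∫ s in (0 : ℝ)..r, s * a s with hφ
  have hder : ∀ r, HasDerivAt φ (r * a r) r := by
    intro r
    refine HasDerivAt.const_add _ (intervalIntegral.integral_hasDerivAt_right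
      (Continuous.intervalIntegrable (by fun_prop) _ _)
      (Continuous.stronglyMeasurableAtFilter (by fun_prop) _ _)
      (Continuous.continuousAt (by fun_prop)))
  have hφc : Continuous φ := continuous_iff_continuousAt.2 fun r => (hder r).continuousAt
  -- The operator integrates up to `|r|`, so removing the weight identifies its fixed point with `φ`
  -- only at nonnegative radii, which is all that the radial equation needs.
  have hφz : ∀ r, 0 ≤ r → Real.exp (K * r ^ 2) * z r = φ r := by
    intro r hr
    have h := congrArg (fun w : BoundedContinuousFunction ℝ ℝ => w r) hfix
    simp only [volterra, BoundedContinuousFunction.coe_ofNormedAddCommGroup, abs_of_nonneg hr] at h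
    rw [← h, ← mul_assoc, ← Real.exp_add]
    simp [hφ, ha]
  have ha0 : ∀ r, 0 ≤ r → 0 ≤ a r := fun r _ => radAvg_nonneg fun σ _ =>
    mul_nonneg (hG0 _) (mul_nonneg (Real.exp_pos _).le (hz0 _))
  refine ⟨φ, a, ⟨hac, by fun_prop, hder, ?_⟩, by simp [hφ], ?_, ha0⟩
  · intro r hr
    have := hasDerivAt_radAvg hn (S := fun t => G t * (Real.exp (K * t ^ 2) * z t))
      (by fun_prop) hr
    rw [← ha] at this
    simpa only [hφz r hr.le] using this
  · intro r hr
    have : 0 ≤ ∫ s in (0 : ℝ)..r, s * a s :=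
      intervalIntegral.integral_nonneg hr fun s hs => mul_nonneg hs.1 (ha0 s hs.1)
    simp only [hφ]; linarith

end Volterra

/-! ### Riccati estimates and the growth of the radial solutions. -/

section Growth

variable {n : ℕ} {φ a G : ℝ → ℝ}

theorem antitoneOn_Ici_of_hasDerivAt_nonpos {f f' : ℝ → ℝ} {r₀ : ℝ}
    (hc : ContinuousOn f (Ici r₀)) (h : ∀ r, r₀ < r → HasDerivAt f (f' r) r)
    (h' : ∀ r, r₀ < r → f' r ≤ 0) : AntitoneOn f (Ici r₀) := by
  refine antitoneOn_of_deriv_nonpos (convex_Ici r₀) hc ?_ ?_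
  · intro r hr
    rw [interior_Ici] at hr
    exact (h r hr).differentiableAt.differentiableWithinAt
  · intro r hr
    rw [interior_Ici] at hr
    rw [(h r hr).deriv]; exact h' r hr

/-- The logarithmic derivative of the radial solution is bounded by any supersolution of the
Riccati equation. -/
theorem logDeriv_le_of_supersolution (hn : 3 ≤ n)
    (h : IsRadialLaplacian n φ a (fun r => G r * φ r))
    (hφ : ∀ r, 0 ≤ r → 1 ≤ φ r) (ha : ∀ r, 0 ≤ r → 0 ≤ a r) {M M' : ℝ → ℝ}
    (hMc : ContinuousOn M (Ici 0)) (hM : ∀ r, 0 < r → HasDerivAt M (M' r) r)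
    (hMG : ∀ r, 0 < r → r ^ 2 * G r ≤ 2 * r * M r + r ^ 2 * M' r) {r : ℝ} (hr : 0 < r) :
    r * a r / φ r ≤ M r := by
  have hφc := h.continuous
  have hac := h.continuous_a
  -- With `ρ = r a / φ`, the Riccati equation times `r²` reads `(r² ρ)' = r² G - (n - 3) r ρ - r²
  -- ρ²`. For `n ≥ 3` the last two terms are nonpositive, so `r² (ρ - M)` decreases from its value
  -- `0` at the origin.
  have hanti : AntitoneOn (fun r => r ^ 3 * a r / φ r - r ^ 2 * M r) (Ici 0) := by
    refine antitoneOn_Ici_of_hasDerivAt_nonpos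
      (f' := fun r => (((3 : ℕ) * r ^ (3 - 1)) * a r + r ^ 3 * ((G r * φ r - n * a r) / r)) * φ r
          / φ r ^ 2 - (r ^ 3 * a r) * (r * a r) / φ r ^ 2
          - (((2 : ℕ) * r ^ (2 - 1)) * M r + r ^ 2 * M' r)) ?_ ?_ ?_
    · refine ContinuousOn.sub ?_ (by fun_prop)
      refine ContinuousOn.div (by fun_prop) (by fun_prop) fun s hs => ?_
      have := hφ s hs; positivity
    · intro s hs
      have h0 : φ s ≠ 0 := by have := hφ s hs.le; positivity
      refine ((((hasDerivAt_pow 3 s).fun_mul (h.hasDerivAt_a s hs)).fun_div (h.hasDerivAt s) h0).fun_sub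
        ((hasDerivAt_pow 2 s).fun_mul (hM s hs))).congr_deriv ?_
      ring
    · intro s hs
      have h1 := hφ s hs.le
      have h2 := ha s hs.le
      have h3 := hMG s hs
      have hn' : (3 : ℝ) ≤ n := by exact_mod_cast hn
      have e : (((3 : ℕ) * s ^ (3 - 1)) * a s + s ^ 3 * ((G s * φ s - n * a s) / s)) * φ s
          / φ s ^ 2 - (s ^ 3 * a s) * (s * a s) / φ s ^ 2
          = s ^ 2 * G s - (n - 3) * s ^ 2 * (a s / φ s) - s ^ 4 * (a s / φ s) ^ 2 := by
        have : φ s ≠ 0 := by positivity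
        field_simp
        push_cast; ring
      rw [e]
      have : 0 ≤ ((n : ℝ) - 3) * s ^ 2 * (a s / φ s) := by
        apply mul_nonneg (mul_nonneg (by linarith) (by positivity)) (by positivity)
      have : 0 ≤ s ^ 4 * (a s / φ s) ^ 2 := by positivity
      push_cast
      simp only [pow_one]
      linarith
  have h0 := hanti (mem_Ici.2 le_rfl) (mem_Ici.2 hr.le) hr.le
  simp only [ne_eq, OfNat.ofNat_ne_zero, not_false_eq_true, zero_pow, zero_mul, zero_div,
    sub_zero] at h0
  have h1 : r ^ 3 * a r / φ r = r ^ 2 * (r * a r / φ r) := by ring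
  rw [h1, ← mul_sub] at h0
  have : 0 < r ^ 2 := by positivity
  nlinarith

/-- Exponential decay of `φ` relative to the free solution beyond the radius `1/lam`. -/
theorem log_solution_le (hn : 3 ≤ n) {lam a₁ a₂ β γ : ℝ} (hlam : 0 < lam)
    (ha₁ : 0 ≤ a₁) (ha₂ : 0 ≤ a₂) (hβ : 1 < β) (hγ : 1 < γ)
    (h : IsRadialLaplacian n φ a (fun r => G r * φ r))
    (hφ : ∀ r, 0 ≤ r → 1 ≤ φ r) (ha : ∀ r, 0 ≤ r → 0 ≤ a r)
    (hG : ∀ r, 0 ≤ r → G r ≤ lam ^ 2 + lam * (a₁ * (1 + r) ^ (-β)) + a₂ * (1 + r) ^ (-γ))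
    {r₀ r : ℝ} (hr₀ : 0 < r₀) (hr : r₀ ≤ r) :
    2 * lam * (Real.log (φ r) + ((n : ℝ) - 1) / 2 * Real.log r - lam * r) - lam
      ≤ 2 * lam * (Real.log (φ r₀) + ((n : ℝ) - 1) / 2 * Real.log r₀ - lam * r₀)
        + (r₀ * a r₀ / φ r₀ + ((n : ℝ) - 1) / 2 / r₀ - lam)
        + lam * a₁ * (1 + r₀) ^ (1 - β) / (β - 1) + a₂ * (1 + r₀) ^ (1 - γ) / (γ - 1)
        + ((n : ℝ) - 1) * (n - 3) / 4 / r₀ := by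
  have hφc := h.continuous
  have hac := h.continuous_a
  have hn' : (3 : ℝ) ≤ n := by exact_mod_cast hn
  set m : ℝ := ((n : ℝ) - 1) / 2 with hm
  set c : ℝ := ((n : ℝ) - 1) * (n - 3) / 4 with hc
  have hc0 : 0 ≤ c := by
    rw [hc]; apply div_nonneg (mul_nonneg _ _) <;> linarith
  -- With `y = φ' / φ + m / s` the Riccati equation becomes `y' = G - y² + c / s²`, and `y - lam` is
  -- the derivative of `log φ + m log s - lam s`. Hence `(y - lam)' + 2 lam (y - lam) = G - lam² + c
  -- / s² - (y - lam)²`. The last three terms of `Q` have derivatives cancelling the bounds on the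
  -- damping, the potential and `c / s²`, so only the negative square can remain.
  let Q : ℝ → ℝ := fun s => (s * a s / φ s + m / s - lam)
    + 2 * lam * (Real.log (φ s) + m * Real.log s - lam * s)
    + lam * a₁ * ((1 + s) ^ (1 - β) / (β - 1)) + a₂ * ((1 + s) ^ (1 - γ) / (γ - 1)) + c / s
  have hpow : ∀ δ : ℝ, 1 < δ → ∀ s, 0 < s →
      HasDerivAt (fun s : ℝ => (1 + s) ^ (1 - δ) / (δ - 1)) (-(1 + s) ^ (-δ)) s := by
    intro δ hδ s hs
    have h1 : HasDerivAt (fun s : ℝ => 1 + s) 1 s := (hasDerivAt_id s).const_add 1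
    refine ((h1.rpow_const (p := 1 - δ) (Or.inl (by positivity))).div_const (δ - 1)).congr_deriv ?_
    have : δ - 1 ≠ 0 := by linarith
    rw [show 1 - δ - 1 = -δ by ring]
    field_simp
    ring
  have hder : ∀ s, 0 < s → HasDerivAt Q
      ((G s - s * a s / φ s * ((n : ℝ) - 1) / s - (s * a s / φ s) ^ 2 - m / s ^ 2)
        + 2 * lam * (s * a s / φ s + m / s - lam)
        + lam * a₁ * (-(1 + s) ^ (-β)) + a₂ * (-(1 + s) ^ (-γ)) - c / s ^ 2) s := by
    intro s hs
    have h0 : φ s ≠ 0 := by have := hφ s hs.le; positivity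
    have hs0 : s ≠ 0 := hs.ne'
    have d1 := (((hasDerivAt_id s).fun_mul (h.hasDerivAt_a s hs)).fun_div (h.hasDerivAt s) h0)
    have d2 := (hasDerivAt_inv hs0).const_mul m
    have d3 := (h.hasDerivAt s).log h0
    have d4 := (Real.hasDerivAt_log hs0).const_mul m
    have d5 := (hasDerivAt_id s).const_mul lam
    have d6 := (hpow β hβ s hs).const_mul (lam * a₁)
    have d7 := (hpow γ hγ s hs).const_mul a₂
    have d8 := (hasDerivAt_inv hs0).const_mul c
    have := ((((((d1.fun_add d2).sub_const lam).fun_add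
      (((d3.fun_add d4).fun_sub d5).const_mul (2 * lam))).fun_add d6).fun_add d7).fun_add d8)
    refine (this.congr_of_eventuallyEq (Eventually.of_forall fun s => ?_)).congr_deriv ?_
    · simp only [Q, id, div_eq_mul_inv]
    · simp only [id]
      field_simp
      ring
  have hanti : AntitoneOn Q (Ici r₀) := by
    refine antitoneOn_Ici_of_hasDerivAt_nonpos
      (fun s hs => (hder s (hr₀.trans_le hs)).continuousAt.continuousWithinAt)
      (fun s hs => hder s (hr₀.trans hs)) ?_
    intro s hs
    have hs0 : 0 < s := hr₀.trans hs
    have hG' := hG s hs0.le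
    set ρ := s * a s / φ s
    have e : (ρ + m / s) ^ 2 = ρ ^ 2 + ρ * ((n : ℝ) - 1) / s + m / s ^ 2 + c / s ^ 2 := by
      rw [hm, hc]; field_simp; ring
    nlinarith [sq_nonneg (ρ + m / s - lam)]
  have hQ := hanti (mem_Ici.2 le_rfl) (mem_Ici.2 hr) hr
  have hrpos : 0 < r := hr₀.trans_le hr
  have p1 : 0 ≤ r * a r / φ r := by
    have := hφ r hrpos.le; have := ha r hrpos.le; positivity
  have p2 : 0 ≤ m / r := by rw [hm]; apply div_nonneg _ hrpos.le; linarith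
  have p3 : 0 ≤ lam * a₁ * ((1 + r) ^ (1 - β) / (β - 1)) :=
    mul_nonneg (by positivity) (div_nonneg (by positivity) (by linarith))
  have p4 : 0 ≤ a₂ * ((1 + r) ^ (1 - γ) / (γ - 1)) :=
    mul_nonneg ha₂ (div_nonneg (by positivity) (by linarith))
  have p5 : 0 ≤ c / r := by positivity
  simp only [Q] at hQ
  simp only [mul_div_assoc] at hQ p1 p2 p3 p4 p5 ⊢
  linarith

/-- The three terms of the majorant answer the three terms bounding `g`: `lam² s` absorbs `lam²`;
the constant `lam a₁ / 2` absorbs the damping, as `s (1 + s) ^ (-β) ≤ 1`; and `A (1 + s) ^ (-κ)`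
absorbs the potential. For the latter, differentiating the power costs at most `κ` out of the
coefficient `2`, which explains `a₂ = A (2 - κ)`. -/
theorem majorant_supersolution {lam a₁ a₂ A β γ κ g s : ℝ} (hlam : 0 < lam) (ha₁ : 0 ≤ a₁)
    (hA0 : 0 ≤ A) (hA2 : a₂ = A * (2 - κ)) (hβ : 1 < β) (hκ1 : 0 < κ) (hκγ : κ ≤ γ - 1)
    (hs : 0 < s) (hκ2 : 0 ≤ 2 - κ)
    (h1 : g ≤ lam ^ 2 + lam * (a₁ * (1 + s) ^ (-β)) + a₂ * (1 + s) ^ (-γ)) :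
    s ^ 2 * g ≤ 2 * s * (lam ^ 2 * s + lam * a₁ / 2 + A * (1 + s) ^ (-κ))
      + s ^ 2 * (lam ^ 2 + A * (-κ * (1 + s) ^ (-κ - 1))) := by
  have ha₂ : 0 ≤ a₂ := hA2 ▸ mul_nonneg hA0 hκ2
  have hx : (1 + s) ^ (-κ) = (1 + s) * (1 + s) ^ (-κ - 1) := by
    rw [← Real.rpow_one_add' (by positivity) (by linarith)]; ring_nf
  have q1 : s * (1 + s) ^ (-β) ≤ 1 := by
    have : (1 + s) ^ (-β) ≤ (1 + s) ^ (-1 : ℝ) :=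
      Real.rpow_le_rpow_of_exponent_le (by linarith) (by linarith)
    rw [Real.rpow_neg_one] at this
    calc s * (1 + s) ^ (-β) ≤ s * (1 + s)⁻¹ := by gcongr
      _ ≤ 1 := by rw [← div_eq_mul_inv, div_le_one (by positivity)]; linarith
  have q2 : s * (1 + s) ^ (-γ) ≤ (1 + s) ^ (-κ) := by
    calc s * (1 + s) ^ (-γ) ≤ (1 + s) * (1 + s) ^ (-γ) := by gcongr; linarith
      _ = (1 + s) ^ (1 + -γ) := by rw [← Real.rpow_one_add' (by positivity) (by linarith)]
      _ ≤ (1 + s) ^ (-κ) := Real.rpow_le_rpow_of_exponent_le (by linarith) (by linarith)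
  have q3 : s ^ 2 * (a₂ * (1 + s) ^ (-γ)) ≤ a₂ * s * (1 + s) ^ (-κ) := by
    have := mul_le_mul_of_nonneg_left q2 (mul_nonneg ha₂ hs.le)
    linarith
  have q4 : s ^ 2 * (lam * (a₁ * (1 + s) ^ (-β))) ≤ lam * a₁ * s := by
    have := mul_le_mul_of_nonneg_left q1 (mul_nonneg (mul_nonneg hlam.le ha₁) hs.le)
    linarith
  have q5 : s ^ 2 * (1 + s) ^ (-κ - 1) ≤ s * (1 + s) ^ (-κ) := by
    rw [hx]
    have : 0 ≤ (1 + s) ^ (-κ - 1) := by positivity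
    nlinarith [mul_nonneg hs.le this]
  have q6 : a₂ * s * (1 + s) ^ (-κ)
      ≤ 2 * s * (A * (1 + s) ^ (-κ)) + s ^ 2 * (A * (-κ * (1 + s) ^ (-κ - 1))) := by
    have := mul_le_mul_of_nonneg_left q5 (mul_nonneg hA0 (by linarith : 0 ≤ κ))
    rw [hA2]; linarith
  have h2 := mul_le_mul_of_nonneg_left h1 (sq_nonneg s)
  have : 0 ≤ lam ^ 2 * s ^ 2 := by positivity
  linarith

/-- Beyond the radius `1 / lam` one has `1 + lam r ≤ 2 lam r`, so replacing `lam r` by `1 + lam r`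
costs the factor `2 ^ m`. -/
theorem le_of_log_le {lam r B m y : ℝ} (hlam : 0 < lam) (hr : 1 ≤ lam * r) (hr0 : 0 < r)
    (hm0 : 0 ≤ m) (hy : 0 < y) (h : Real.log y + m * Real.log r - lam * r ≤ B - m * Real.log lam) :
    y ≤ Real.exp B * 2 ^ m * (1 + lam * r) ^ (-m) * Real.exp (lam * r) := by
  have h2 : y ≤ Real.exp B * (lam * r) ^ (-m) * Real.exp (lam * r) := by
    rw [Real.rpow_def_of_pos (by positivity), ← Real.exp_add, ← Real.exp_add,
      ← Real.log_le_iff_le_exp (by positivity), Real.log_mul hlam.ne' hr0.ne']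
    linarith
  have h3 : (lam * r) ^ (-m) ≤ 2 ^ m * (1 + lam * r) ^ (-m) := by
    rw [Real.rpow_neg (by positivity), Real.rpow_neg (by positivity), ← div_eq_mul_inv,
      inv_le_comm₀ (by positivity) (by positivity), inv_div, div_le_iff₀ (by positivity),
      ← Real.mul_rpow (by positivity) (by positivity)]
    exact Real.rpow_le_rpow (by positivity) (by linarith) hm0
  calc y ≤ Real.exp B * (lam * r) ^ (-m) * Real.exp (lam * r) := h2
    _ ≤ Real.exp B * (2 ^ m * (1 + lam * r) ^ (-m)) * Real.exp (lam * r) := by gcongr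
    _ = _ := by ring

set_option maxHeartbeats 1000000 in
/-- Uniform upper bound for the radial solutions of `Δφ = (lam² + lam d + v) φ`. -/
theorem exists_solution_bound (hn : 3 ≤ n) {a₁ a₂ β γ : ℝ} (ha₁ : 0 ≤ a₁) (ha₂ : 0 ≤ a₂)
    (hβ : 1 < β) (hγ : 2 < γ) :
    ∃ C : ℝ, 0 < C ∧ ∀ (lam : ℝ) (φ a G : ℝ → ℝ), 0 < lam → lam ≤ 1 →
      IsRadialLaplacian n φ a (fun r => G r * φ r) → φ 0 = 1 →
      (∀ r, 0 ≤ r → 1 ≤ φ r) → (∀ r, 0 ≤ r → 0 ≤ a r) →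
      (∀ r, 0 ≤ r → G r ≤ lam ^ 2 + lam * (a₁ * (1 + r) ^ (-β)) + a₂ * (1 + r) ^ (-γ)) →
      ∀ r, 0 ≤ r → φ r ≤ C * (1 + lam * r) ^ (-(((n : ℝ) - 1) / 2)) * Real.exp (lam * r) := by
  have hn' : (3 : ℝ) ≤ n := by exact_mod_cast hn
  set m : ℝ := ((n : ℝ) - 1) / 2 with hm
  have hm0 : 0 ≤ m := by rw [hm]; linarith
  -- `κ > 1` makes the majorant term `(1 + s) ^ (-κ)` integrable, `κ < 2` makes it a supersolution,
  -- and `κ ≤ γ - 1` lets it dominate the potential; such a `κ` exists because `γ > 2`.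
  obtain ⟨κ, hκ1, hκ2, hκγ⟩ : ∃ κ : ℝ, 1 < κ ∧ κ < 2 ∧ κ ≤ γ - 1 :=
    ⟨min (γ - 1) (3 / 2), lt_min (by linarith) (by norm_num),
      (min_le_right _ _).trans_lt (by norm_num), min_le_left _ _⟩
  set A : ℝ := a₂ / (2 - κ) with hA
  have hA0 : 0 ≤ A := div_nonneg ha₂ (by linarith)
  set C₀ : ℝ := 1 / 2 + a₁ / 2 + A / (κ - 1) with hC₀
  have hC₀0 : 0 ≤ C₀ := by
    have : 0 ≤ A / (κ - 1) := div_nonneg hA0 (by linarith)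
    rw [hC₀]; positivity
  set c : ℝ := ((n : ℝ) - 1) * (n - 3) / 4 with hc
  have hc0 : 0 ≤ c := by
    rw [hc]; apply div_nonneg (mul_nonneg _ _) <;> linarith
  set B : ℝ := C₀ + (1 + a₁ / 2 + A + m + a₁ / (β - 1) + a₂ / (γ - 1) + c) / 2 with hB
  have hB0 : C₀ ≤ B := by
    have : 0 ≤ a₁ / (β - 1) := div_nonneg ha₁ (by linarith)
    have : 0 ≤ a₂ / (γ - 1) := div_nonneg ha₂ (by linarith)
    rw [hB]; linarith
  refine ⟨Real.exp B * 2 ^ m, by positivity, ?_⟩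
  intro lam φ a G hlam hlam1 h h01 hφ ha hG
  have hφc := h.continuous
  have hac := h.continuous_a
  have hpw : ∀ s : ℝ, 0 < s →
      HasDerivAt (fun s : ℝ => (1 + s) ^ (-κ)) (-κ * (1 + s) ^ (-κ - 1)) s := by
    intro s hs
    have h1 : HasDerivAt (fun s : ℝ => 1 + s) 1 s := (hasDerivAt_id s).const_add 1
    refine (h1.rpow_const (p := -κ) (Or.inl (by positivity))).congr_deriv ?_
    ring
  have hpc : ∀ e : ℝ, ContinuousOn (fun s : ℝ => (1 + s) ^ e) (Ici 0) := by
    intro e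
    refine ContinuousOn.rpow_const (by fun_prop) fun s hs => Or.inl ?_
    have : (0 : ℝ) ≤ s := hs
    positivity
  let M : ℝ → ℝ := fun s => lam ^ 2 * s + lam * a₁ / 2 + A * (1 + s) ^ (-κ)
  have hρ : ∀ s, 0 < s → s * a s / φ s ≤ M s := by
    intro s hs
    refine logDeriv_le_of_supersolution (M := M)
      (M' := fun s => lam ^ 2 + A * (-κ * (1 + s) ^ (-κ - 1))) hn h hφ ha ?_ ?_ ?_ hs
    · have := hpc (-κ)
      simp only [M]; fun_prop
    · intro s hs
      refine ((((hasDerivAt_id s).const_mul (lam ^ 2)).add_const (lam * a₁ / 2)).fun_add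
        ((hpw s hs).const_mul A)).congr_deriv ?_
      rw [mul_one]
    · intro s hs
      have hA2 : a₂ = A * (2 - κ) := by
        rw [hA]; field_simp [show (2 - κ) ≠ 0 by linarith]
      exact majorant_supersolution hlam ha₁ hA0 hA2 hβ (by linarith) hκγ hs (by linarith) (hG s hs.le)
  have hlog : ∀ s, 0 ≤ s → Real.log (φ s)
      ≤ lam ^ 2 * s ^ 2 / 2 + lam * a₁ / 2 * s + A / (κ - 1) := by
    intro s hs
    have hpw' : ∀ s : ℝ, 0 < s →
        HasDerivAt (fun s : ℝ => (1 + s) ^ (1 - κ)) ((1 - κ) * (1 + s) ^ (-κ)) s := by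
      intro s hs
      have h1 : HasDerivAt (fun s : ℝ => 1 + s) 1 s := (hasDerivAt_id s).const_add 1
      refine (h1.rpow_const (p := 1 - κ) (Or.inl (by positivity))).congr_deriv ?_
      rw [show 1 - κ - 1 = -κ by ring]; ring
    have hanti : AntitoneOn (fun s => Real.log (φ s) - lam ^ 2 / 2 * s ^ 2 - lam * a₁ / 2 * s
        + A / (κ - 1) * (1 + s) ^ (1 - κ)) (Ici 0) := by
      refine antitoneOn_Ici_of_hasDerivAt_nonpos (f' := fun s => s * a s / φ s - M s) ?_ ?_ ?_
      · have := hpc (1 - κ)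
        have h2 : ContinuousOn (fun s => Real.log (φ s)) (Ici 0) := by
          refine ContinuousOn.log (by fun_prop) fun s hs => ?_
          have := hφ s hs; positivity
        fun_prop
      · intro s hs
        have h0 : φ s ≠ 0 := by have := hφ s hs.le; positivity
        refine (((((h.hasDerivAt s).log h0).sub ((hasDerivAt_pow 2 s).const_mul (lam ^ 2 / 2))).sub
          ((hasDerivAt_id s).const_mul (lam * a₁ / 2))).add
          ((hpw' s hs).const_mul (A / (κ - 1)))).congr_deriv ?_
        have : κ - 1 ≠ 0 := by linarith
        simp only [M]
        push_cast
        field_simp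
        ring
      · intro s hs; have := hρ s hs; linarith
    have h0 := hanti (mem_Ici.2 le_rfl) (mem_Ici.2 hs) hs
    simp only [h01, Real.log_one, add_zero, Real.one_rpow] at h0
    have : 0 ≤ A / (κ - 1) * (1 + s) ^ (1 - κ) :=
      mul_nonneg (div_nonneg hA0 (by linarith)) (by positivity)
    linarith
  intro r hr
  have hφr := hφ r hr
  -- Up to the radius `1 / lam` the integrated majorant bounds `φ` by a constant. Beyond it, the
  -- bound at `1 / lam` is propagated along the free growth `lam r - m log r`.
  rcases le_total r (1 / lam) with hcase | hcase
  · have hlr : lam * r ≤ 1 := by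
      rw [le_div_iff₀ hlam] at hcase; linarith
    have hlr0 : 0 ≤ lam * r := by positivity
    have h1 : Real.log (φ r) ≤ B := by
      refine (hlog r hr).trans (le_trans ?_ hB0)
      rw [hC₀, ← mul_pow]
      have t1 : (lam * r) ^ 2 ≤ 1 := pow_le_one₀ hlr0 hlr
      have t2 := mul_le_mul_of_nonneg_left hlr ha₁
      linarith
    have h2 : φ r ≤ Real.exp B := by
      rw [← Real.log_le_iff_le_exp (by positivity)]; exact h1
    have h3 : 1 ≤ 2 ^ m * (1 + lam * r) ^ (-m) := by
      rw [Real.rpow_neg (by positivity), ← div_eq_mul_inv, one_le_div (by positivity)]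
      exact Real.rpow_le_rpow (by positivity) (by linarith) hm0
    have h4 : 1 ≤ Real.exp (lam * r) := Real.one_le_exp hlr0
    calc φ r ≤ Real.exp B * 1 * 1 := by linarith
      _ ≤ Real.exp B * (2 ^ m * (1 + lam * r) ^ (-m)) * Real.exp (lam * r) := by gcongr
      _ = _ := by ring
  · have hr₀ : 0 < 1 / lam := by positivity
    have hrp : 0 < r := hr₀.trans_le hcase
    have hlr : 1 ≤ lam * r := by
      rw [div_le_iff₀ hlam] at hcase; linarith
    have hk := log_solution_le hn hlam ha₁ ha₂ hβ (by linarith) h hφ ha hG hr₀ hcase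
    rw [← hm, ← hc] at hk
    have k1 := hρ _ hr₀
    have k2 := hlog _ hr₀.le
    have e1 : lam ^ 2 * (1 / lam) ^ 2 / 2 + lam * a₁ / 2 * (1 / lam) + A / (κ - 1) = C₀ := by
      rw [hC₀]; field_simp
    rw [e1] at k2
    have hpb : ∀ e : ℝ, 1 ≤ e → (1 + 1 / lam) ^ (-e) ≤ lam := by
      intro e he
      have : (1 + 1 / lam) ^ (-e) ≤ (1 + 1 / lam) ^ (-1 : ℝ) :=
        Real.rpow_le_rpow_of_exponent_le (by linarith) (by linarith)
      refine this.trans ?_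
      rw [Real.rpow_neg_one]
      rw [inv_le_comm₀ (by positivity) hlam, inv_eq_one_div]; linarith
    have hp1 : (1 + 1 / lam) ^ (1 - β) ≤ 1 :=
      Real.rpow_le_one_of_one_le_of_nonpos (by linarith) (by linarith)
    -- This full factor `lam` uses `γ > 2`. All remainders in `hk` are then of order `lam`, so
    -- dividing by `2 lam` leaves constants independent of the frequency.
    have hp2 : (1 + 1 / lam) ^ (1 - γ) ≤ lam := by
      have := hpb (γ - 1) (by linarith); rwa [neg_sub] at this
    have k3 : M (1 / lam) ≤ lam * (1 + a₁ / 2 + A) := by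
      simp only [M]
      have h5 := mul_le_mul_of_nonneg_left (hpb κ hκ1.le) hA0
      have h6 : lam ^ 2 * (1 / lam) = lam := by field_simp
      linarith
    have k4 : lam * a₁ * (1 + 1 / lam) ^ (1 - β) / (β - 1) ≤ lam * (a₁ / (β - 1)) := by
      rw [← mul_div_assoc]
      apply div_le_div_of_nonneg_right _ (by linarith)
      exact mul_le_of_le_one_right (mul_nonneg hlam.le ha₁) hp1
    have k5 : a₂ * (1 + 1 / lam) ^ (1 - γ) / (γ - 1) ≤ lam * (a₂ / (γ - 1)) := by
      rw [← mul_div_assoc]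
      apply div_le_div_of_nonneg_right _ (by linarith)
      rw [mul_comm lam]; exact mul_le_mul_of_nonneg_left hp2 ha₂
    have k6 : m / (1 / lam) = lam * m := by field_simp
    have k7 : c / (1 / lam) = lam * c := by field_simp
    have k8 : Real.log (1 / lam) = -Real.log lam := by rw [one_div, Real.log_inv]
    have k9 : lam * (1 / lam) = 1 := by field_simp
    rw [k6, k7, k8, k9] at hk
    have hfin : lam * (Real.log (φ r) + m * Real.log r - lam * r)
        ≤ lam * (B - m * Real.log lam) := by
      have := mul_le_mul_of_nonneg_left k2 hlam.le
      rw [hB]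
      linarith
    exact le_of_log_le hlam hlr hrp hm0 (by positivity) (le_of_mul_le_mul_left hfin hlam)

end Growth

/-! ### Radial functions on `ℝⁿ` and their weak Laplacian. -/

section Laplacian

variable {n : ℕ}

/-- The derivative of `f` along the `i`-th coordinate. -/
noncomputable def pderiv (i : Fin n) (f : Space n → ℝ) (x : Space n) : ℝ :=
  fderiv ℝ f x (EuclideanSpace.single i 1)

/-- The Laplacian on `ℝⁿ`. -/
noncomputable def lap (f : Space n → ℝ) (x : Space n) : ℝ := ∑ i, pderiv i (pderiv i f) x

/-- `ΔF = S` in the sense of distributions. -/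
def HasWeakLaplacian (F S : Space n → ℝ) : Prop :=
  ∀ κ : Space n → ℝ, ContDiff ℝ ∞ κ → HasCompactSupport κ → ∫ x, F x * lap κ x = ∫ x, S x * κ x

theorem contDiff_pderiv {f : Space n → ℝ} (hf : ContDiff ℝ ∞ f) (i : Fin n) :
    ContDiff ℝ ∞ (pderiv i f) :=
  (hf.fderiv_right (m := ∞) (by simp)).clm_apply contDiff_const

theorem hasCompactSupport_pderiv {f : Space n → ℝ} (hf : HasCompactSupport f) (i : Fin n) :
    HasCompactSupport (pderiv i f) :=
  (hf.fderiv ℝ).comp_left (g := fun L : Space n →L[ℝ] ℝ => L (EuclideanSpace.single i 1)) (by simp)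

theorem contDiff_lap {f : Space n → ℝ} (hf : ContDiff ℝ ∞ f) : ContDiff ℝ ∞ (lap f) :=
  ContDiff.sum fun i _ => contDiff_pderiv (contDiff_pderiv hf i) i

theorem hasLineDerivAt_pderiv {f : Space n → ℝ} (hf : ContDiff ℝ ∞ f) (i : Fin n) (x : Space n) :
    HasLineDerivAt ℝ f (pderiv i f x) x (EuclideanSpace.single i 1) :=
  (hf.differentiable (by simp) x).hasFDerivAt.hasLineDerivAt _

theorem hasFDerivAt_norm_of_ne {x : Space n} (hx : x ≠ 0) :
    HasFDerivAt (fun y : Space n => ‖y‖) (‖x‖⁻¹ • innerSL ℝ x) x := by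
  have h1 := (hasStrictFDerivAt_norm_sq x).hasFDerivAt.sqrt (by positivity)
  have h2 : (fun y : Space n => √(‖y‖ ^ 2)) = fun y => ‖y‖ := by
    ext y; exact Real.sqrt_sq (norm_nonneg y)
  rw [h2] at h1
  refine h1.congr_fderiv ?_
  rw [Real.sqrt_sq (norm_nonneg x)]
  ext y
  simp only [one_div, mul_inv_rev, smul_apply, smul_eq_mul, nsmul_eq_mul]
  push_cast; ring

theorem IsRadialLaplacian.hasLineDerivAt {F a S : ℝ → ℝ} (h : IsRadialLaplacian n F a S)
    (i : Fin n) (x : Space n) :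
    HasLineDerivAt ℝ (fun y : Space n => F ‖y‖) (a ‖x‖ * x i) x (EuclideanSpace.single i 1) := by
  by_cases hx : x = 0
  · subst hx
    unfold HasLineDerivAt
    have h0 := h.hasDerivAt 0
    rw [zero_mul, hasDerivAt_iff_isLittleO_nhds_zero] at h0
    simp only [zero_add, smul_zero, sub_zero] at h0
    rw [hasDerivAt_iff_isLittleO_nhds_zero]
    have h1 : Tendsto (fun t : ℝ => |t|) (𝓝 0) (𝓝 0) := by
      have := (continuous_abs (G := ℝ)).tendsto 0; rwa [abs_zero] at this
    have h2 := (h0.comp_tendsto h1)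
    refine (h2.trans_isBigO ?_).congr_left ?_
    · exact Asymptotics.isBigO_of_le _ fun t => by simp
    · intro t
      simp [norm_smul]
  · have h1 := (h.hasDerivAt ‖x‖).comp_hasFDerivAt x (hasFDerivAt_norm_of_ne hx)
    have h2 := h1.hasLineDerivAt (EuclideanSpace.single i 1)
    refine HasDerivAt.congr_deriv h2 ?_
    have : ‖x‖ ≠ 0 := norm_ne_zero_iff.2 hx
    simp only [smul_apply, innerSL_apply_apply, smul_eq_mul,
      EuclideanSpace.inner_single_right]
    field_simp
    simp

/-- Away from the origin this is the product rule with `a' = (S - n a) / r`. At the origin the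
difference quotient is `a |t|`, with limit `a 0`, and the second summand disappears because its
quotient `0 / 0` is `0`. -/
theorem IsRadialLaplacian.hasLineDerivAt_grad {F a S : ℝ → ℝ} (h : IsRadialLaplacian n F a S)
    (i : Fin n) (x : Space n) :
    HasLineDerivAt ℝ (fun y : Space n => a ‖y‖ * y i)
      (a ‖x‖ + (S ‖x‖ - n * a ‖x‖) * (x i ^ 2 / ‖x‖ ^ 2)) x (EuclideanSpace.single i 1) := by
  by_cases hx : x = 0
  · subst hx
    unfold HasLineDerivAt
    rw [hasDerivAt_iff_tendsto_slope]
    have h1 : Tendsto (fun t : ℝ => a |t|) (𝓝[≠] 0) (𝓝 (a 0)) := by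
      have := (h.continuous_a.comp continuous_abs).tendsto 0
      simp only [Function.comp_def, abs_zero] at this
      exact this.mono_left nhdsWithin_le_nhds
    simp only [norm_zero, PiLp.zero_apply, ne_eq, OfNat.ofNat_ne_zero, not_false_eq_true, zero_pow,
      div_zero, mul_zero, add_zero]
    refine h1.congr' ?_
    filter_upwards [self_mem_nhdsWithin] with t ht
    have ht : t ≠ 0 := ht
    simp only [slope, zero_add, norm_smul, PiLp.norm_single, norm_one, mul_one,
      PiLp.smul_apply, smul_eq_mul, Real.norm_eq_abs, PiLp.single_apply,
      if_true, sub_zero, vsub_eq_sub, zero_smul, PiLp.zero_apply, mul_zero]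
    field_simp
  · have hx0 : 0 < ‖x‖ := norm_pos_iff.2 hx
    have h1 := ((h.hasDerivAt_a ‖x‖ hx0).comp_hasFDerivAt x (hasFDerivAt_norm_of_ne hx)).mul
      (EuclideanSpace.proj (𝕜 := ℝ) i : Space n →L[ℝ] ℝ).hasFDerivAt
    have h2 := h1.hasLineDerivAt (EuclideanSpace.single i 1)
    refine HasDerivAt.congr_deriv h2 ?_
    simp only [smul_apply, innerSL_apply_apply, smul_eq_mul,
      EuclideanSpace.inner_single_right, add_apply, Function.comp_def]
    simp
    field_simp

/-- Two integrations by parts along each coordinate. Directional derivatives at every point together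
with integrability suffice, so no continuity of the second derivatives at the origin has to be
checked. The pure second derivatives add up to `S` because `∑ x i ^ 2 = ‖x‖ ^ 2`. -/
theorem IsRadialLaplacian.hasWeakLaplacian {F a S : ℝ → ℝ} (hn : 1 ≤ n)
    (h : IsRadialLaplacian n F a S) :
    HasWeakLaplacian (fun x : Space n => F ‖x‖) (fun x => S ‖x‖) := by
  intro κ hκ hκc
  have hFc := h.continuous
  have hac := h.continuous_a
  have hSc := h.continuous_S
  have hκ1 := fun i => (contDiff_pderiv hκ i).continuous
  have hκ2 := fun i => (contDiff_pderiv (contDiff_pderiv hκ i) i).continuous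
  have hκc1 := fun i => hasCompactSupport_pderiv hκc i
  have hκc2 := fun i => hasCompactSupport_pderiv (hκc1 i) i
  have hκ0 := hκ.continuous
  have hx : ∀ i : Fin n, Continuous fun x : Space n => x i := fun i =>
    (EuclideanSpace.proj (𝕜 := ℝ) i : Space n →L[ℝ] ℝ).continuous
  have hint : ∀ i : Fin n, Integrable (fun x : Space n =>
      (a ‖x‖ + (S ‖x‖ - n * a ‖x‖) * (x i ^ 2 / ‖x‖ ^ 2)) * κ x) := by
    intro i
    have e : (fun x : Space n => (a ‖x‖ + (S ‖x‖ - n * a ‖x‖) * (x i ^ 2 / ‖x‖ ^ 2)) * κ x)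
        = fun x => a ‖x‖ * κ x + (x i ^ 2 / ‖x‖ ^ 2) * ((S ‖x‖ - n * a ‖x‖) * κ x) := by
      ext x; ring
    rw [e]
    refine Integrable.add ?_ ?_
    · exact Continuous.integrable_of_hasCompactSupport (by fun_prop) hκc.mul_left
    · refine Integrable.bdd_mul (c := 1)
        (Continuous.integrable_of_hasCompactSupport (by fun_prop) hκc.mul_left) ?_ ?_
      · have := (hx i).measurable
        exact Measurable.aestronglyMeasurable (by fun_prop)
      · refine Eventually.of_forall fun x => ?_
        rw [Real.norm_eq_abs, abs_of_nonneg (by positivity)]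
        apply div_le_one_of_le₀ _ (by positivity)
        rw [sq_le_sq, abs_norm]
        exact PiLp.norm_apply_le x i
  have hA : ∀ i : Fin n, ∫ x : Space n, F ‖x‖ * pderiv i (pderiv i κ) x
      = -∫ x : Space n, a ‖x‖ * x i * pderiv i κ x := by
    intro i
    have := hκ1 i; have := hκ2 i; have := hx i
    refine integral_bilinear_hasLineDerivAt_right_eq_neg_left_of_integrable
      (B := ContinuousLinearMap.mul ℝ ℝ) (v := EuclideanSpace.single i 1)
      (f := fun x : Space n => F ‖x‖) (f' := fun x => a ‖x‖ * x i)
      (g := pderiv i κ) (g' := pderiv i (pderiv i κ)) ?_ ?_ ?_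
      (fun x _ => h.hasLineDerivAt i x)
      (fun x _ => hasLineDerivAt_pderiv (contDiff_pderiv hκ i) i x)
    · exact Continuous.integrable_of_hasCompactSupport (f := fun x => a ‖x‖ * x i * pderiv i κ x)
        (by fun_prop) (hκc1 i).mul_left
    · exact Continuous.integrable_of_hasCompactSupport
        (f := fun x => F ‖x‖ * pderiv i (pderiv i κ) x) (by fun_prop) (hκc2 i).mul_left
    · exact Continuous.integrable_of_hasCompactSupport (f := fun x => F ‖x‖ * pderiv i κ x)
        (by fun_prop) (hκc1 i).mul_left
  have hB : ∀ i : Fin n, ∫ x : Space n, a ‖x‖ * x i * pderiv i κ x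
      = -∫ x : Space n, (a ‖x‖ + (S ‖x‖ - n * a ‖x‖) * (x i ^ 2 / ‖x‖ ^ 2)) * κ x := by
    intro i
    have := hκ1 i; have := hx i
    refine integral_bilinear_hasLineDerivAt_right_eq_neg_left_of_integrable
      (B := ContinuousLinearMap.mul ℝ ℝ) (v := EuclideanSpace.single i 1)
      (f := fun x : Space n => a ‖x‖ * x i)
      (f' := fun x => a ‖x‖ + (S ‖x‖ - n * a ‖x‖) * (x i ^ 2 / ‖x‖ ^ 2))
      (g := κ) (g' := pderiv i κ) (hint i) ?_ ?_
      (fun x _ => h.hasLineDerivAt_grad i x)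
      (fun x _ => hasLineDerivAt_pderiv hκ i x)
    · exact Continuous.integrable_of_hasCompactSupport (f := fun x => a ‖x‖ * x i * pderiv i κ x)
        (by fun_prop) (hκc1 i).mul_left
    · exact Continuous.integrable_of_hasCompactSupport (f := fun x => a ‖x‖ * x i * κ x)
        (by fun_prop) hκc.mul_left
  calc ∫ x : Space n, F ‖x‖ * lap κ x
      = ∑ i, ∫ x : Space n, F ‖x‖ * pderiv i (pderiv i κ) x := by
        rw [← integral_finsetSum]
        · simp only [lap, Finset.mul_sum]
        · intro i _
          have := hκ2 i
          exact Continuous.integrable_of_hasCompactSupport (by fun_prop) (hκc2 i).mul_left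
    _ = ∑ i, ∫ x : Space n, (a ‖x‖ + (S ‖x‖ - n * a ‖x‖) * (x i ^ 2 / ‖x‖ ^ 2)) * κ x := by
        refine Finset.sum_congr rfl fun i _ => ?_
        rw [hA, hB, neg_neg]
    _ = ∫ x : Space n, S ‖x‖ * κ x := by
        rw [← integral_finsetSum _ fun i _ => hint i]
        have : Nonempty (Fin n) := ⟨⟨0, hn⟩⟩
        have hne : ∀ᵐ x : Space n, x ≠ 0 := by
          rw [ae_iff]; simp
        refine integral_congr_ae ?_
        filter_upwards [hne] with x hx
        have hx0 : ‖x‖ ^ 2 ≠ 0 := by have := norm_pos_iff.2 hx; positivity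
        rw [← Finset.sum_mul, Finset.sum_add_distrib, ← Finset.mul_sum, ← Finset.sum_div]
        have e : ∑ i, x i ^ 2 = ‖x‖ ^ 2 := by
          rw [EuclideanSpace.norm_sq_eq]; simp
        rw [e, div_self hx0]
        simp

end Laplacian

/-! ### Correctors and test pairs with constants uniform in the frequency. -/

section Family

variable {n : ℕ}

/-- First-order corrector: given the radial solution `φ` of `Δφ = G φ`, a solution `χ` of
`Δχ = G χ + d φ` of sublinear growth relative to `φ`. -/
theorem exists_radial_corrector (hn : 3 ≤ n) {φ a G d : ℝ → ℝ} (hG : Continuous G)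
    (hd : Continuous d) (h : IsRadialLaplacian n φ a (fun r => G r * φ r))
    (hφ : ∀ r, 0 ≤ r → 1 ≤ φ r) (ha : ∀ r, 0 ≤ r → 0 ≤ a r) (hd0 : ∀ r, 0 ≤ r → 0 ≤ d r)
    {B δ : ℝ} (hB : 0 ≤ B) (hδ0 : 0 < δ) (hδ1 : δ < 1)
    (hdB : ∀ r, 0 ≤ r → r * d r ≤ B * (1 + r) ^ (-δ)) :
    ∃ χ b : ℝ → ℝ, IsRadialLaplacian n χ b (fun r => G r * χ r + d r * φ r) ∧
      ∀ r, 0 ≤ r → 0 ≤ χ r ∧ χ r ≤ B / (1 - δ) * (1 + r) ^ (1 - δ) * φ r := by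
  have hφc := h.continuous
  have hac := h.continuous_a
  -- Reduction of order: for `χ = μ φ` the equation becomes `(r ^ (n - 1) φ² μ')' = r ^ (n - 1) φ²
  -- d`, that is `μ' = r P / φ²`.
  set P := radAvg n (fun r => φ r ^ 2 * d r) with hP
  have hPc : Continuous P := continuous_radAvg n (by fun_prop)
  have hmono : MonotoneOn φ (Ici 0) := by
    refine monotoneOn_of_deriv_nonneg (convex_Ici 0) (by fun_prop)
      (fun r _ => (h.hasDerivAt r).differentiableAt.differentiableWithinAt) fun r hr => ?_
    rw [interior_Ici] at hr
    have hr : 0 < r := hr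
    rw [(h.hasDerivAt r).deriv]
    exact mul_nonneg hr.le (ha r hr.le)
  have hφa : ∀ s, 1 ≤ φ |s| := fun s => hφ _ (abs_nonneg s)
  -- At negative arguments `φ` is not known to be nonzero; the absolute value makes the quotient
  -- continuous on the whole line.
  set am : ℝ → ℝ := fun s => P |s| / φ |s| ^ 2 with ham
  have hamc : Continuous am := by
    refine Continuous.div (by fun_prop) (by fun_prop) fun s => ?_
    have := hφa s; positivity
  set μ : ℝ → ℝ := fun r => ∫ s in (0 : ℝ)..r, s * am s with hμ
  have hμd : ∀ r, HasDerivAt μ (r * am r) r := fun r =>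
    intervalIntegral.integral_hasDerivAt_right
      (Continuous.intervalIntegrable (by fun_prop) _ _)
      (Continuous.stronglyMeasurableAtFilter (by fun_prop) _ _)
      (Continuous.continuousAt (by fun_prop))
  have hμc : Continuous μ := continuous_iff_continuousAt.2 fun r => (hμd r).continuousAt
  have ham0 : ∀ s, 0 ≤ s → 0 ≤ s * am s := by
    intro s hs
    refine mul_nonneg hs (div_nonneg (radAvg_nonneg fun σ hσ => ?_) (sq_nonneg _))
    rw [abs_of_nonneg hs]
    exact mul_nonneg (sq_nonneg _) (hd0 _ (mul_nonneg hσ.1 hs))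
  -- Since `φ` is increasing, the ratio `φ (σ s)² / φ s²` is at most `1`. One factor of `σ ^ (n -
  -- 1)` completes `σ s d (σ s)`; a second one, available for `n ≥ 3`, pays for replacing `1 + σ s`
  -- by `1 + s`.
  have hamB : ∀ s, 0 ≤ s → s * am s ≤ B * (1 + s) ^ (-δ) := by
    intro s hs
    have h0 : 0 < φ s ^ 2 := by have := hφ s hs; positivity
    simp only [ham, abs_of_nonneg hs]
    rw [← mul_div_assoc, div_le_iff₀ h0]
    have e : s * P s = ∫ σ in (0 : ℝ)..1, s * (σ ^ (n - 1) * (φ (σ * s) ^ 2 * d (σ * s))) := by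
      rw [intervalIntegral.integral_const_mul]; rfl
    have e2 : B * (1 + s) ^ (-δ) * φ s ^ 2
        = ∫ σ in (0 : ℝ)..1, B * (1 + s) ^ (-δ) * φ s ^ 2 := by simp
    rw [e, e2]
    refine intervalIntegral.integral_mono_on zero_le_one
      (Continuous.intervalIntegrable (by fun_prop) _ _) (by simp) fun σ hσ => ?_
    have hσ0 := hσ.1
    have hσs : 0 ≤ σ * s := mul_nonneg hσ.1 hs
    have h1 : φ (σ * s) ≤ φ s := hmono hσs hs (mul_le_of_le_one_left hs hσ.2)
    have h2 : φ (σ * s) ^ 2 ≤ φ s ^ 2 := by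
      have := hφ _ hσs; gcongr
    have h3 := hdB _ hσs
    have h4 : σ ^ (n - 2) ≤ σ := pow_le_of_le_one hσ.1 hσ.2 (by omega)
    have h5 : σ ^ (n - 1) = σ ^ (n - 2) * σ := by rw [← pow_succ]; congr 1; omega
    have h6 : 0 ≤ σ ^ (n - 2) := pow_nonneg hσ.1 _
    have h7 := mul_nonneg hσs (hd0 _ hσs)
    have h8 : σ * (1 + σ * s) ^ (-δ) ≤ (1 + s) ^ (-δ) := by
      rcases hσ.1.eq_or_lt with h0 | h0
      · rw [← h0, zero_mul]; positivity
      · have h9 : (1 + σ * s) ^ (-δ) ≤ (σ * (1 + s)) ^ (-δ) :=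
          Real.rpow_le_rpow_of_nonpos (by positivity) (by nlinarith [hσ.2]) (by linarith)
        rw [Real.mul_rpow hσ.1 (by positivity)] at h9
        have h10 : σ * σ ^ (-δ) ≤ 1 := by
          rw [← Real.rpow_one_add' hσ.1 (by linarith)]
          exact Real.rpow_le_one hσ.1 hσ.2 (by linarith)
        have h11 : 0 ≤ (1 + s) ^ (-δ) := by positivity
        calc σ * (1 + σ * s) ^ (-δ) ≤ σ * (σ ^ (-δ) * (1 + s) ^ (-δ)) := by gcongr
          _ = (σ * σ ^ (-δ)) * (1 + s) ^ (-δ) := by ring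
          _ ≤ 1 * (1 + s) ^ (-δ) := by gcongr
          _ = _ := one_mul _
    calc s * (σ ^ (n - 1) * (φ (σ * s) ^ 2 * d (σ * s)))
        = σ ^ (n - 2) * (φ (σ * s) ^ 2 * (σ * s * d (σ * s))) := by rw [h5]; ring
      _ ≤ σ * (φ s ^ 2 * (B * (1 + σ * s) ^ (-δ))) := by gcongr
      _ = B * (σ * (1 + σ * s) ^ (-δ)) * φ s ^ 2 := by ring
      _ ≤ B * (1 + s) ^ (-δ) * φ s ^ 2 := by gcongr
  refine ⟨fun r => μ r * φ r, fun r => μ r * a r + am r * φ r,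
    ⟨by fun_prop, by fun_prop, ?_, ?_⟩, ?_⟩
  · intro r
    exact ((hμd r).fun_mul (h.hasDerivAt r)).congr_deriv (by ring)
  · intro r hr
    have hφ0 : φ r ≠ 0 := by have := hφ r hr.le; positivity
    have hamd : HasDerivAt am ((((φ r ^ 2 * d r) - n * P r) / r * φ r ^ 2
        - P r * (2 * φ r * (r * a r))) / (φ r ^ 2) ^ 2) r := by
      have h1 := hasDerivAt_radAvg (n := n) (by omega) (S := fun r => φ r ^ 2 * d r) (by fun_prop) hr
      rw [← hP] at h1
      have h2 := h1.fun_div ((h.hasDerivAt r).fun_pow 2) (by positivity)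
      refine (h2.congr_of_eventuallyEq ?_).congr_deriv ?_
      · filter_upwards [lt_mem_nhds hr] with s hs
        simp only [ham, abs_of_pos hs]
      · push_cast; ring
    have h3 := ((hμd r).fun_mul (h.hasDerivAt_a r hr)).fun_add (hamd.fun_mul (h.hasDerivAt r))
    refine h3.congr_deriv ?_
    simp only [ham, abs_of_pos hr]
    field_simp
    ring
  · intro r hr
    have h1 : 0 ≤ μ r := intervalIntegral.integral_nonneg hr fun s hs => ham0 s hs.1
    have h2 : μ r ≤ B / (1 - δ) * (1 + r) ^ (1 - δ) := by
      have hpw : ∀ s ∈ uIcc 0 r, HasDerivAt (fun s : ℝ => B / (1 - δ) * (1 + s) ^ (1 - δ))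
          (B * (1 + s) ^ (-δ)) s := by
        intro s hs
        rw [uIcc_of_le hr] at hs
        have h1 : HasDerivAt (fun s : ℝ => 1 + s) 1 s := (hasDerivAt_id s).const_add 1
        refine ((h1.rpow_const (p := 1 - δ)
          (Or.inl (by have := hs.1; positivity))).const_mul (B / (1 - δ))).congr_deriv ?_
        have : 1 - δ ≠ 0 := by linarith
        rw [show 1 - δ - 1 = -δ by ring]
        field_simp
      have hint : IntervalIntegrable (fun s : ℝ => B * (1 + s) ^ (-δ)) volume 0 r := by
        refine ContinuousOn.intervalIntegrable (ContinuousOn.mul continuousOn_const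
          (ContinuousOn.rpow_const (by fun_prop) fun s hs => Or.inl ?_))
        rw [uIcc_of_le hr] at hs
        have := hs.1; positivity
      have h3 : μ r ≤ ∫ s in (0 : ℝ)..r, B * (1 + s) ^ (-δ) :=
        intervalIntegral.integral_mono_on hr (Continuous.intervalIntegrable (by fun_prop) _ _)
          hint fun s hs => hamB s hs.1
      rw [intervalIntegral.integral_eq_sub_of_hasDerivAt hpw hint] at h3
      have h4 : 0 ≤ B / (1 - δ) * (1 + 0) ^ (1 - δ) :=
        mul_nonneg (div_nonneg hB (by linarith)) (by positivity)
      linarith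
    have := hφ r hr
    exact ⟨by positivity, mul_le_mul_of_nonneg_right h2 (by positivity)⟩

/-- A solution `φ` of `Δφ = (lam² + lam D + V) φ` with a corrector
`Δχ = (lam² + lam D + V) χ + D φ`, both controlled by the constants `C` and `δ`. -/
structure IsTestPair (D V : Space n → ℝ) (lam C δ : ℝ) (φ χ : Space n → ℝ) : Prop where
  continuous_φ : Continuous φ
  continuous_χ : Continuous χ
  lap_φ : HasWeakLaplacian φ (fun x => (lam ^ 2 + lam * D x + V x) * φ x)
  lap_χ : HasWeakLaplacian χ (fun x => (lam ^ 2 + lam * D x + V x) * χ x + D x * φ x)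
  one_le : ∀ x, 1 ≤ φ x
  le_exp : ∀ x, φ x ≤ C * (1 + lam * ‖x‖) ^ (-(((n : ℝ) - 1) / 2)) * Real.exp (lam * ‖x‖)
  nonneg_χ : ∀ x, 0 ≤ χ x
  χ_le : ∀ x, χ x ≤ C * (1 + ‖x‖) ^ (1 - δ) * φ x
  Dχ_le : ∀ x, D x * χ x ≤ C * φ x

/-- The test pairs exist with a constant that does not depend on `lam ∈ (0,1]`. -/
theorem exists_testPair (hn : 3 ≤ n) {a₁ a₂ β γ : ℝ} (ha₁ : 0 ≤ a₁) (ha₂ : 0 ≤ a₂)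
    (hβ : 1 < β) (hγ : 2 < γ) {D V : Space n → ℝ} (hD : IsCoefficient a₁ β D)
    (hV : IsCoefficient a₂ γ V) :
    ∃ C δ : ℝ, 0 < C ∧ 0 < δ ∧ δ < 1 ∧ ∀ lam : ℝ, 0 < lam → lam ≤ 1 →
      ∃ φ χ : Space n → ℝ, IsTestPair D V lam C δ φ χ := by
  obtain ⟨C, hC, hbound⟩ := exists_solution_bound hn ha₁ ha₂ hβ hγ
  -- `δ ≤ β - 1` turns the decay of `D` into `(1 + r) d ≤ a₁ (1 + r) ^ (-δ)`, and `δ < 1` keeps the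
  -- primitive of `(1 + r) ^ (-δ)` a positive power.
  obtain ⟨δ, hδ0, hδ1, hδβ⟩ : ∃ δ : ℝ, 0 < δ ∧ δ < 1 ∧ δ ≤ β - 1 :=
    ⟨min (β - 1) (1 / 2), lt_min (by linarith) (by norm_num),
      (min_le_right _ _).trans_lt (by norm_num), min_le_left _ _⟩
  have hA0 : 0 ≤ a₁ / (1 - δ) := div_nonneg ha₁ (by linarith)
  -- The three entries of the maximum serve the bounds on `φ`, on `χ` and on `D χ`.
  refine ⟨max C (max (a₁ / (1 - δ)) (a₁ * (a₁ / (1 - δ)))), δ, lt_max_of_lt_left hC, hδ0, hδ1,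
    fun lam hlam hlam1 => ?_⟩
  let e : Space n := EuclideanSpace.single ⟨0, by omega⟩ 1
  have he : ∀ r : ℝ, 0 ≤ r → ‖r • e‖ = r := fun r hr => by
    simp [e, norm_smul, abs_of_nonneg hr]
  have hrad : ∀ {c b : ℝ} {W : Space n → ℝ}, IsCoefficient c b W → ∀ x, W (‖x‖ • e) = W x :=
    fun h x => h.radial _ _ (he _ (norm_nonneg x))
  set d : ℝ → ℝ := fun r => D (r • e) with hd
  set v : ℝ → ℝ := fun r => V (r • e) with hv
  have hDc := hD.continuous
  have hVc := hV.continuous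
  have hdc : Continuous d := by fun_prop
  have hvc : Continuous v := by fun_prop
  have hbd : ∀ {c b : ℝ} {W : Space n → ℝ}, 0 ≤ c → 0 < b → IsCoefficient c b W → ∀ x, W x ≤ c := by
    intro c b W hc hb h x
    refine (h.decay x).trans (mul_le_of_le_one_right hc ?_)
    exact Real.rpow_le_one_of_one_le_of_nonpos (by have := norm_nonneg x; linarith) (by linarith)
  set G : ℝ → ℝ := fun r => lam ^ 2 + lam * d r + v r with hGdef
  have hGc : Continuous G := by fun_prop
  obtain ⟨φ, a, hφ, hφ0, hφ1, ha⟩ := exists_radial_solution (n := n) (by omega) hGc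
    (fun r => by have := hD.nonneg (r • e); have := hV.nonneg (r • e); positivity)
    ⟨lam ^ 2 + lam * a₁ + a₂, fun r => by
      have h1 := hbd ha₁ (by linarith) hD (r • e)
      have h2 := hbd ha₂ (by linarith) hV (r • e)
      simp only [hGdef, hd, hv]; gcongr⟩
  have hrd : ∀ r : ℝ, 0 ≤ r → (1 + r) * d r ≤ a₁ * (1 + r) ^ (-δ) := by
    intro r hr
    have h1 := hD.decay (r • e)
    rw [he r hr] at h1
    calc (1 + r) * d r ≤ (1 + r) * (a₁ * (1 + r) ^ (-β)) := by gcongr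
      _ = a₁ * ((1 + r) * (1 + r) ^ (-β)) := by ring
      _ = a₁ * (1 + r) ^ (1 - β) := by
          rw [← Real.rpow_one_add' (by positivity) (by linarith), ← sub_eq_add_neg]
      _ ≤ a₁ * (1 + r) ^ (-δ) := by
          gcongr
          · linarith
          · linarith
  obtain ⟨χ, b, hχ, hχb⟩ := exists_radial_corrector hn hGc hdc hφ hφ1 ha
    (fun r _ => hD.nonneg _) ha₁ hδ0 hδ1
    (fun r hr => (mul_le_mul_of_nonneg_right (by linarith) (hD.nonneg _)).trans (hrd r hr))
  have hub := hbound lam φ a G hlam hlam1 hφ hφ0 hφ1 ha (fun r hr => by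
    have h1 := hD.decay (r • e)
    have h2 := hV.decay (r • e)
    rw [he r hr] at h1 h2
    simp only [hGdef, hd, hv]; gcongr)
  have hφc := hφ.continuous
  have hχc := hχ.continuous
  have hpos : ∀ x : Space n, 0 < φ ‖x‖ := fun x => by
    have := hφ1 _ (norm_nonneg x); positivity
  refine ⟨fun x => φ ‖x‖, fun x => χ ‖x‖, by fun_prop, by fun_prop, ?_, ?_,
    fun x => hφ1 _ (norm_nonneg x), fun x => ?_, fun x => (hχb _ (norm_nonneg x)).1,
    fun x => ?_, fun x => ?_⟩
  · have := hφ.hasWeakLaplacian (by omega)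
    simpa only [hGdef, hd, hv, hrad hD, hrad hV] using this
  · have := hχ.hasWeakLaplacian (by omega)
    simpa only [hGdef, hd, hv, hrad hD, hrad hV] using this
  · refine (hub _ (norm_nonneg x)).trans ?_
    gcongr
    exact le_max_left _ _
  · refine (hχb _ (norm_nonneg x)).2.trans ?_
    have := (hpos x).le
    gcongr
    exact (le_max_left _ _).trans (le_max_right _ _)
  · have h1 := (hχb _ (norm_nonneg x)).2
    have h2 := hrd _ (norm_nonneg x)
    simp only [hd, hrad hD] at h2
    have := (hpos x).le
    have h3 : (1 + ‖x‖) ^ (1 - δ) * D x ≤ a₁ := by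
      calc (1 + ‖x‖) ^ (1 - δ) * D x ≤ (1 + ‖x‖) * D x := by
            have := hD.nonneg x
            gcongr
            have h4 : (1 + ‖x‖) ^ (1 - δ) ≤ (1 + ‖x‖) ^ (1 : ℝ) :=
              Real.rpow_le_rpow_of_exponent_le (by linarith [norm_nonneg x]) (by linarith)
            rwa [Real.rpow_one] at h4
        _ ≤ a₁ * (1 + ‖x‖) ^ (-δ) := h2
        _ ≤ a₁ := mul_le_of_le_one_right ha₁
            (Real.rpow_le_one_of_one_le_of_nonpos (by linarith [norm_nonneg x]) (by linarith))
    calc D x * χ ‖x‖ ≤ D x * (a₁ / (1 - δ) * (1 + ‖x‖) ^ (1 - δ) * φ ‖x‖) := by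
          have := hD.nonneg x; gcongr
      _ = a₁ / (1 - δ) * ((1 + ‖x‖) ^ (1 - δ) * D x) * φ ‖x‖ := by ring
      _ ≤ a₁ / (1 - δ) * a₁ * φ ‖x‖ := by gcongr
      _ = a₁ * (a₁ / (1 - δ)) * φ ‖x‖ := by ring
      _ ≤ _ := by
          gcongr
          exact (le_max_right _ _).trans (le_max_right _ _)

end Family

/-! ### Space-time slabs, light cones and Fubini. -/

section SlabMeasure

variable {n : ℕ} {Tm : ℝ≥0∞}

theorem measurableSet_timeInterval : MeasurableSet (timeInterval Tm) :=
  measurableSet_Ici.inter (measurableSet_lt ENNReal.measurable_ofReal measurable_const)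

theorem slab_eq_prod : slab n Tm = timeInterval Tm ×ˢ univ := by
  ext z; simp [slab]

theorem measurableSet_slab : MeasurableSet (slab n Tm) := by
  rw [slab_eq_prod]; exact measurableSet_timeInterval.prod MeasurableSet.univ

theorem restrict_slab : (volume : Measure (ℝ × Space n)).restrict (slab n Tm)
    = (volume.restrict (timeInterval Tm)).prod volume := by
  rw [slab_eq_prod, Measure.volume_eq_prod, ← Measure.prod_restrict, Measure.restrict_univ]

theorem Icc_subset_timeInterval {T : ℝ} (hT : ENNReal.ofReal T < Tm) :
    Icc 0 T ⊆ timeInterval Tm :=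
  fun _ ht => ⟨ht.1, (ENNReal.ofReal_le_ofReal ht.2).trans_lt hT⟩

theorem timeInterval_mem_nhds {T t : ℝ} (hT : ENNReal.ofReal T < Tm) (ht : t ∈ Ioo 0 T) :
    timeInterval Tm ∈ 𝓝 t :=
  mem_of_superset (Icc_mem_nhds ht.1 ht.2) (Icc_subset_timeInterval hT)

/-- The part of the slab `t ≤ T` inside the ball of radius `T + R`. -/
def coneBox (n : ℕ) (R T : ℝ) : Set (ℝ × Space n) := Icc 0 T ×ˢ Metric.closedBall 0 (T + R)

theorem isCompact_coneBox (R T : ℝ) : IsCompact (coneBox n R T) :=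
  isCompact_Icc.prod (isCompact_closedBall _ _)

theorem measurableSet_coneBox (R T : ℝ) : MeasurableSet (coneBox n R T) :=
  (isCompact_coneBox R T).isClosed.measurableSet

theorem coneBox_subset_slab {R T : ℝ} (hT : ENNReal.ofReal T < Tm) :
    coneBox n R T ⊆ slab n Tm :=
  fun _ hz => Icc_subset_timeInterval hT hz.1

theorem restrict_coneBox (R T : ℝ) : (volume : Measure (ℝ × Space n)).restrict (coneBox n R T)
    = (volume.restrict (Icc 0 T)).prod (volume.restrict (Metric.closedBall 0 (T + R))) := by
  rw [coneBox, Measure.volume_eq_prod, Measure.prod_restrict]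

/-- A property of `f` on almost every time slice, when `f` is represented by slices vanishing
outside the light cone, holds almost everywhere on the slab. -/
theorem ae_slab_of_forall_ae {f : ℝ × Space n → ℝ} {R : ℝ}
    (hf : AEStronglyMeasurable f (volume.restrict (slab n Tm)))
    (h : ∀ᵐ t, t ∈ timeInterval Tm → ∀ᵐ x : Space n, t + R < ‖x‖ → f (t, x) = 0) :
    ∀ᵐ z ∂(volume.restrict (slab n Tm)), z.1 + R < ‖z.2‖ → f z = 0 := by
  rw [restrict_slab] at hf ⊢
  -- The exceptional null set depends on the time slice. Passing to a measurable representative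
  -- makes the set in question measurable, so that slicewise statements assemble into one on the
  -- slab.
  obtain ⟨g, hg, hfg⟩ := hf
  have h1 := Measure.ae_ae_of_ae_prod hfg
  have hm : MeasurableSet {z : ℝ × Space n | z.1 + R < ‖z.2‖ → g z = 0} := by
    have e : {z : ℝ × Space n | z.1 + R < ‖z.2‖ → g z = 0}
        = {z : ℝ × Space n | z.1 + R < ‖z.2‖}ᶜ ∪ g ⁻¹' {0} := by
      ext z; simp [imp_iff_not_or]
    rw [e]
    exact (measurableSet_lt (by fun_prop) (by fun_prop)).compl.union
      (hg.measurable (measurableSet_singleton 0))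
  have h2 : ∀ᵐ z ∂((volume.restrict (timeInterval Tm)).prod (volume : Measure (Space n))),
      z.1 + R < ‖z.2‖ → g z = 0 := by
    rw [Measure.ae_prod_iff_ae_ae hm]
    filter_upwards [h1, (ae_restrict_iff' measurableSet_timeInterval).2 h] with t ht1 ht2
    filter_upwards [ht1, ht2] with x hx1 hx2 hx
    rw [← hx1, hx2 hx]
  filter_upwards [hfg, h2] with z h3 h4 h5
  rw [h3, h4 h5]

theorem setIntegral_slab_eq_coneBox {f : ℝ × Space n → ℝ} {R T : ℝ} (hT : ENNReal.ofReal T < Tm)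
    (h1 : ∀ z, T < z.1 → f z = 0)
    (h2 : ∀ᵐ z ∂(volume.restrict (slab n Tm)), z.1 + R < ‖z.2‖ → f z = 0) :
    ∫ z in slab n Tm, f z = ∫ z in coneBox n R T, f z := by
  refine setIntegral_eq_of_subset_of_ae_sdiff_eq_zero measurableSet_slab.nullMeasurableSet
    (coneBox_subset_slab hT) ?_
  rw [ae_restrict_iff' measurableSet_slab] at h2
  filter_upwards [h2] with z hz hz'
  by_cases h3 : T < z.1
  · exact h1 z h3
  · refine hz hz'.1 ?_
    by_contra h4
    refine hz'.2 ⟨⟨hz'.1.1, not_lt.1 h3⟩, ?_⟩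
    rw [mem_closedBall_zero_iff]; linarith [not_lt.1 h3, not_lt.1 h4]

/-- An `L²`-continuous curve is integrable on compact space-time boxes. -/
theorem integrableOn_coneBox_of_represents {F : Type*} [NormedAddCommGroup F]
    [InnerProductSpace ℝ F] {f : ℝ × Space n → F} {U : ℝ → Lp F 2 (volume : Measure (Space n))}
    (hf : Represents Tm f U) (hU : ContinuousOn U (timeInterval Tm)) {R T : ℝ}
    (hT : ENNReal.ofReal T < Tm) : IntegrableOn f (coneBox n R T) := by
  have hmeas : AEStronglyMeasurable f (volume.restrict (coneBox n R T)) :=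
    hf.1.mono_measure (Measure.restrict_mono (coneBox_subset_slab hT) le_rfl)
  unfold IntegrableOn
  rw [restrict_coneBox] at hmeas ⊢
  obtain ⟨C, hC⟩ := isCompact_Icc.exists_bound_of_continuousOn
    (hU.mono (Icc_subset_timeInterval hT))
  have hfin : volume (Metric.closedBall (0 : Space n) (T + R)) < ⊤ := measure_closedBall_lt_top
  have hsq : ∀ t, Integrable (fun x => ‖U t x‖ ^ 2) := fun t =>
    (memLp_two_iff_integrable_sq_norm (Lp.memLp (U t)).1).1 (Lp.memLp (U t))
  have hnorm : ∀ t, ∫ x, ‖U t x‖ ^ 2 = ‖U t‖ ^ 2 := by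
    intro t
    rw [← real_inner_self_eq_norm_sq, L2.inner_def]
    simp only [real_inner_self_eq_norm_sq]
  have hUi : ∀ t, IntegrableOn (fun x => U t x) (Metric.closedBall (0 : Space n) (T + R)) := by
    intro t
    have : IsFiniteMeasure (volume.restrict (Metric.closedBall (0 : Space n) (T + R))) :=
      ⟨by simpa using hfin⟩
    exact ((Lp.memLp (U t)).restrict _).integrable (by norm_num)
  rw [integrable_prod_iff hmeas]
  constructor
  · refine (ae_restrict_iff' measurableSet_Icc).2 (Eventually.of_forall fun t ht => ?_)
    exact (hUi t).congr_fun_ae (ae_restrict_of_ae (hf.2 t (Icc_subset_timeInterval hT ht)).symm)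
  · refine Integrable.of_bound hmeas.norm.integral_prod_right'
      (C ^ 2 + volume.real (Metric.closedBall (0 : Space n) (T + R))) ?_
    refine (ae_restrict_iff' measurableSet_Icc).2 (Eventually.of_forall fun t ht => ?_)
    rw [Real.norm_of_nonneg (integral_nonneg fun _ => norm_nonneg _)]
    have e : ∫ x in Metric.closedBall (0 : Space n) (T + R), ‖f (t, x)‖
        = ∫ x in Metric.closedBall (0 : Space n) (T + R), ‖U t x‖ := by
      refine integral_congr_ae (ae_restrict_of_ae ?_)
      filter_upwards [hf.2 t (Icc_subset_timeInterval hT ht)] with x hx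
      rw [hx]
    rw [e]
    calc ∫ x in Metric.closedBall (0 : Space n) (T + R), ‖U t x‖
        ≤ ∫ x in Metric.closedBall (0 : Space n) (T + R), (‖U t x‖ ^ 2 + 1) := by
          refine integral_mono (hUi t).norm ?_ fun x => ?_
          · exact (hsq t).integrableOn.add (integrableOn_const hfin.ne)
          · simp only []
            nlinarith [sq_nonneg (‖U t x‖ - 1)]
      _ = (∫ x in Metric.closedBall (0 : Space n) (T + R), ‖U t x‖ ^ 2)
          + volume.real (Metric.closedBall (0 : Space n) (T + R)) := by
          rw [integral_add (hsq t).integrableOn (integrableOn_const hfin.ne)]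
          simp
      _ ≤ C ^ 2 + volume.real (Metric.closedBall (0 : Space n) (T + R)) := by
          gcongr
          refine (setIntegral_le_integral (hsq t)
            (Eventually.of_forall fun _ => sq_nonneg _)).trans ?_
          rw [hnorm]
          have := hC t ht
          gcongr

end SlabMeasure

/-! ### Pairing `L²`-valued curves with functions of space. -/

section Pairing

variable {n : ℕ} {Tm : ℝ≥0∞}

/-- The `L²` class of a continuous function cut off to a ball. -/
theorem memLp_indicator_ball {F : Space n → ℝ} (hF : Continuous F) (M : ℝ) :
    MemLp ((Metric.closedBall (0 : Space n) M).indicator F) 2 volume := by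
  rw [memLp_indicator_iff_restrict measurableSet_closedBall]
  obtain ⟨C, hC⟩ := (isCompact_closedBall (0 : Space n) M).exists_bound_of_continuousOn
    hF.continuousOn
  have : IsFiniteMeasure (volume.restrict (Metric.closedBall (0 : Space n) M)) :=
    ⟨by simpa using measure_closedBall_lt_top⟩
  refine MemLp.of_bound hF.aestronglyMeasurable C ?_
  exact (ae_restrict_iff' measurableSet_closedBall).2 (Eventually.of_forall fun x hx => hC x hx)

/-- This writes a slice integral as an inner product in `L²`, so that the differentiability of the
solution as an `L²`-valued curve can be used under the integral. -/
theorem inner_toLp_indicator {F : Space n → ℝ} (hF : Continuous F) (M : ℝ)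
    {f : Space n → ℝ} {U : Lp ℝ 2 (volume : Measure (Space n))} (hfU : f =ᵐ[volume] U) :
    inner ℝ ((memLp_indicator_ball hF M).toLp _) U
      = ∫ x in Metric.closedBall (0 : Space n) M, f x * F x := by
  rw [L2.inner_def, ← integral_indicator measurableSet_closedBall]
  refine integral_congr_ae ?_
  filter_upwards [hfU, (memLp_indicator_ball hF M).coeFn_toLp] with x h1 h2
  rw [h2, ← h1]
  by_cases hx : x ∈ Metric.closedBall (0 : Space n) M
  · simp [hx]
  · simp [hx]

/-- Integration by parts in time against `e(t) F(x)`, where `e` vanishes for `t ≥ T`. -/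
theorem integral_coneBox_time_by_parts {w wt : ℝ × Space n → ℝ}
    {U Ut : ℝ → Lp ℝ 2 (volume : Measure (Space n))} (hw : Represents Tm w U)
    (hwt : Represents Tm wt Ut) (hU : ContinuousOn U (timeInterval Tm))
    (hUt : ContinuousOn Ut (timeInterval Tm))
    (hd : ∀ t ∈ timeInterval Tm, HasDerivWithinAt U (Ut t) (timeInterval Tm) t)
    {R T : ℝ} (hT0 : 0 ≤ T) (hT : ENNReal.ofReal T < Tm) {F : Space n → ℝ} (hF : Continuous F)
    {e : ℝ → ℝ} (he : ContDiff ℝ 1 e) (heT : e T = 0) :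
    ∫ z in coneBox n R T, wt z * (e z.1 * F z.2)
      = -(e 0 * ∫ x in Metric.closedBall (0 : Space n) (T + R), w (0, x) * F x)
        - ∫ z in coneBox n R T, w z * (deriv e z.1 * F z.2) := by
  have hec := he.continuous
  have hec' : Continuous (deriv e) := he.continuous_deriv (by simp)
  have hsub := Icc_subset_timeInterval hT
  have hprod : ∀ {f : ℝ × Space n → ℝ} {W : ℝ → Lp ℝ 2 (volume : Measure (Space n))}
      (_ : Represents Tm f W) (_ : ContinuousOn W (timeInterval Tm)) {c : ℝ → ℝ}
      (_ : Continuous c),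
      ∫ z in coneBox n R T, f z * (c z.1 * F z.2)
        = ∫ t in (0 : ℝ)..T, c t * inner ℝ ((memLp_indicator_ball hF (T + R)).toLp _) (W t) := by
    intro f W hf hW c hc
    have hi : IntegrableOn (fun z => f z * (c z.1 * F z.2)) (coneBox n R T) :=
      (integrableOn_coneBox_of_represents hf hW hT).mul_continuousOn (by fun_prop)
        (isCompact_coneBox R T)
    rw [intervalIntegral.integral_of_le hT0, ← integral_Icc_eq_integral_Ioc]
    unfold IntegrableOn at hi
    rw [restrict_coneBox] at hi ⊢
    rw [integral_prod _ hi]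
    refine setIntegral_congr_fun measurableSet_Icc fun t ht => ?_
    simp only []
    rw [inner_toLp_indicator hF (T + R) (hf.2 t (hsub ht)), ← integral_const_mul]
    congr 1; ext x; ring
  rw [hprod hwt hUt hec, hprod hw hU hec']
  set Φ := (memLp_indicator_ball hF (T + R)).toLp _ with hΦ
  have h0 : inner ℝ Φ (U 0) = ∫ x in Metric.closedBall (0 : Space n) (T + R), w (0, x) * F x :=
    inner_toLp_indicator hF (T + R) (hw.2 0 (hsub ⟨le_rfl, hT0⟩))
  rw [← h0]
  have hcont : ContinuousOn (fun t => inner ℝ Φ (U t)) (Icc 0 T) :=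
    continuousOn_const.inner (hU.mono hsub)
  have hcont' : ContinuousOn (fun t => inner ℝ Φ (Ut t)) (Icc 0 T) :=
    continuousOn_const.inner (hUt.mono hsub)
  have i1 : IntervalIntegrable (fun t => e t * inner ℝ Φ (Ut t)) volume 0 T := by
    refine ContinuousOn.intervalIntegrable ?_
    rw [uIcc_of_le hT0]; fun_prop
  have i2 : IntervalIntegrable (fun t => deriv e t * inner ℝ Φ (U t)) volume 0 T := by
    refine ContinuousOn.intervalIntegrable ?_
    rw [uIcc_of_le hT0]; fun_prop
  have key := intervalIntegral.integral_eq_sub_of_hasDerivAt_of_le hT0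
    (f := fun t => e t * inner ℝ Φ (U t))
    (f' := fun t => deriv e t * inner ℝ Φ (U t) + e t * inner ℝ Φ (Ut t)) (by fun_prop) ?_
    (i2.add i1)
  · rw [intervalIntegral.integral_add i2 i1] at key
    simp only [heT, zero_mul] at key
    linarith
  · intro t ht
    have h1 : HasDerivAt U (Ut t) t :=
      (hd t (hsub (Ioo_subset_Icc_self ht))).hasDerivAt (timeInterval_mem_nhds hT ht)
    have h2 : HasDerivAt (fun t => inner ℝ Φ (U t)) (inner ℝ Φ (Ut t)) t := by
      have := (hasDerivAt_const t Φ).inner ℝ h1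
      simpa using this
    exact ((he.differentiable (by simp) t).hasDerivAt).fun_mul h2

/-- The time derivative inherits the finite speed of propagation. -/
theorem deriv_eq_zero_outside_cone {w wt : ℝ × Space n → ℝ}
    {U Ut : ℝ → Lp ℝ 2 (volume : Measure (Space n))} (hw : Represents Tm w U)
    (hwt : Represents Tm wt Ut)
    (hd : ∀ t ∈ timeInterval Tm, HasDerivWithinAt U (Ut t) (timeInterval Tm) t) {R : ℝ}
    (hs : ∀ t ∈ timeInterval Tm, ∀ᵐ x : Space n, t + R < ‖x‖ → w (t, x) = 0) {t : ℝ}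
    (ht : t ∈ timeInterval Tm) (ht0 : 0 < t) :
    ∀ᵐ x : Space n, t + R < ‖x‖ → wt (t, x) = 0 := by
  set A : Set (Space n) := {x | t + R < ‖x‖} with hA
  have hAm : MeasurableSet A := measurableSet_lt measurable_const measurable_norm
  have hg : MemLp (A.indicator (Ut t)) 2 volume := (Lp.memLp (Ut t)).indicator hAm
  -- The curve is tested with `g = 1_A Ut(t)`. For `s ≤ t` the set `A` lies outside the cone at time
  -- `s`, so the pairing of `g` with `U s` vanishes on `[0, t]`; its derivative at `t` from within
  -- this interval equals `‖g‖²`, which is therefore zero.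
  set g := hg.toLp _ with hgdef
  have hsub : Icc 0 t ⊆ timeInterval Tm := Icc_subset_timeInterval ht.2
  have h1 : HasDerivWithinAt (fun s => inner ℝ g (U s)) (inner ℝ g (Ut t)) (Icc 0 t) t := by
    have := (hasDerivWithinAt_const t (Icc 0 t) g).inner ℝ ((hd t ht).mono hsub)
    simpa using this
  have h2 : ∀ s ∈ Icc 0 t, inner ℝ g (U s) = 0 := by
    intro s hs'
    rw [L2.inner_def]
    refine integral_eq_zero_of_ae ?_
    filter_upwards [hg.coeFn_toLp, hs s (hsub hs'), hw.2 s (hsub hs')] with x e1 e2 e3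
    rw [← hgdef] at e1
    rw [e1, ← e3]
    by_cases hx : x ∈ A
    · rw [e2 (by have : t + R < ‖x‖ := hx; linarith [hs'.2])]; simp
    · simp [hx]
  have h3 : HasDerivWithinAt (fun s => inner ℝ g (U s)) 0 (Icc 0 t) t :=
    (hasDerivWithinAt_const t (Icc 0 t) (0 : ℝ)).congr (fun s hs' => h2 s hs')
      (h2 t ⟨ht0.le, le_rfl⟩)
  have h4 : inner ℝ g (Ut t) = 0 :=
    (uniqueDiffOn_Icc ht0 t ⟨ht0.le, le_rfl⟩).eq_deriv _ h1 h3
  have h5 : inner ℝ g (Ut t) = inner ℝ g g := by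
    rw [L2.inner_def, L2.inner_def]
    refine integral_congr_ae ?_
    filter_upwards [hg.coeFn_toLp] with x e1
    rw [← hgdef] at e1
    rw [e1]
    by_cases hx : x ∈ A <;> simp [hx]
  have h6 : g = 0 := by
    rw [h5] at h4; exact inner_self_eq_zero.1 h4
  have h7 : (A.indicator (Ut t)) =ᵐ[volume] 0 := by
    have := hg.coeFn_toLp
    rw [← hgdef, h6] at this
    exact this.symm.trans (Lp.coeFn_zero _ _ _)
  filter_upwards [h7, hwt.2 t ht] with x e1 e2 hx
  rw [e2]
  have hx : x ∈ A := hx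
  simpa [hx] using e1

end Pairing

/-! ### Smooth approximation of functions with a continuous weak Laplacian. -/

section Mollify

variable {n : ℕ}

theorem pderiv_const_sub {f : Space n → ℝ} (hf : ContDiff ℝ ∞ f) (i : Fin n) (x : Space n) :
    pderiv i (fun y => f (x - y)) = fun y => -pderiv i f (x - y) := by
  ext y
  have h1 : HasFDerivAt f (fderiv ℝ f (x - y)) (x - y) :=
    (hf.differentiable (by simp) _).hasFDerivAt
  have h2 := h1.comp y ((hasFDerivAt_id y).const_sub x)
  have h3 : fderiv ℝ (fun y => f (x - y)) y = _ := h2.fderiv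
  simp [pderiv, h3]

theorem lap_const_sub {f : Space n → ℝ} (hf : ContDiff ℝ ∞ f) (x y : Space n) :
    lap (fun y => f (x - y)) y = lap f (x - y) := by
  refine Finset.sum_congr rfl fun i _ => ?_
  rw [pderiv_const_sub hf]
  have h1 := pderiv_const_sub (contDiff_pderiv hf i) i x
  have h2 : pderiv i (fun y => -pderiv i f (x - y)) y = -pderiv i (fun y => pderiv i f (x - y)) y := by
    simp [pderiv, fderiv_fun_neg]
  rw [h2, h1, neg_neg]

open scoped Convolution

theorem pderiv_convolution {κ F : Space n → ℝ} (hκ : ContDiff ℝ ∞ κ) (hκc : HasCompactSupport κ)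
    (hF : Continuous F) (i : Fin n) :
    pderiv i (κ ⋆[ContinuousLinearMap.lsmul ℝ ℝ, volume] F)
      = (pderiv i κ ⋆[ContinuousLinearMap.lsmul ℝ ℝ, volume] F) := by
  ext x
  have h := HasCompactSupport.hasFDerivAt_convolution_left (μ := (volume : Measure (Space n)))
    (ContinuousLinearMap.lsmul ℝ ℝ)
    hκc (hκ.of_le (by simp)) hF.locallyIntegrable x
  rw [pderiv, h.fderiv]
  have hi : Integrable (fun t => (ContinuousLinearMap.precompL (Space n)
      (ContinuousLinearMap.lsmul ℝ ℝ)) (fderiv ℝ κ t) (F (x - t))) volume := by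
    refine (HasCompactSupport.convolutionExists_left_of_continuous_right _ (hκc.fderiv ℝ)
      ?_ hF x)
    exact (hκ.continuous_fderiv (by simp)).locallyIntegrable
  unfold convolution
  rw [ContinuousLinearMap.integral_apply hi]
  rfl

theorem lap_convolution {κ F : Space n → ℝ} (hκ : ContDiff ℝ ∞ κ) (hκc : HasCompactSupport κ)
    (hF : Continuous F) (x : Space n) :
    lap (κ ⋆[ContinuousLinearMap.lsmul ℝ ℝ, volume] F) x = ∫ t, lap κ t * F (x - t) := by
  have h1 : ∀ i, pderiv i (pderiv i (κ ⋆[ContinuousLinearMap.lsmul ℝ ℝ, volume] F)) x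
      = ∫ t, pderiv i (pderiv i κ) t * F (x - t) := by
    intro i
    rw [pderiv_convolution hκ hκc hF, pderiv_convolution (contDiff_pderiv hκ i)
      (hasCompactSupport_pderiv hκc i) hF]
    rfl
  unfold lap
  simp only [h1, Finset.sum_mul]
  rw [integral_finsetSum]
  intro i _
  have hc := (contDiff_pderiv (contDiff_pderiv hκ i) i).continuous
  exact Continuous.integrable_of_hasCompactSupport (by fun_prop)
    (hasCompactSupport_pderiv (hasCompactSupport_pderiv hκc i) i).mul_right

/-- A continuous function with continuous weak Laplacian is approximated, uniformly on balls and
together with its Laplacian, by test functions. -/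
theorem exists_contDiff_approx {F S : Space n → ℝ} (hF : Continuous F) (hS : Continuous S)
    (hFS : HasWeakLaplacian F S) {M δ : ℝ} (hM : 0 ≤ M) (hδ : 0 < δ) :
    ∃ ζ : Space n → ℝ, ContDiff ℝ ∞ ζ ∧ HasCompactSupport ζ ∧
      ∀ x ∈ Metric.closedBall (0 : Space n) M, |ζ x - F x| ≤ δ ∧ |lap ζ x - S x| ≤ δ := by
  -- The radius `M + 2` leaves room for a mollifier of radius at most `1`: around any point of the
  -- ball of radius `M`, the mollifier sees only points where the cutoff equals `1`.
  let b : ContDiffBump (0 : Space n) := ⟨M + 2, M + 3, by linarith, by linarith⟩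
  have hb1 : ∀ y : Space n, ‖y‖ ≤ M + 2 → b y = 1 := fun y hy =>
    b.one_of_mem_closedBall (by rwa [mem_closedBall_zero_iff])
  have hbc : Continuous b := b.continuous
  have key : ∀ {E : Space n → ℝ}, Continuous E → ∃ r : ℝ, 0 < r ∧ ∀ x y : Space n,
      dist x y < r → dist (b x * E x) (b y * E y) < δ := by
    intro E hE
    have hu : UniformContinuous (fun x => b x * E x) :=
      HasCompactSupport.uniformContinuous_of_continuous b.hasCompactSupport.mul_right (by fun_prop)
    obtain ⟨r, hr, h⟩ := Metric.uniformContinuous_iff.1 hu δ hδ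
    exact ⟨r, hr, fun x y => @h x y⟩
  obtain ⟨r₁, hr₁, h₁⟩ := key hF
  obtain ⟨r₂, hr₂, h₂⟩ := key hS
  obtain ⟨r, hr, hr1, hrr₁, hrr₂⟩ : ∃ r : ℝ, 0 < r ∧ r ≤ 1 ∧ r ≤ r₁ ∧ r ≤ r₂ :=
    ⟨min 1 (min r₁ r₂), by positivity, min_le_left _ _,
      (min_le_right _ _).trans (min_le_left _ _), (min_le_right _ _).trans (min_le_right _ _)⟩
  let k : ContDiffBump (0 : Space n) := ⟨r / 2, r, by positivity, by linarith⟩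
  set κ : Space n → ℝ := k.normed volume with hκdef
  have hκ : ContDiff ℝ ∞ κ := k.contDiff_normed
  have hκc : HasCompactSupport κ := k.hasCompactSupport_normed
  have hκ0 : ∀ t, r < ‖t‖ → κ t = 0 := by
    intro t ht
    refine image_eq_zero_of_notMem_tsupport ?_
    rw [hκdef, k.tsupport_normed_eq, mem_closedBall_zero_iff]
    exact not_le.2 ht
  have hlap0 : ∀ t, r < ‖t‖ → lap κ t = 0 := by
    intro t ht
    have ht' : t ∉ tsupport κ := by
      rw [hκdef, k.tsupport_normed_eq, mem_closedBall_zero_iff]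
      exact not_le.2 ht
    refine Finset.sum_eq_zero fun i _ => ?_
    have h1 : t ∉ tsupport (pderiv i (pderiv i κ)) := fun h =>
      ht' ((tsupport_fderiv_apply_subset ℝ _).trans (tsupport_fderiv_apply_subset ℝ _) h)
    exact image_eq_zero_of_notMem_tsupport h1
  have hbF : Continuous (fun x => b x * F x) := by fun_prop
  have hbS : Continuous (fun x => b x * S x) := by fun_prop
  refine ⟨κ ⋆[ContinuousLinearMap.lsmul ℝ ℝ, volume] (fun x => b x * F x), ?_, ?_, ?_⟩
  · exact HasCompactSupport.contDiff_convolution_left (n := ⊤) _ hκc hκ hbF.locallyIntegrable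
  · exact HasCompactSupport.convolution _ hκc b.hasCompactSupport.mul_right
  intro x hx
  rw [mem_closedBall_zero_iff] at hx
  constructor
  · have := k.dist_normed_convolution_le (μ := volume) (g := fun x => b x * F x) (x₀ := x) (ε := δ)
      hbF.aestronglyMeasurable (fun y hy => (h₁ y x (lt_of_lt_of_le hy hrr₁)).le)
    rw [Real.dist_eq] at this
    simpa only [hb1 x (by linarith), one_mul] using this
  · have := k.dist_normed_convolution_le (μ := volume) (g := fun x => b x * S x) (x₀ := x) (ε := δ)
      hbS.aestronglyMeasurable (fun y hy => (h₂ y x (lt_of_lt_of_le hy hrr₂)).le)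
    rw [Real.dist_eq] at this
    simp only [hb1 x (by linarith), one_mul] at this
    have hb1' : ∀ t : Space n, ‖t‖ ≤ r → b (x - t) = 1 := fun t ht =>
      hb1 _ ((norm_sub_le _ _).trans (by linarith))
    -- The Laplacian falls on the kernel, the weak identity is applied to the test function `y ↦ κ
    -- (x - y)`, and the cutoff may be dropped and reinserted because it is `1` wherever that test
    -- function is nonzero.
    have e : lap (κ ⋆[ContinuousLinearMap.lsmul ℝ ℝ, volume] (fun x => b x * F x)) x
        = (κ ⋆[ContinuousLinearMap.lsmul ℝ ℝ, volume] (fun x => b x * S x)) x := by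
      rw [lap_convolution hκ hκc hbF]
      calc ∫ t, lap κ t * (b (x - t) * F (x - t))
          = ∫ t, F (x - t) * lap (fun y => κ (x - y)) (x - t) := by
            congr 1; ext t
            rw [lap_const_sub hκ, sub_sub_cancel]
            by_cases ht : ‖t‖ ≤ r
            · rw [hb1' t ht]; ring
            · rw [hlap0 t (not_le.1 ht)]; ring
        _ = ∫ y, F y * lap (fun y => κ (x - y)) y :=
            integral_sub_left_eq_self (fun y => F y * lap (fun y => κ (x - y)) y) volume x
        _ = ∫ y, S y * κ (x - y) := by
            refine hFS _ (hκ.comp (contDiff_const.sub contDiff_id)) ?_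
            exact hκc.comp_homeomorph (Homeomorph.subLeft x)
        _ = ∫ t, S (x - t) * κ t := by
            rw [← integral_sub_left_eq_self (fun y => S y * κ (x - y)) volume x]
            simp only [sub_sub_cancel]
        _ = _ := by
            unfold convolution
            congr 1; ext t
            simp only [ContinuousLinearMap.lsmul_apply, smul_eq_mul]
            by_cases ht : ‖t‖ ≤ r
            · rw [hb1' t ht]; ring
            · rw [hκ0 t (not_le.1 ht)]; ring
    rw [e]
    exact this

end Mollify

/-! ### From the weak gradient to the Laplacian of the test function. -/

section WeakGradient

variable {n : ℕ}

theorem gradient_apply (f : Space n → ℝ) (x : Space n) (i : Fin n) :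
    gradient f x i = pderiv i f x := by
  have h := InnerProductSpace.toDual_symm_apply (𝕜 := ℝ) (x := EuclideanSpace.single i (1 : ℝ))
    (y := fderiv ℝ f x)
  rw [EuclideanSpace.inner_single_right] at h
  simpa [gradient, pderiv] using h

theorem continuous_gradient {f : Space n → ℝ} (hf : ContDiff ℝ ∞ f) : Continuous (gradient f) :=
  (InnerProductSpace.toDual ℝ (Space n)).symm.continuous.comp (hf.continuous_fderiv (by simp))

theorem hasCompactSupport_gradient {f : Space n → ℝ} (hf : HasCompactSupport f) :
    HasCompactSupport (gradient f) :=
  (hf.fderiv ℝ).comp_left (g := (InnerProductSpace.toDual ℝ (Space n)).symm) (by simp)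

/-- The defining vector identity is applied to each partial derivative of `ζ`; its component in the
same direction is kept, and these components are summed. -/
theorem HasWeakGradient.integral_inner_gradient {f : Space n → ℝ} {g : Space n → Space n}
    (h : HasWeakGradient f g) (hf : LocallyIntegrable f) (hg : LocallyIntegrable g)
    {ζ : Space n → ℝ} (hζ : ContDiff ℝ ∞ ζ) (hζc : HasCompactSupport ζ) :
    ∫ x, inner ℝ (g x) (gradient ζ x) = -∫ x, f x * lap ζ x := by
  have hp := fun i => contDiff_pderiv hζ i
  have hpc := fun i => hasCompactSupport_pderiv hζc i
  have i1 : ∀ i, Integrable (fun x => pderiv i ζ x • g x) := fun i =>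
    hg.integrable_smul_left_of_hasCompactSupport (hp i).continuous (hpc i)
  have i2 : ∀ i, Integrable (fun x => f x • gradient (pderiv i ζ) x) := fun i =>
    hf.integrable_smul_right_of_hasCompactSupport (continuous_gradient (hp i))
      (hasCompactSupport_gradient (hpc i))
  have i3 : ∀ i, Integrable (fun x => pderiv i ζ x * g x i) := fun i =>
    (EuclideanSpace.proj (𝕜 := ℝ) i : Space n →L[ℝ] ℝ).integrable_comp (i1 i)
  have i4 : ∀ i, Integrable (fun x => f x * pderiv i (pderiv i ζ) x) := fun i => by
    have := (EuclideanSpace.proj (𝕜 := ℝ) i : Space n →L[ℝ] ℝ).integrable_comp (i2 i)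
    refine this.congr (Eventually.of_forall fun x => ?_)
    simp [gradient_apply]
  have comp : ∀ i, ∫ x, pderiv i ζ x * g x i = -∫ x, f x * pderiv i (pderiv i ζ) x := by
    intro i
    have h1 := congrArg (fun v => (EuclideanSpace.proj (𝕜 := ℝ) i : Space n →L[ℝ] ℝ) v)
      (h (pderiv i ζ) (hp i) (hpc i))
    simp only [map_neg] at h1
    rw [← ContinuousLinearMap.integral_comp_comm _ (i2 i),
      ← ContinuousLinearMap.integral_comp_comm _ (i1 i)] at h1
    simp only [PiLp.proj_apply, PiLp.smul_apply, smul_eq_mul, gradient_apply] at h1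
    linarith
  calc ∫ x, inner ℝ (g x) (gradient ζ x) = ∫ x, ∑ i, pderiv i ζ x * g x i := by
        congr 1; ext x
        rw [PiLp.inner_apply]
        simp [gradient_apply]
    _ = ∑ i, ∫ x, pderiv i ζ x * g x i := integral_finsetSum _ fun i _ => i3 i
    _ = -∑ i, ∫ x, f x * pderiv i (pderiv i ζ) x := by
        rw [← Finset.sum_neg_distrib]; exact Finset.sum_congr rfl fun i _ => comp i
    _ = _ := by
        rw [← integral_finsetSum _ fun i _ => i4 i]
        simp only [lap, Finset.mul_sum]

end WeakGradient

/-! ### The weak equation tested with products of a time cutoff and a spatial profile. -/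

section WeakForm

variable {n : ℕ} {Tm : ℝ≥0∞} {ε R : ℝ} {D V f₀ f₁ : Space n → ℝ} {w wt : ℝ × Space n → ℝ}
  {dw : ℝ × Space n → Space n} {N : ℝ × Space n → ℝ}

/-- One component of the system: a weak solution `w` of `w_tt - Δw + D w_t + V w = N` with data
`ε (f₀, f₁)` supported in the light cone. -/
structure IsWaveComponent (Tm : ℝ≥0∞) (ε R : ℝ) (D V f₀ f₁ : Space n → ℝ) (w wt : ℝ × Space n → ℝ)
    (dw : ℝ × Space n → Space n) (N : ℝ × Space n → ℝ) : Prop where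
  energy : IsEnergyClass Tm w wt dw
  init : ∀ᵐ x : Space n, w (0, x) = ε * f₀ x
  eq : IsWeakEquation Tm ε D V f₀ f₁ w wt dw N
  speed : ∀ t ∈ timeInterval Tm, ∀ᵐ x : Space n, t + R < ‖x‖ → w (t, x) = 0
  speed_source : ∀ᵐ z ∂(volume.restrict (slab n Tm)), z.1 + R < ‖z.2‖ → N z = 0
  continuous_D : Continuous D
  continuous_V : Continuous V
  continuous₀ : Continuous f₀
  continuous₁ : Continuous f₁
  supp₀ : Function.support f₀ ⊆ Metric.closedBall 0 R
  supp₁ : Function.support f₁ ⊆ Metric.closedBall 0 R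

/-- The time cutoff `h`, made compactly supported without changing it for `t ≥ -1`. -/
noncomputable def pastCutoff (h : ℝ → ℝ) (t : ℝ) : ℝ := h t * Real.smoothTransition (t + 2)

theorem pastCutoff_eq (h : ℝ → ℝ) {t : ℝ} (ht : -1 ≤ t) : pastCutoff h t = h t := by
  rw [pastCutoff, Real.smoothTransition.one_of_one_le (by linarith), mul_one]

theorem deriv_pastCutoff (h : ℝ → ℝ) {t : ℝ} (ht : 0 ≤ t) : deriv (pastCutoff h) t = deriv h t := by
  refine Filter.EventuallyEq.deriv_eq ?_
  filter_upwards [lt_mem_nhds (show (-1 : ℝ) < t by linarith)] with s hs using pastCutoff_eq h hs.le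

theorem isTestFunction_pastCutoff {h : ℝ → ℝ} (hh : ContDiff ℝ ∞ h) {T : ℝ}
    (hT : ENNReal.ofReal T < Tm) (hhT : ∀ t, T ≤ t → h t = 0) {ζ : Space n → ℝ}
    (hζ : ContDiff ℝ ∞ ζ) (hζc : HasCompactSupport ζ) :
    IsTestFunction Tm (fun z : ℝ × Space n => pastCutoff h z.1 * ζ z.2) := by
  have hsub : Function.support (fun z : ℝ × Space n => pastCutoff h z.1 * ζ z.2)
      ⊆ Icc (-2) T ×ˢ tsupport ζ := by
    intro z hz
    have h1 := left_ne_zero_of_mul hz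
    have h2 := right_ne_zero_of_mul hz
    refine ⟨⟨?_, ?_⟩, subset_tsupport _ h2⟩
    · by_contra h3
      refine h1 ?_
      rw [pastCutoff, Real.smoothTransition.zero_of_nonpos (by linarith), mul_zero]
    · by_contra h3
      exact h1 (by rw [pastCutoff, hhT _ (not_le.1 h3).le, zero_mul])
  have hcomp : IsCompact (Icc (-2) T ×ˢ tsupport ζ) := isCompact_Icc.prod hζc
  refine ⟨?_, HasCompactSupport.of_support_subset_isCompact hcomp hsub, ?_⟩
  · have h1 : ContDiff ℝ ∞ (pastCutoff h) :=
      hh.mul (Real.smoothTransition.contDiff.comp (contDiff_id.add contDiff_const))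
    exact (h1.comp contDiff_fst).mul (hζ.comp contDiff_snd)
  · intro z hz
    have := closure_minimal hsub hcomp.isClosed hz
    exact (ENNReal.ofReal_le_ofReal this.1.2).trans_lt hT

/-- At `t = T` the function is known to vanish on one side only; as it is differentiable, the
one-sided derivative already determines the derivative. -/
theorem deriv_eq_zero_of_le {h : ℝ → ℝ} (hh : Differentiable ℝ h) {T : ℝ}
    (hhT : ∀ t, T ≤ t → h t = 0) : ∀ t, T ≤ t → deriv h t = 0 := by
  intro t ht
  have h1 : HasDerivWithinAt h (deriv h t) (Ici t) t := (hh t).hasDerivAt.hasDerivWithinAt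
  have h2 : HasDerivWithinAt h 0 (Ici t) t :=
    (hasDerivWithinAt_const t (Ici t) (0 : ℝ)).congr (fun s hs => hhT s (ht.trans hs)) (hhT t ht)
  exact (uniqueDiffOn_Ici t t self_mem_Ici).eq_deriv _ h1 h2

theorem IsEnergyClass.integrableOn (hw : IsEnergyClass Tm w wt dw) {R T : ℝ}
    (hT : ENNReal.ofReal T < Tm) : IntegrableOn w (coneBox n R T) ∧
      IntegrableOn wt (coneBox n R T) ∧ IntegrableOn dw (coneBox n R T) := by
  obtain ⟨U, Ut, dU, h1, h2, h3, h4, h5, -, -, h6⟩ := hw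
  exact ⟨integrableOn_coneBox_of_represents h1 h4 hT, integrableOn_coneBox_of_represents h2 h6 hT,
    integrableOn_coneBox_of_represents h3 h5 hT⟩

theorem IsWaveComponent.ae_slab (hW : IsWaveComponent Tm ε R D V f₀ f₁ w wt dw N) :
    (∀ᵐ z ∂(volume.restrict (slab n Tm)), z.1 + R < ‖z.2‖ → w z = 0) ∧
      (∀ᵐ z ∂(volume.restrict (slab n Tm)), z.1 + R < ‖z.2‖ → wt z = 0) := by
  obtain ⟨U, Ut, dU, h1, h2, h3, h4, h5, -, h7, h6⟩ := hW.energy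
  refine ⟨ae_slab_of_forall_ae h1.1 (Eventually.of_forall hW.speed),
    ae_slab_of_forall_ae h2.1 ?_⟩
  -- The support argument for the time derivative needs a nondegenerate interval `[0, t]`; the time
  -- `0` is negligible.
  have : ∀ᵐ t : ℝ, t ≠ 0 := by rw [ae_iff]; simp
  filter_upwards [this] with t ht0 ht
  exact deriv_eq_zero_outside_cone h1 h2 h7 hW.speed ht (lt_of_le_of_ne ht.1 ht0.symm)

/-- The gradient term of the weak form, integrated by parts in space. -/
theorem IsEnergyClass.integral_inner_gradient (hw : IsEnergyClass Tm w wt dw) {T : ℝ}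
    (hT : ENNReal.ofReal T < Tm) {h : ℝ → ℝ} (hh : Continuous h)
    (hhT : ∀ t, T ≤ t → h t = 0) {ζ : Space n → ℝ} (hζ : ContDiff ℝ ∞ ζ)
    (hζc : HasCompactSupport ζ) :
    ∫ z in slab n Tm, inner ℝ (dw z) (h z.1 • gradient ζ z.2)
      = -∫ z in slab n Tm, w z * (h z.1 * lap ζ z.2) := by
  obtain ⟨U, Ut, dU, h1, h2, h3, h4, h5, hg, -, h6⟩ := hw
  obtain ⟨M, hM⟩ := hζc.isCompact.isBounded.subset_closedBall (0 : Space n)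
  have hζ0 : ∀ x, M < ‖x‖ → gradient ζ x = 0 ∧ lap ζ x = 0 := by
    intro x hx
    have hx' : x ∉ tsupport ζ := fun h => by
      have := mem_closedBall_zero_iff.1 (hM h); linarith
    have hz : ∀ i, x ∉ tsupport (pderiv i ζ) := fun i h =>
      hx' (tsupport_fderiv_apply_subset ℝ _ h)
    refine ⟨?_, Finset.sum_eq_zero fun i _ => ?_⟩
    · ext i; rw [gradient_apply]; exact image_eq_zero_of_notMem_tsupport (hz i)
    · exact image_eq_zero_of_notMem_tsupport fun h => hz i (tsupport_fderiv_apply_subset ℝ _ h)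
  have hslab : ∀ᵐ z ∂(volume.restrict (slab n Tm)), z.1 + M < ‖z.2‖ → M < ‖z.2‖ := by
    refine (ae_restrict_iff' measurableSet_slab).2 (Eventually.of_forall fun z hz hz' => ?_)
    have : 0 ≤ z.1 := hz.1
    linarith
  have hgc := continuous_gradient hζ
  have hlc := (contDiff_lap hζ).continuous
  rw [setIntegral_slab_eq_coneBox (R := M) hT (fun z hz => by rw [hhT _ hz.le]; simp)
    (by filter_upwards [hslab] with z hz hz'; rw [(hζ0 _ (hz hz')).1]; simp),
    setIntegral_slab_eq_coneBox (R := M) hT (fun z hz => by rw [hhT _ hz.le]; simp)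
    (by filter_upwards [hslab] with z hz hz'; rw [(hζ0 _ (hz hz')).2]; simp)]
  have hsub := Icc_subset_timeInterval hT
  have i1 : IntegrableOn (fun z => w z * (h z.1 * lap ζ z.2)) (coneBox n M T) :=
    (integrableOn_coneBox_of_represents h1 h4 hT).mul_continuousOn (by fun_prop)
      (isCompact_coneBox M T)
  have i2 : IntegrableOn (fun z => inner ℝ (dw z) (h z.1 • gradient ζ z.2)) (coneBox n M T) := by
    have hdw := integrableOn_coneBox_of_represents (R := M) h3 h5 hT
    have hdn : IntegrableOn (fun z => ‖dw z‖) (coneBox n M T) := hdw.norm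
    have hb : IntegrableOn (fun z => ‖dw z‖ * ‖h z.1 • gradient ζ z.2‖) (coneBox n M T) :=
      hdn.mul_continuousOn (by fun_prop) (isCompact_coneBox M T)
    refine Integrable.mono' hb (hdw.1.inner (Continuous.aestronglyMeasurable (by fun_prop))) ?_
    exact Eventually.of_forall fun z => norm_inner_le_norm _ _
  unfold IntegrableOn at i1 i2
  rw [restrict_coneBox] at i1 i2 ⊢
  rw [integral_prod _ i1, integral_prod _ i2, ← integral_neg]
  refine setIntegral_congr_fun measurableSet_Icc fun t ht => ?_
  simp only []
  have hball : ∀ x : Space n, x ∉ Metric.closedBall (0 : Space n) (T + M) → M < ‖x‖ := by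
    intro x hx
    rw [mem_closedBall_zero_iff, not_le] at hx
    have := ht.1.trans ht.2; linarith
  rw [setIntegral_eq_integral_of_forall_compl_eq_zero
    (fun x hx => by rw [(hζ0 x (hball x hx)).1]; simp),
    setIntegral_eq_integral_of_forall_compl_eq_zero
    (fun x hx => by rw [(hζ0 x (hball x hx)).2]; simp)]
  have l1 : LocallyIntegrable (fun x => w (t, x)) :=
    ((Lp.memLp (U t)).ae_eq (h1.2 t (hsub ht)).symm).locallyIntegrable (by norm_num)
  have l2 : LocallyIntegrable (fun x => dw (t, x)) :=
    ((Lp.memLp (dU t)).ae_eq (h3.2 t (hsub ht)).symm).locallyIntegrable (by norm_num)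
  have := (hg t (hsub ht)).integral_inner_gradient l1 l2 hζ hζc
  calc ∫ x, inner ℝ (dw (t, x)) (h t • gradient ζ x)
      = h t * ∫ x, inner ℝ (dw (t, x)) (gradient ζ x) := by
        rw [← integral_const_mul]; congr 1; ext x; rw [real_inner_smul_right]
    _ = -∫ x, w (t, x) * (h t * lap ζ x) := by
        rw [this, mul_neg, ← integral_const_mul]; congr 2; ext x; ring

/-- The weak equation provides integrability of the source only against test functions, so one equal
to `1` on the box is used. The intermediate time `T'` leaves room for its time cutoff to vanish
before `Tm`. -/
theorem IsWaveComponent.integrableOn_source (hW : IsWaveComponent Tm ε R D V f₀ f₁ w wt dw N)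
    {R' T : ℝ} (hT0 : 0 ≤ T) (hT : ENNReal.ofReal T < Tm) : IntegrableOn N (coneBox n R' T) := by
  obtain ⟨T', hTT', hT'⟩ := ENNReal.lt_iff_exists_nnreal_btwn.1 hT
  have hTT : T < T' := by
    have := (ENNReal.ofReal_lt_iff_lt_toReal hT0 ENNReal.coe_ne_top).1 hTT'
    simpa using this
  let h : ℝ → ℝ := fun t => Real.smoothTransition ((T' - t) / (T' - T))
  have hh : ContDiff ℝ ∞ h := Real.smoothTransition.contDiff.comp
    ((contDiff_const.sub contDiff_id).div_const _)
  have hM : 0 < |T + R'| + 1 := by positivity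
  let b : ContDiffBump (0 : Space n) := ⟨|T + R'| + 1, |T + R'| + 2, hM, by linarith⟩
  have htest := isTestFunction_pastCutoff (Tm := Tm) (T := T') hh (by simpa using hT')
    (fun t ht => Real.smoothTransition.zero_of_nonpos
      (div_nonpos_of_nonpos_of_nonneg (by linarith) (by linarith)))
    b.contDiff b.hasCompactSupport
  have h1 := ((hW.eq _ htest).1).mono_set (coneBox_subset_slab (R := R') hT)
  refine h1.congr_fun (fun z hz => ?_) (measurableSet_coneBox _ _)
  have h2 : pastCutoff h z.1 = 1 := by
    rw [pastCutoff_eq h (by have := hz.1.1; linarith)]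
    refine Real.smoothTransition.one_of_one_le ?_
    rw [one_le_div (by linarith)]
    have := hz.1.2; linarith
  have h3 : b z.2 = 1 := b.one_of_mem_closedBall (by
    have := mem_closedBall_zero_iff.1 hz.2
    rw [mem_closedBall_zero_iff]
    have := le_abs_self (T + R')
    simp only [b]; linarith)
  simp only [h2, h3, mul_one]

theorem IsWaveComponent.time_by_parts (hW : IsWaveComponent Tm ε R D V f₀ f₁ w wt dw N)
    {T : ℝ} (hT0 : 0 ≤ T) (hT : ENNReal.ofReal T < Tm) {F : Space n → ℝ} (hF : Continuous F)
    {e : ℝ → ℝ} (he : ContDiff ℝ 1 e) (heT : e T = 0) :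
    ∫ z in coneBox n R T, wt z * (e z.1 * F z.2)
      = -(e 0 * (ε * ∫ x, f₀ x * F x)) - ∫ z in coneBox n R T, w z * (deriv e z.1 * F z.2) := by
  obtain ⟨U, Ut, dU, h1, h2, h3, h4, h5, -, h7, h6⟩ := hW.energy
  rw [integral_coneBox_time_by_parts h1 h2 h4 h6 h7 hT0 hT hF he heT]
  have e1 : ∫ x in Metric.closedBall (0 : Space n) (T + R), f₀ x * F x = ∫ x, f₀ x * F x := by
    refine setIntegral_eq_integral_of_forall_compl_eq_zero fun x hx => ?_
    have : f₀ x = 0 := by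
      by_contra h0
      exact hx (Metric.closedBall_subset_closedBall (by linarith) (hW.supp₀ h0))
    rw [this, zero_mul]
  have e2 : ∫ x in Metric.closedBall (0 : Space n) (T + R), w (0, x) * F x
      = ∫ x in Metric.closedBall (0 : Space n) (T + R), ε * (f₀ x * F x) := by
    refine integral_congr_ae (ae_restrict_of_ae ?_)
    filter_upwards [hW.init] with x hx
    rw [hx]; ring
  rw [e2, integral_const_mul, e1]

/-- The weak equation tested against `h(t) ζ(x)` with `ζ` smooth. -/
theorem IsWaveComponent.integral_smooth (hW : IsWaveComponent Tm ε R D V f₀ f₁ w wt dw N)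
    {T : ℝ} (hT0 : 0 ≤ T) (hT : ENNReal.ofReal T < Tm) {h : ℝ → ℝ} (hh : ContDiff ℝ ∞ h)
    (hhT : ∀ t, T ≤ t → h t = 0) {ζ : Space n → ℝ} (hζ : ContDiff ℝ ∞ ζ)
    (hζc : HasCompactSupport ζ) :
    (∫ z in coneBox n R T, N z * h z.1 * ζ z.2)
        + ε * (h 0 * (∫ x, f₁ x * ζ x) + h 0 * (∫ x, f₀ x * D x * ζ x)
          - deriv h 0 * ∫ x, f₀ x * ζ x)
      = (∫ z in coneBox n R T, w z * deriv (deriv h) z.1 * ζ z.2)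
        - (∫ z in coneBox n R T, w z * h z.1 * lap ζ z.2)
        - (∫ z in coneBox n R T, w z * D z.2 * deriv h z.1 * ζ z.2)
        + ∫ z in coneBox n R T, w z * V z.2 * h z.1 * ζ z.2 := by
  have hhd : Differentiable ℝ h := hh.differentiable (by simp)
  have hd0 := deriv_eq_zero_of_le hhd hhT
  have hhd1 : ContDiff ℝ 1 (deriv h) :=
    ((contDiff_infty_iff_deriv.1 hh).2).of_le (by simp)
  have heq := (hW.eq _ (isTestFunction_pastCutoff hh hT hhT hζ hζc)).2
  obtain ⟨hw0, hwt0⟩ := hW.ae_slab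
  have hnn : ∀ {z : ℝ × Space n}, z ∈ slab n Tm → 0 ≤ z.1 := fun hz => hz.1
  have hp0 : pastCutoff h 0 = h 0 := pastCutoff_eq h (by norm_num)
  have hpz : ∀ {z : ℝ × Space n}, z ∈ slab n Tm → pastCutoff h z.1 = h z.1 := fun hz =>
    pastCutoff_eq h (by have := hnn hz; linarith)
  have hdt : ∀ {z : ℝ × Space n}, z ∈ slab n Tm →
      dt (fun z : ℝ × Space n => pastCutoff h z.1 * ζ z.2) z = deriv h z.1 * ζ z.2 := by
    intro z hz
    simp only [dt]
    rw [deriv_mul_const_field, deriv_pastCutoff h (hnn hz)]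
  have hdx : ∀ {z : ℝ × Space n}, z ∈ slab n Tm →
      dx (fun z : ℝ × Space n => pastCutoff h z.1 * ζ z.2) z = h z.1 • gradient ζ z.2 := by
    intro z hz
    simp only [dx, gradient]
    rw [hpz hz, fderiv_const_mul (hζ.differentiable (by simp) _), map_smul]
  have e1 : ∫ z in slab n Tm, N z * (pastCutoff h z.1 * ζ z.2)
      = ∫ z in coneBox n R T, N z * h z.1 * ζ z.2 := by
    rw [setIntegral_congr_fun (g := fun z => N z * h z.1 * ζ z.2) measurableSet_slab
      (fun z hz => by simp only [hpz hz]; ring)]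
    refine setIntegral_slab_eq_coneBox hT (fun z hz => by rw [hhT _ hz.le]; simp) ?_
    filter_upwards [hW.speed_source] with z hz hz'
    rw [hz hz']; simp
  have e2 : ∫ z in slab n Tm, wt z * dt (fun z : ℝ × Space n => pastCutoff h z.1 * ζ z.2) z
      = ∫ z in coneBox n R T, wt z * (deriv h z.1 * ζ z.2) := by
    rw [setIntegral_congr_fun (g := fun z => wt z * (deriv h z.1 * ζ z.2)) measurableSet_slab
      (fun z hz => by simp only [hdt hz])]
    refine setIntegral_slab_eq_coneBox hT (fun z hz => by rw [hd0 _ hz.le]; simp) ?_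
    filter_upwards [hwt0] with z hz hz'
    rw [hz hz']; simp
  have e3 : ∫ z in slab n Tm,
        inner ℝ (dw z) (dx (fun z : ℝ × Space n => pastCutoff h z.1 * ζ z.2) z)
      = -∫ z in coneBox n R T, w z * h z.1 * lap ζ z.2 := by
    rw [setIntegral_congr_fun (g := fun z => inner ℝ (dw z) (h z.1 • gradient ζ z.2))
      measurableSet_slab (fun z hz => by simp only [hdx hz]),
      hW.energy.integral_inner_gradient hT hh.continuous hhT hζ hζc,
      setIntegral_slab_eq_coneBox (R := R) hT (fun z hz => by rw [hhT _ hz.le]; simp)]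
    · simp only [mul_assoc]
    · filter_upwards [hw0] with z hz hz'
      rw [hz hz']; simp
  have e4 : ∫ z in slab n Tm,
        w z * D z.2 * dt (fun z : ℝ × Space n => pastCutoff h z.1 * ζ z.2) z
      = ∫ z in coneBox n R T, w z * D z.2 * deriv h z.1 * ζ z.2 := by
    rw [setIntegral_congr_fun (g := fun z => w z * D z.2 * deriv h z.1 * ζ z.2) measurableSet_slab
      (fun z hz => by simp only [hdt hz]; ring)]
    refine setIntegral_slab_eq_coneBox hT (fun z hz => by rw [hd0 _ hz.le]; simp) ?_
    filter_upwards [hw0] with z hz hz'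
    rw [hz hz']; simp
  have e5 : ∫ z in slab n Tm, V z.2 * w z * (pastCutoff h z.1 * ζ z.2)
      = ∫ z in coneBox n R T, w z * V z.2 * h z.1 * ζ z.2 := by
    rw [setIntegral_congr_fun (g := fun z => w z * V z.2 * h z.1 * ζ z.2) measurableSet_slab
      (fun z hz => by simp only [hpz hz]; ring)]
    refine setIntegral_slab_eq_coneBox hT (fun z hz => by rw [hhT _ hz.le]; simp) ?_
    filter_upwards [hw0] with z hz hz'
    rw [hz hz']; simp
  -- The last time derivative passes from `wt` to `deriv h`. The boundary at `0` yields the term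
  -- with `deriv h 0` and the data; the boundary at `T` is empty because `deriv h` vanishes there as
  -- well.
  have e6 := hW.time_by_parts hT0 hT hζ.continuous hhd1 (hd0 T le_rfl)
  have e7 : ∀ g : Space n → ℝ, ∫ x, g x * (pastCutoff h 0 * ζ x) = h 0 * ∫ x, g x * ζ x := by
    intro g
    rw [← integral_const_mul, hp0]; congr 1; ext x; ring
  rw [e1, e2, e3, e4, e5, e6, e7, e7] at heq
  simp only [mul_assoc] at heq ⊢
  linarith

theorem tendsto_setIntegral_mul {α : Type*} [TopologicalSpace α] [T2Space α] [MeasurableSpace α]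
    [BorelSpace α] [SecondCountableTopologyEither α ℝ] {μ : Measure α} {K : Set α}
    (hK : IsCompact K) {f g : α → ℝ} {G : ℕ → α → ℝ} (hf : IntegrableOn f K μ)
    (hg : Continuous g) (hG : ∀ k, Continuous (G k))
    (h : ∀ k : ℕ, ∀ x ∈ K, |G k x - g x| ≤ 1 / ((k : ℝ) + 1)) :
    Tendsto (fun k => ∫ x in K, f x * G k x ∂μ) atTop (𝓝 (∫ x in K, f x * g x ∂μ)) := by
  rw [tendsto_iff_norm_sub_tendsto_zero]
  have hlim : Tendsto (fun k : ℕ => (∫ x in K, ‖f x‖ ∂μ) * (1 / ((k : ℝ) + 1))) atTop (𝓝 0) := by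
    simpa using tendsto_one_div_add_atTop_nhds_zero_nat.const_mul (∫ x in K, ‖f x‖ ∂μ)
  refine squeeze_zero (fun _ => norm_nonneg _) (fun k => ?_) hlim
  rw [← integral_sub (hf.mul_continuousOn (hG k).continuousOn hK)
    (hf.mul_continuousOn hg.continuousOn hK), ← integral_mul_const]
  refine norm_integral_le_of_norm_le (hf.norm.mul_const _) ?_
  refine (ae_restrict_iff' hK.isClosed.measurableSet).2 (Eventually.of_forall fun x hx => ?_)
  rw [← mul_sub, norm_mul]
  exact mul_le_mul_of_nonneg_left (h k x hx) (norm_nonneg _)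

/-- The weak equation tested against `h(t) F(x)`, where `F` has Laplacian `S`. -/
theorem IsWaveComponent.integral_weakLaplacian (hW : IsWaveComponent Tm ε R D V f₀ f₁ w wt dw N)
    (hR : 0 ≤ R) {T : ℝ} (hT0 : 0 ≤ T) (hT : ENNReal.ofReal T < Tm) {h : ℝ → ℝ}
    (hh : ContDiff ℝ ∞ h) (hhT : ∀ t, T ≤ t → h t = 0) {F S : Space n → ℝ} (hF : Continuous F)
    (hS : Continuous S) (hFS : HasWeakLaplacian F S) :
    (∫ z in coneBox n R T, N z * h z.1 * F z.2)
        + ε * (h 0 * (∫ x, f₁ x * F x) + h 0 * (∫ x, f₀ x * D x * F x)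
          - deriv h 0 * ∫ x, f₀ x * F x)
      = (∫ z in coneBox n R T, w z * deriv (deriv h) z.1 * F z.2)
        - (∫ z in coneBox n R T, w z * h z.1 * S z.2)
        - (∫ z in coneBox n R T, w z * D z.2 * deriv h z.1 * F z.2)
        + ∫ z in coneBox n R T, w z * V z.2 * h z.1 * F z.2 := by
  -- The source and the solution are integrable on the box, so the limit passes once `ζ k` and its
  -- Laplacian converge uniformly there.
  have happ : ∀ k : ℕ, ∃ ζ : Space n → ℝ, ContDiff ℝ ∞ ζ ∧ HasCompactSupport ζ ∧
      ∀ x ∈ Metric.closedBall (0 : Space n) (T + R),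
        |ζ x - F x| ≤ 1 / ((k : ℝ) + 1) ∧ |lap ζ x - S x| ≤ 1 / ((k : ℝ) + 1) :=
    fun k => exists_contDiff_approx hF hS hFS (by positivity) (by positivity)
  choose ζ hζ hζc hζb using happ
  have hhc := hh.continuous
  have hh1 : ContDiff ℝ ∞ (deriv h) := (contDiff_infty_iff_deriv.1 hh).2
  have hhc1 := hh1.continuous
  have hhc2 : Continuous (deriv (deriv h)) := ((contDiff_infty_iff_deriv.1 hh1).2).continuous
  have hDc := hW.continuous_D
  have hVc := hW.continuous_V
  have hNi : IntegrableOn N (coneBox n R T) := hW.integrableOn_source hT0 hT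
  have hwi : IntegrableOn w (coneBox n R T) := (hW.energy.integrableOn hT).1
  have hK := isCompact_coneBox (n := n) R T
  have t1 : ∀ {f : ℝ × Space n → ℝ}, IntegrableOn f (coneBox n R T) →
      Tendsto (fun k => ∫ z in coneBox n R T, f z * ζ k z.2) atTop
        (𝓝 (∫ z in coneBox n R T, f z * F z.2)) := fun hf =>
    tendsto_setIntegral_mul hK hf (by fun_prop) (fun k => (hζ k).continuous.comp continuous_snd)
      (fun k z hz => (hζb k z.2 hz.2).1)
  have t2 : ∀ {f : ℝ × Space n → ℝ}, IntegrableOn f (coneBox n R T) →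
      Tendsto (fun k => ∫ z in coneBox n R T, f z * lap (ζ k) z.2) atTop
        (𝓝 (∫ z in coneBox n R T, f z * S z.2)) := fun hf =>
    tendsto_setIntegral_mul hK hf (by fun_prop)
      (fun k => (contDiff_lap (hζ k)).continuous.comp continuous_snd)
      (fun k z hz => (hζb k z.2 hz.2).2)
  have t3 : ∀ {f : Space n → ℝ}, Continuous f → Function.support f ⊆ Metric.closedBall 0 R →
      Tendsto (fun k => ∫ x, f x * ζ k x) atTop (𝓝 (∫ x, f x * F x)) := by
    intro f hf hfs
    have e : ∀ G : Space n → ℝ, ∫ x, f x * G x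
        = ∫ x in Metric.closedBall (0 : Space n) R, f x * G x := by
      intro G
      refine (setIntegral_eq_integral_of_forall_compl_eq_zero fun x hx => ?_).symm
      have : f x = 0 := by by_contra h0; exact hx (hfs h0)
      rw [this, zero_mul]
    simp only [e]
    refine tendsto_setIntegral_mul (isCompact_closedBall _ _)
      (hf.continuousOn.integrableOn_compact (isCompact_closedBall _ _)) hF
      (fun k => (hζ k).continuous) (fun k x hx => (hζb k x ?_).1)
    exact Metric.closedBall_subset_closedBall (by linarith) hx
  have c1 := hW.continuous₁
  have c0 := hW.continuous₀
  have hL := ((t1 (hNi.mul_continuousOn (g' := fun z => h z.1) (by fun_prop) hK)).add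
    ((((t3 c1 hW.supp₁).const_mul (h 0)).add
      ((t3 (f := fun x => f₀ x * D x) (by fun_prop)
        ((Function.support_mul_subset_left _ _).trans hW.supp₀)).const_mul (h 0))).sub
      ((t3 c0 hW.supp₀).const_mul (deriv h 0)) |>.const_mul ε))
  have hR' := (((t1 (hwi.mul_continuousOn (g' := fun z => deriv (deriv h) z.1)
      (by fun_prop) hK)).sub
    (t2 (hwi.mul_continuousOn (g' := fun z => h z.1) (by fun_prop) hK))).sub
    (t1 ((hwi.mul_continuousOn (g' := fun z => D z.2) (by fun_prop) hK).mul_continuousOn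
      (g' := fun z => deriv h z.1) (by fun_prop) hK))).add
    (t1 ((hwi.mul_continuousOn (g' := fun z => V z.2) (by fun_prop) hK).mul_continuousOn
      (g' := fun z => h z.1) (by fun_prop) hK))
  exact tendsto_nhds_unique (hL.congr fun k =>
    hW.integral_smooth hT0 hT hh hhT (hζ k) (hζc k)) hR'

end WeakForm

/-! ### Construction of the time cutoff. -/

section Profile

/-- A smooth cutoff profile: `1` on `t ≤ 1/2`, `0` on `t ≥ 1`, with derivatives controlled by
`H ^ κ` and second derivative bounded below by a multiple of `-H`. -/
structure IsProfile (κ C : ℝ) (H : ℝ → ℝ) : Prop where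
  smooth : ContDiff ℝ ∞ H
  eq_one : ∀ t, t ≤ 1 / 2 → H t = 1
  eq_zero : ∀ t, 1 ≤ t → H t = 0
  antitone : Antitone H
  deriv₁ : ∀ t ∈ Icc (0 : ℝ) 1, |deriv H t| ≤ C * H t ^ κ
  deriv₂ : ∀ t ∈ Icc (0 : ℝ) 1, |deriv (deriv H) t| ≤ C * H t ^ κ
  deriv₃ : ∀ t ∈ Icc (0 : ℝ) 1, |deriv (deriv (deriv H)) t| ≤ C * H t ^ κ
  le_deriv₂ : ∀ t ∈ Icc (0 : ℝ) 1, -(C * H t) ≤ deriv (deriv H) t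

theorem IsProfile.nonneg {κ C : ℝ} {H : ℝ → ℝ} (hH : IsProfile κ C H) (t : ℝ) : 0 ≤ H t := by
  have := hH.antitone (le_max_left t 1)
  rwa [hH.eq_zero _ (le_max_right t 1)] at this

theorem IsProfile.le_one {κ C : ℝ} {H : ℝ → ℝ} (hH : IsProfile κ C H) (t : ℝ) : H t ≤ 1 := by
  have := hH.antitone (min_le_left t (1 / 2))
  rwa [hH.eq_one _ (min_le_right t (1 / 2))] at this

/-- The root is the normalised tail integral of a bump on `[1/2, 1]`. For `τ ≥ 3/4` the first factor
of the bump is `1` and the second is decreasing, so the root is convex on the last quarter. -/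
theorem exists_profile_root : ∃ s s₁ s₂ s₃ : ℝ → ℝ, ContDiff ℝ ∞ s ∧
    (∀ t, HasDerivAt s (s₁ t) t) ∧ (∀ t, HasDerivAt s₁ (s₂ t) t) ∧
    (∀ t, HasDerivAt s₂ (s₃ t) t) ∧ (∀ t, t ≤ 1 / 2 → s t = 1) ∧ (∀ t, 1 ≤ t → s t = 0) ∧
    Antitone s ∧ 0 < s (3 / 4) ∧ (∀ t, 3 / 4 < t → 0 ≤ s₂ t) ∧
    ∃ B, 0 ≤ B ∧ ∀ t ∈ Icc (0 : ℝ) 1, |s₁ t| ≤ B ∧ |s₂ t| ≤ B ∧ |s₃ t| ≤ B := by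
  let b : ℝ → ℝ := fun τ => Real.smoothTransition (4 * τ - 2) * Real.smoothTransition (4 - 4 * τ)
  have hb : ContDiff ℝ ∞ b :=
    (Real.smoothTransition.contDiff.comp ((contDiff_const.mul contDiff_id).sub contDiff_const)).mul
      (Real.smoothTransition.contDiff.comp (contDiff_const.sub (contDiff_const.mul contDiff_id)))
  have hbc := hb.continuous
  have hb1 : ContDiff ℝ ∞ (deriv b) := (contDiff_infty_iff_deriv.1 hb).2
  have hb2 : ContDiff ℝ ∞ (deriv (deriv b)) := (contDiff_infty_iff_deriv.1 hb1).2
  have hb0 : ∀ τ, 0 ≤ b τ := fun τ =>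
    mul_nonneg (Real.smoothTransition.nonneg _) (Real.smoothTransition.nonneg _)
  have hbz1 : ∀ τ, τ ≤ 1 / 2 → b τ = 0 := fun τ hτ => by
    simp only [b]; rw [Real.smoothTransition.zero_of_nonpos (by linarith), zero_mul]
  have hbz2 : ∀ τ, 1 ≤ τ → b τ = 0 := fun τ hτ => by
    simp only [b]; rw [mul_comm, Real.smoothTransition.zero_of_nonpos (by linarith), zero_mul]
  have hii : ∀ x y, IntervalIntegrable b volume x y := fun x y => hbc.intervalIntegrable _ _
  have hpos : ∀ x, 1 / 2 ≤ x → x < 1 → 0 < ∫ τ in x..1, b τ := fun x hx hx1 =>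
    intervalIntegral.intervalIntegral_pos_of_pos_on (hii _ _) (fun τ hτ =>
      mul_pos (Real.smoothTransition.pos_of_pos (by linarith [hτ.1]))
        (Real.smoothTransition.pos_of_pos (by linarith [hτ.2]))) hx1
  set I := ∫ τ in (1 / 2 : ℝ)..1, b τ with hI
  have hI0 : 0 < I := hpos _ le_rfl (by norm_num)
  let s : ℝ → ℝ := fun t => (∫ τ in t..1, b τ) / I
  have hs : ∀ t, HasDerivAt s (-b t / I) t := fun t =>
    (intervalIntegral.integral_hasDerivAt_left (hii _ _)
      (hbc.stronglyMeasurableAtFilter _ _) hbc.continuousAt).div_const I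
  have hderiv : deriv s = fun t => -b t / I := funext fun t => (hs t).deriv
  have hss : ContDiff ℝ ∞ s := by
    rw [contDiff_infty_iff_deriv]
    refine ⟨fun t => (hs t).differentiableAt, ?_⟩
    rw [hderiv]
    exact hb.neg.div_const I
  refine ⟨s, fun t => -b t / I, fun t => -deriv b t / I, fun t => -deriv (deriv b) t / I, hss, hs,
    fun t => ((hb.differentiable (by simp) t).hasDerivAt.fun_neg).div_const I,
    fun t => ((hb1.differentiable (by simp) t).hasDerivAt.fun_neg).div_const I, ?_, ?_, ?_, ?_, ?_, ?_⟩
  · intro t ht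
    have h1 : ∫ τ in t..(1 / 2 : ℝ), b τ = 0 := by
      rw [intervalIntegral.integral_congr (g := fun _ => 0)]
      · simp
      · intro τ hτ
        rw [uIcc_of_le ht] at hτ
        exact hbz1 τ hτ.2
    simp only [s]
    rw [← intervalIntegral.integral_add_adjacent_intervals (hii t (1 / 2)) (hii (1 / 2) 1), h1,
      zero_add, ← hI, div_self hI0.ne']
  · intro t ht
    have h1 : ∫ τ in t..1, b τ = 0 := by
      rw [intervalIntegral.integral_congr (g := fun _ => 0)]
      · simp
      · intro τ hτ
        rw [uIcc_of_ge ht] at hτ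
        exact hbz2 τ hτ.1
    simp only [s, h1, zero_div]
  · refine antitone_of_deriv_nonpos (fun t => (hs t).differentiableAt) fun t => ?_
    rw [(hs t).deriv]
    exact div_nonpos_of_nonpos_of_nonneg (neg_nonpos.2 (hb0 t)) hI0.le
  · exact div_pos (hpos _ (by norm_num) (by norm_num)) hI0
  · intro t ht
    have h1 : AntitoneOn b (Ici (3 / 4)) := by
      intro x hx y hy hxy
      have e : ∀ z ∈ Ici (3 / 4 : ℝ), b z = Real.smoothTransition (4 - 4 * z) := by
        intro z hz
        have hz : (3 / 4 : ℝ) ≤ z := hz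
        simp only [b]
        rw [Real.smoothTransition.one_of_one_le (by linarith), one_mul]
      rw [e x hx, e y hy]
      exact Real.smoothTransition.monotone (by linarith)
    have h2 : derivWithin b (Ici (3 / 4)) t ≤ 0 := h1.derivWithin_nonpos
    rw [derivWithin_of_mem_nhds (Ici_mem_nhds ht)] at h2
    exact div_nonneg (by linarith) hI0.le
  · have hbd : ∀ f : ℝ → ℝ, Continuous f → ∃ B, 0 ≤ B ∧ ∀ t ∈ Icc (0 : ℝ) 1, |f t| ≤ B := by
      intro f hf
      obtain ⟨B, hB⟩ := isCompact_Icc.exists_bound_of_continuousOn (s := Icc (0 : ℝ) 1)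
        hf.continuousOn
      exact ⟨B, (norm_nonneg _).trans (hB 0 ⟨le_rfl, zero_le_one⟩), hB⟩
    have c1 := hb1.continuous
    have c2 := hb2.continuous
    obtain ⟨B₁, h1, h1'⟩ := hbd (fun t => -b t / I) (by fun_prop)
    obtain ⟨B₂, h2, h2'⟩ := hbd (fun t => -deriv b t / I) (by fun_prop)
    obtain ⟨B₃, h3, h3'⟩ := hbd (fun t => -deriv (deriv b) t / I) (by fun_prop)
    refine ⟨B₁ + B₂ + B₃, by positivity, fun t ht => ⟨?_, ?_, ?_⟩⟩
    · have := h1' t ht; linarith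
    · have := h2' t ht; linarith
    · have := h3' t ht; linarith

theorem abs_mul_le_of_le {x y X Y : ℝ} (hx : 0 ≤ x) (hxX : x ≤ X) (hy : |y| ≤ Y) :
    |x * y| ≤ X * Y := by
  rw [abs_mul, abs_of_nonneg hx]
  exact mul_le_mul hxX hy (abs_nonneg _) (hx.trans hxX)

/-- The profile is a high power of the root. Its derivatives up to order three retain a factor `s ^
K`, and `s ^ K ≤ (s ^ (K + 3)) ^ κ` as soon as `κ (K + 3) ≤ K`. For the lower bound on the second
derivative, the root is convex beyond `3/4` and bounded below by a positive constant before it. -/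
theorem exists_profile {κ : ℝ} (hκ1 : κ < 1) : ∃ H C, 0 < C ∧ IsProfile κ C H := by
  obtain ⟨s, s₁, s₂, s₃, hs, d1, d2, d3, hs1, hs0, hanti, hs34, hconv, B, hB, hb⟩ :=
    exists_profile_root
  obtain ⟨K, hK⟩ : ∃ K : ℕ, 3 / (1 - κ) ≤ K := exists_nat_ge _
  rw [div_le_iff₀ (by linarith)] at hK
  have hs0' : ∀ t, 0 ≤ s t := fun t => by
    have := hanti (le_max_left t 1); rwa [hs0 _ (le_max_right t 1)] at this
  have hs1' : ∀ t, s t ≤ 1 := fun t => by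
    have := hanti (min_le_left t (1 / 2)); rwa [hs1 _ (min_le_right t (1 / 2))] at this
  have e1 : deriv (fun t => s t ^ (K + 3)) = fun t => (K + 3) * (s t ^ (K + 2) * s₁ t) := by
    ext t
    refine ((d1 t).fun_pow (K + 3)).deriv.trans ?_
    push_cast [Nat.add_succ_sub_one]
    ring
  have e2 : deriv (fun t => (K + 3) * (s t ^ (K + 2) * s₁ t))
      = fun t => (K + 3) * ((K + 2) * s t ^ (K + 1) * s₁ t ^ 2 + s t ^ (K + 2) * s₂ t) := by
    ext t
    refine ((((d1 t).fun_pow (K + 2)).fun_mul (d2 t)).const_mul ((K : ℝ) + 3)).deriv.trans ?_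
    push_cast [Nat.add_succ_sub_one]
    ring
  have e3 : deriv (fun t => (K + 3) * ((K + 2) * s t ^ (K + 1) * s₁ t ^ 2 + s t ^ (K + 2) * s₂ t))
      = fun t => (K + 3) * ((K + 2) * (K + 1) * s t ^ K * s₁ t ^ 3
        + 3 * (K + 2) * s t ^ (K + 1) * s₁ t * s₂ t + s t ^ (K + 2) * s₃ t) := by
    ext t
    refine ((((((d1 t).fun_pow (K + 1)).const_mul ((K : ℝ) + 2)).fun_mul ((d2 t).fun_pow 2)).fun_add
      (((d1 t).fun_pow (K + 2)).fun_mul (d3 t))).const_mul ((K : ℝ) + 3)).deriv.trans ?_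
    push_cast [Nat.add_succ_sub_one]
    ring
  set C : ℝ := 1 + (K + 3) * B + (K + 3) * ((K + 2) * B ^ 2 + B)
    + (K + 3) * ((K + 2) * (K + 1) * B ^ 3 + 3 * (K + 2) * B * B + B)
    + (K + 3) * B / s (3 / 4) with hC
  have c1 : 0 ≤ (K + 3) * B := by positivity
  have c2 : 0 ≤ (K + 3) * ((K + 2) * B ^ 2 + B) := by positivity
  have c3 : 0 ≤ (K + 3) * ((K + 2) * (K + 1) * B ^ 3 + 3 * (K + 2) * B * B + B) := by positivity
  have c4 : 0 ≤ (K + 3) * B / s (3 / 4) := by positivity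
  have hsK : ∀ t, s t ^ K ≤ (s t ^ (K + 3)) ^ κ := by
    intro t
    rw [← Real.rpow_natCast, ← Real.rpow_natCast, ← Real.rpow_mul (hs0' t)]
    rcases (hs0' t).eq_or_lt with h0 | h0
    · rw [← h0, Real.zero_rpow]
      · positivity
      · intro h
        rw [h, zero_mul] at hK; linarith
    · refine Real.rpow_le_rpow_of_exponent_ge h0 (hs1' t) ?_
      push_cast
      linarith
  have hp : ∀ t j, s t ^ (K + j) ≤ s t ^ K := fun t j =>
    pow_le_pow_of_le_one (hs0' t) (hs1' t) (by omega)
  refine ⟨fun t => s t ^ (K + 3), C, by linarith, hs.pow _, fun t ht => by simp [hs1 t ht],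
    fun t ht => by simp [hs0 t ht], fun x y hxy => pow_le_pow_left₀ (hs0' y) (hanti hxy) _,
    ?_, ?_, ?_, ?_⟩
  · intro t ht
    obtain ⟨b1, b2, b3⟩ := hb t ht
    rw [e1]
    have := hs0' t
    calc |(K + 3) * (s t ^ (K + 2) * s₁ t)| ≤ (K + 3) * (s t ^ K * B) := by
          rw [abs_mul, abs_of_nonneg (by positivity : (0 : ℝ) ≤ K + 3)]
          exact mul_le_mul_of_nonneg_left (abs_mul_le_of_le (by positivity) (hp t 2) b1)
            (by positivity)
      _ = (K + 3) * B * s t ^ K := by ring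
      _ ≤ C * (s t ^ (K + 3)) ^ κ := by
          gcongr
          · linarith
          · exact hsK t
  · intro t ht
    obtain ⟨b1, b2, b3⟩ := hb t ht
    rw [e1, e2]
    have := hs0' t
    calc |((K : ℝ) + 3) * ((K + 2) * s t ^ (K + 1) * s₁ t ^ 2 + s t ^ (K + 2) * s₂ t)|
        = ((K : ℝ) + 3) * |(K + 2) * (s t ^ (K + 1) * s₁ t ^ 2) + s t ^ (K + 2) * s₂ t| := by
          rw [abs_mul, abs_of_nonneg (by positivity : (0 : ℝ) ≤ K + 3), mul_assoc ((K : ℝ) + 2)]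
      _ ≤ (K + 3) * ((K + 2) * (s t ^ K * B ^ 2) + s t ^ K * B) := by
          refine mul_le_mul_of_nonneg_left ((abs_add_le _ _).trans (add_le_add ?_
            (abs_mul_le_of_le (by positivity) (hp t 2) b2))) (by positivity)
          rw [abs_mul, abs_of_nonneg (by positivity : (0 : ℝ) ≤ K + 2)]
          exact mul_le_mul_of_nonneg_left (abs_mul_le_of_le (by positivity) (hp t 1)
            (by rw [abs_pow]; gcongr)) (by positivity)
      _ = (K + 3) * ((K + 2) * B ^ 2 + B) * s t ^ K := by ring
      _ ≤ C * (s t ^ (K + 3)) ^ κ := by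
          gcongr
          · linarith
          · exact hsK t
  · intro t ht
    obtain ⟨b1, b2, b3⟩ := hb t ht
    rw [e1, e2, e3]
    have := hs0' t
    calc |((K : ℝ) + 3) * ((K + 2) * (K + 1) * s t ^ K * s₁ t ^ 3
          + 3 * (K + 2) * s t ^ (K + 1) * s₁ t * s₂ t + s t ^ (K + 2) * s₃ t)|
        = ((K : ℝ) + 3) * |(K + 2) * (K + 1) * (s t ^ K * s₁ t ^ 3)
          + 3 * (K + 2) * (s t ^ (K + 1) * (s₁ t * s₂ t)) + s t ^ (K + 2) * s₃ t| := by
          rw [abs_mul, abs_of_nonneg (by positivity : (0 : ℝ) ≤ K + 3)]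
          ring_nf
      _ ≤ (K + 3) * ((K + 2) * (K + 1) * (s t ^ K * B ^ 3)
          + 3 * (K + 2) * (s t ^ K * (B * B)) + s t ^ K * B) := by
          refine mul_le_mul_of_nonneg_left ((abs_add_le _ _).trans (add_le_add
            ((abs_add_le _ _).trans (add_le_add ?_ ?_))
            (abs_mul_le_of_le (by positivity) (hp t 2) b3))) (by positivity)
          · rw [abs_mul, abs_of_nonneg (by positivity : (0 : ℝ) ≤ (K + 2) * (K + 1))]
            exact mul_le_mul_of_nonneg_left (abs_mul_le_of_le (by positivity) le_rfl
              (by rw [abs_pow]; gcongr)) (by positivity)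
          · rw [abs_mul, abs_of_nonneg (by positivity : (0 : ℝ) ≤ 3 * (K + 2))]
            exact mul_le_mul_of_nonneg_left (abs_mul_le_of_le (by positivity) (hp t 1)
              (by rw [abs_mul]; gcongr)) (by positivity)
      _ = (K + 3) * ((K + 2) * (K + 1) * B ^ 3 + 3 * (K + 2) * B * B + B) * s t ^ K := by ring
      _ ≤ C * (s t ^ (K + 3)) ^ κ := by
          gcongr
          · linarith
          · exact hsK t
  · intro t ht
    obtain ⟨b1, b2, b3⟩ := hb t ht
    rw [e1, e2]
    have h0 := hs0' t
    have h1 : 0 ≤ ((K : ℝ) + 3) * ((K + 2) * s t ^ (K + 1) * s₁ t ^ 2) := by positivity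
    have h2 : 0 ≤ s t ^ (K + 3) := by positivity
    rcases lt_or_ge (3 / 4) t with h34 | h34
    · have h3 := hconv t h34
      have h4 : 0 ≤ ((K : ℝ) + 3) * (s t ^ (K + 2) * s₂ t) := by positivity
      have h5 : 0 ≤ C * s t ^ (K + 3) := mul_nonneg (by linarith) h2
      simp only []
      linarith
    · have h3 : s (3 / 4) ≤ s t := hanti h34
      have h4 : -B ≤ s₂ t := (abs_le.1 b2).1
      have h5 : s t ^ (K + 2) ≤ s t ^ (K + 3) / s (3 / 4) := by
        rw [le_div_iff₀ hs34, pow_succ (s t) (K + 2)]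
        gcongr
      have h6 : ((K : ℝ) + 3) * (s t ^ (K + 2) * s₂ t) ≥ -((K + 3) * B / s (3 / 4) * s t ^ (K + 3)) := by
        calc ((K : ℝ) + 3) * (s t ^ (K + 2) * s₂ t) ≥ (K + 3) * (s t ^ (K + 2) * (-B)) := by gcongr
          _ = -((K + 3) * B * s t ^ (K + 2)) := by ring
          _ ≥ -((K + 3) * B * (s t ^ (K + 3) / s (3 / 4))) := by
              apply neg_le_neg; gcongr
          _ = _ := by ring
      have h7 : (K + 3) * B / s (3 / 4) * s t ^ (K + 3) ≤ C * s t ^ (K + 3) := by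
        gcongr; linarith
      simp only []
      linarith

end Profile

/-! ### The truncated test function and its corrector. -/

section TestPair

variable {n : ℕ} {Tm : ℝ≥0∞} {ε R : ℝ} {D V f₀ f₁ : Space n → ℝ} {w wt : ℝ × Space n → ℝ}
  {dw : ℝ × Space n → Space n} {N : ℝ × Space n → ℝ}

theorem deriv_exp_mul {E : ℝ → ℝ} (hE : Differentiable ℝ E) (lam : ℝ) :
    deriv (fun t => Real.exp (-(lam * t)) * E t)
      = fun t => Real.exp (-(lam * t)) * (deriv E t - lam * E t) := by
  ext t
  have h1 : HasDerivAt (fun t : ℝ => -(lam * t)) (-lam) t := by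
    simpa using ((hasDerivAt_id t).const_mul lam).fun_neg
  refine (h1.exp.fun_mul (hE t).hasDerivAt).deriv.trans ?_
  ring

theorem deriv_deriv_exp_mul {E : ℝ → ℝ} (hE : ContDiff ℝ ∞ E) (lam : ℝ) :
    deriv (deriv (fun t => Real.exp (-(lam * t)) * E t))
      = fun t => Real.exp (-(lam * t)) * (deriv (deriv E) t - 2 * lam * deriv E t + lam ^ 2 * E t) := by
  have h0 : Differentiable ℝ E := hE.differentiable (by simp)
  have h1 : Differentiable ℝ (deriv E) :=
    ((contDiff_infty_iff_deriv.1 hE).2).differentiable (by simp)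
  rw [deriv_exp_mul h0, deriv_exp_mul (h1.fun_sub (h0.const_mul lam))]
  ext t
  rw [deriv_fun_sub (h1 t) ((h0 t).const_mul lam), deriv_const_mul _ (h0 t)]
  ring

theorem contDiff_exp_mul {E : ℝ → ℝ} {k : WithTop ℕ∞} (hE : ContDiff ℝ k E) (lam : ℝ) :
    ContDiff ℝ k (fun t => Real.exp (-(lam * t)) * E t) :=
  (Real.contDiff_exp.comp (contDiff_const.mul contDiff_id).neg).mul hE

theorem IsWaveComponent.integral_weakLaplacian_single
    (hW : IsWaveComponent Tm ε R D V f₀ f₁ w wt dw N)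
    (hR : 0 ≤ R) {T : ℝ} (hT0 : 0 ≤ T) (hT : ENNReal.ofReal T < Tm) {h : ℝ → ℝ}
    (hh : ContDiff ℝ ∞ h) (hhT : ∀ t, T ≤ t → h t = 0) {F S : Space n → ℝ} (hF : Continuous F)
    (hS : Continuous S) (hFS : HasWeakLaplacian F S) :
    (∫ z in coneBox n R T, N z * (h z.1 * F z.2))
        + ε * (h 0 * (∫ x, f₁ x * F x) + h 0 * (∫ x, f₀ x * D x * F x)
          - deriv h 0 * ∫ x, f₀ x * F x)
      = ∫ z in coneBox n R T, w z * (deriv (deriv h) z.1 * F z.2 - h z.1 * S z.2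
          - D z.2 * deriv h z.1 * F z.2 + V z.2 * h z.1 * F z.2) := by
  have h1 := hW.integral_weakLaplacian hR hT0 hT hh hhT hF hS hFS
  have hw := (hW.energy.integrableOn (R := R) hT).1
  have hK := isCompact_coneBox (n := n) R T
  have hd := hW.continuous_D
  have hv := hW.continuous_V
  have hhc := hh.continuous
  have hh1 : ContDiff ℝ ∞ (deriv h) := (contDiff_infty_iff_deriv.1 hh).2
  have hh2 : ContDiff ℝ ∞ (deriv (deriv h)) := (contDiff_infty_iff_deriv.1 hh1).2
  have hh1c := hh1.continuous
  have hh2c := hh2.continuous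
  have key : ∀ g : ℝ × Space n → ℝ, Continuous g →
      Integrable (fun z => w z * g z) (volume.restrict (coneBox n R T)) := fun g hg =>
    hw.mul_continuousOn hg.continuousOn hK
  have i1 := key (fun z => deriv (deriv h) z.1 * F z.2) (by fun_prop)
  have i2 := key (fun z => h z.1 * S z.2) (by fun_prop)
  have i3 := key (fun z => D z.2 * deriv h z.1 * F z.2) (by fun_prop)
  have i4 := key (fun z => V z.2 * h z.1 * F z.2) (by fun_prop)
  simp only [mul_add, mul_sub]
  have s2 : Integrable (fun z => w z * (deriv (deriv h) z.1 * F z.2) - w z * (h z.1 * S z.2))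
    (volume.restrict (coneBox n R T)) := i1.sub i2
  have s3 : Integrable (fun z => w z * (deriv (deriv h) z.1 * F z.2) - w z * (h z.1 * S z.2)
    - w z * (D z.2 * deriv h z.1 * F z.2)) (volume.restrict (coneBox n R T)) := s2.sub i3
  rw [integral_add s3 i4, integral_sub s2 i3, integral_sub i1 i2]
  simp only [← mul_assoc, mul_add, mul_sub] at h1 ⊢
  exact h1

/-- The weak form tested with `exp (-λt) (E φ - E' χ)`. -/
theorem IsWaveComponent.integral_testPair (hW : IsWaveComponent Tm ε R D V f₀ f₁ w wt dw N)
    (hR : 0 ≤ R) {T : ℝ} (hT0 : 0 ≤ T) (hT : ENNReal.ofReal T < Tm) {lam C δ : ℝ}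
    {φ χ : Space n → ℝ} (hP : IsTestPair D V lam C δ φ χ) {E : ℝ → ℝ} (hE : ContDiff ℝ ∞ E)
    (hET : ∀ t, T ≤ t → E t = 0) (hE0 : E 0 = 1) (hE1 : deriv E 0 = 0)
    (hE2 : deriv (deriv E) 0 = 0) :
    (∫ z in coneBox n R T, N z * (Real.exp (-(lam * z.1)) * (E z.1 * φ z.2 - deriv E z.1 * χ z.2)))
        + ε * ((∫ x, f₁ x * φ x) + (∫ x, f₀ x * D x * φ x) + lam * ∫ x, f₀ x * φ x)
      = ∫ z in coneBox n R T, w z * (Real.exp (-(lam * z.1)) *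
          ((deriv (deriv E) z.1 - 2 * lam * deriv E z.1) * φ z.2
            - (deriv (deriv (deriv E)) z.1 - 2 * lam * deriv (deriv E) z.1) * χ z.2
            + D z.2 * deriv (deriv E) z.1 * χ z.2)) := by
  have hφ := hP.continuous_φ
  have hχ := hP.continuous_χ
  have hd := hW.continuous_D
  have hv := hW.continuous_V
  have hE' : ContDiff ℝ ∞ (deriv E) := (contDiff_infty_iff_deriv.1 hE).2
  have hE'' : ContDiff ℝ ∞ (deriv (deriv E)) := (contDiff_infty_iff_deriv.1 hE').2
  have hE''' : ContDiff ℝ ∞ (deriv (deriv (deriv E))) := (contDiff_infty_iff_deriv.1 hE'').2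
  have hc := hE.continuous
  have hc' := hE'.continuous
  have hc'' := hE''.continuous
  have hc''' := hE'''.continuous
  have hdE : Differentiable ℝ E := hE.differentiable (by simp)
  have h1T := deriv_eq_zero_of_le hdE hET
  -- Truncating `exp (-lam t) φ` by `E` leaves `(E'' - 2 lam E' - D E') φ`, in which `D E' φ` has no
  -- factor `lam`. The adjoint operator applied to `exp (-lam t) E' χ` produces the same `-D E' φ`,
  -- from the source in the equation of `χ`; it cancels in the difference of the two identities.
  have a1 := hW.integral_weakLaplacian_single hR hT0 hT (contDiff_exp_mul hE lam)
    (fun t ht => by simp [hET t ht]) hφ (by fun_prop) hP.lap_φ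
  have a2 := hW.integral_weakLaplacian_single hR hT0 hT (contDiff_exp_mul hE' lam)
    (fun t ht => by simp [h1T t ht]) hχ (by fun_prop) hP.lap_χ
  rw [deriv_deriv_exp_mul hE, deriv_exp_mul hdE] at a1
  rw [deriv_deriv_exp_mul hE', deriv_exp_mul (hE'.differentiable (by simp))] at a2
  simp only [hE0, hE1, hE2, mul_zero, Real.exp_zero, neg_zero] at a1 a2
  have hw := (hW.energy.integrableOn (R := R) hT).1
  have hN := hW.integrableOn_source (R' := R) hT0 hT
  have hK := isCompact_coneBox (n := n) R T
  have key : ∀ {u : ℝ × Space n → ℝ} (_ : IntegrableOn u (coneBox n R T)) {g : ℝ × Space n → ℝ},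
      Continuous g → Integrable (fun z => u z * g z) (volume.restrict (coneBox n R T)) :=
    fun hu _ hg => hu.mul_continuousOn hg.continuousOn hK
  have b1 : (∫ z in coneBox n R T,
        N z * (Real.exp (-(lam * z.1)) * (E z.1 * φ z.2 - deriv E z.1 * χ z.2)))
      = (∫ z in coneBox n R T, N z * (Real.exp (-(lam * z.1)) * E z.1 * φ z.2))
        - ∫ z in coneBox n R T, N z * (Real.exp (-(lam * z.1)) * deriv E z.1 * χ z.2) := by
    rw [← integral_sub (key hN (by fun_prop)) (key hN (by fun_prop))]
    congr 1; ext z; ring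
  rw [b1]
  have b2 := congrArg₂ (fun x y => x - y) a1 a2
  rw [← integral_sub (key hw (by fun_prop)) (key hw (by fun_prop))] at b2
  refine Eq.trans ?_ (b2.trans ?_)
  · ring
  · congr 1; ext z; ring

end TestPair

/-! ### Localisation to the light cone and the form of the test inequality. -/

section TestInequality

variable {n : ℕ} {Tm : ℝ≥0∞} {ε R : ℝ} {D V f₀ f₁ : Space n → ℝ} {w wt : ℝ × Space n → ℝ}
  {dw : ℝ × Space n → Space n} {N : ℝ × Space n → ℝ}

theorem deriv_comp_div_const {H : ℝ → ℝ} (hH : Differentiable ℝ H) (T : ℝ) :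
    deriv (fun t => H (t / T)) = fun t => deriv H (t / T) / T := by
  ext t
  refine ((hH (t / T)).hasDerivAt.comp t ((hasDerivAt_id t).div_const T)).deriv.trans ?_
  simp [div_eq_mul_inv]

theorem IsProfile.deriv_scaled {κ C : ℝ} {H : ℝ → ℝ} (hH : IsProfile κ C H) (T : ℝ) :
    deriv (fun t => H (t / T)) = (fun t => deriv H (t / T) / T) ∧
    deriv (deriv (fun t => H (t / T))) = (fun t => deriv (deriv H) (t / T) / T / T) ∧
    deriv (deriv (deriv (fun t => H (t / T))))
      = (fun t => deriv (deriv (deriv H)) (t / T) / T / T / T) := by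
  have h1 : ContDiff ℝ ∞ (deriv H) := (contDiff_infty_iff_deriv.1 hH.smooth).2
  have h2 : ContDiff ℝ ∞ (deriv (deriv H)) := (contDiff_infty_iff_deriv.1 h1).2
  have e1 := deriv_comp_div_const (hH.smooth.differentiable (by simp)) T
  have e2 := deriv_comp_div_const (h1.differentiable (by simp)) T
  have e3 := deriv_comp_div_const (h2.differentiable (by simp)) T
  have e2' : deriv (fun t => deriv H (t / T) / T) = fun t => deriv (deriv H) (t / T) / T / T := by
    ext t; rw [deriv_div_const, e2]
  have e3' : deriv (fun t => deriv (deriv H) (t / T) / T / T)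
      = fun t => deriv (deriv (deriv H)) (t / T) / T / T / T := by
    ext t; rw [deriv_div_const, deriv_div_const, e3]
  refine ⟨e1, by rw [e1, e2'], by rw [e1, e2', e3']⟩

theorem IsProfile.deriv_eq_zero {κ C : ℝ} {H : ℝ → ℝ} (hH : IsProfile κ C H) {t : ℝ}
    (ht : t < 1 / 2) : deriv H t = 0 ∧ deriv (deriv H) t = 0 ∧ deriv (deriv (deriv H)) t = 0 := by
  have h1 : ∀ s < (1 / 2 : ℝ), deriv H s = 0 := fun s hs => by
    have : H =ᶠ[𝓝 s] fun _ => 1 := by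
      filter_upwards [gt_mem_nhds hs] with r hr using hH.eq_one r hr.le
    rw [this.deriv_eq, deriv_const]
  have h2 : ∀ s < (1 / 2 : ℝ), deriv (deriv H) s = 0 := fun s hs => by
    have : deriv H =ᶠ[𝓝 s] fun _ => 0 := by
      filter_upwards [gt_mem_nhds hs] with r hr using h1 r hr
    rw [this.deriv_eq, deriv_const]
  have h3 : ∀ s < (1 / 2 : ℝ), deriv (deriv (deriv H)) s = 0 := fun s hs => by
    have : deriv (deriv H) =ᶠ[𝓝 s] fun _ => 0 := by
      filter_upwards [gt_mem_nhds hs] with r hr using h2 r hr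
    rw [this.deriv_eq, deriv_const]
  exact ⟨h1 t ht, h2 t ht, h3 t ht⟩

/-- The part `a ≤ t ≤ b` of the light cone `|x| ≤ t + R`. -/
def lightCone (n : ℕ) (R a b : ℝ) : Set (ℝ × Space n) :=
  {z | a ≤ z.1 ∧ z.1 ≤ b ∧ ‖z.2‖ ≤ z.1 + R}

theorem lightCone_subset_coneBox {R a b : ℝ} (ha : 0 ≤ a) :
    lightCone n R a b ⊆ coneBox n R b := fun z hz =>
  ⟨⟨ha.trans hz.1, hz.2.1⟩, mem_closedBall_zero_iff.2 (by linarith [hz.2.1, hz.2.2])⟩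

theorem isClosed_lightCone (R a b : ℝ) : IsClosed (lightCone n R a b) :=
  (isClosed_le continuous_const continuous_fst).inter
    ((isClosed_le continuous_fst continuous_const).inter
      (isClosed_le continuous_snd.norm (continuous_fst.add continuous_const)))

theorem measurableSet_lightCone (R a b : ℝ) : MeasurableSet (lightCone n R a b) :=
  (isClosed_lightCone R a b).measurableSet

theorem isCompact_lightCone {R a b : ℝ} (ha : 0 ≤ a) : IsCompact (lightCone n R a b) :=
  (isCompact_coneBox R b).of_isClosed_subset (isClosed_lightCone R a b)
    (lightCone_subset_coneBox ha)

/-- The profile `(1 + λ|x|)^(-(n-1)/2) exp (-λ(t - |x|))` of the test function. -/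
noncomputable def envelope (n : ℕ) (lam : ℝ) (z : ℝ × Space n) : ℝ :=
  (1 + lam * ‖z.2‖) ^ (-(((n : ℝ) - 1) / 2)) * Real.exp (lam * (‖z.2‖ - z.1))

theorem continuous_envelope {lam : ℝ} (h : 0 ≤ lam) : Continuous (envelope n lam) := by
  refine Continuous.mul (Continuous.rpow_const (by fun_prop) fun z => Or.inl ?_) (by fun_prop)
  positivity

theorem envelope_nonneg {lam : ℝ} (h : 0 ≤ lam) (z : ℝ × Space n) : 0 ≤ envelope n lam z := by
  unfold envelope; positivity

/-- The error kernels contain only derivatives of the cutoff, hence vanish before `T / 2`; together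
with finite speed, only the outer shell of the cone contributes. -/
theorem integral_coneBox_le_lightCone {T B : ℝ} (hT : 0 ≤ T)
    (hw : IntegrableOn w (coneBox n R T))
    (hw0 : ∀ᵐ z ∂(volume.restrict (coneBox n R T)), z.1 + R < ‖z.2‖ → w z = 0)
    {k g : ℝ × Space n → ℝ} (hk : Continuous k) (hg : Continuous g)
    (hk0 : ∀ z, z.1 < T / 2 → k z = 0) (hkg : ∀ z ∈ coneBox n R T, |k z| ≤ B * g z) :
    ∫ z in coneBox n R T, w z * k z ≤ B * ∫ z in lightCone n R (T / 2) T, |w z| * g z := by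
  have hsub : lightCone n R (T / 2) T ⊆ coneBox n R T :=
    lightCone_subset_coneBox (by linarith)
  have e1 : ∫ z in coneBox n R T, w z * k z = ∫ z in lightCone n R (T / 2) T, w z * k z := by
    refine setIntegral_eq_of_subset_of_ae_sdiff_eq_zero (measurableSet_coneBox R T).nullMeasurableSet
      hsub ?_
    rw [ae_restrict_iff' (measurableSet_coneBox R T)] at hw0
    filter_upwards [hw0] with z hz hz'
    by_cases h3 : z.1 < T / 2
    · rw [hk0 z h3, mul_zero]
    by_cases h4 : z.1 + R < ‖z.2‖
    · rw [hz hz'.1 h4, zero_mul]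
    · exact absurd ⟨not_lt.1 h3, hz'.1.1.2, not_lt.1 h4⟩ hz'.2
  rw [e1, ← integral_const_mul]
  have hw' := hw.mono_set hsub
  have hK := isCompact_lightCone (n := n) (R := R) (a := T / 2) (b := T) (by linarith)
  refine setIntegral_mono_on (hw'.mul_continuousOn hk.continuousOn hK)
    ((IntegrableOn.mul_continuousOn hw'.norm hg.continuousOn hK).const_mul B) (measurableSet_lightCone _ _ _)
    fun z hz => ?_
  calc w z * k z ≤ |w z| * |k z| := (le_abs_self _).trans (abs_mul _ _).le
    _ ≤ |w z| * (B * g z) := mul_le_mul_of_nonneg_left (hkg z (hsub hz)) (abs_nonneg _)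
    _ = B * (|w z| * g z) := by ring

theorem half_integral_lightCone_le {T : ℝ} (hN : IntegrableOn N (coneBox n R T))
    (hN0 : ∀ z, 0 ≤ N z) {k g : ℝ × Space n → ℝ} (hk : Continuous k) (hg : Continuous g)
    (hg0 : ∀ z ∈ coneBox n R T, 0 ≤ g z) (hkg : ∀ z ∈ coneBox n R T, g z / 2 ≤ k z) :
    (∫ z in lightCone n R 0 T, N z * g z) / 2 ≤ ∫ z in coneBox n R T, N z * k z := by
  have hsub : lightCone n R 0 T ⊆ coneBox n R T := lightCone_subset_coneBox le_rfl
  have hK := isCompact_coneBox (n := n) R T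
  have h1 : ∫ z in lightCone n R 0 T, N z * g z ≤ ∫ z in coneBox n R T, N z * g z :=
    setIntegral_mono_set (hN.mul_continuousOn hg.continuousOn hK)
      ((ae_restrict_iff' (measurableSet_coneBox R T)).2 (Eventually.of_forall fun z hz =>
        mul_nonneg (hN0 z) (hg0 z hz))) hsub.eventuallyLE
  have h2 : (∫ z in coneBox n R T, N z * g z) / 2 ≤ ∫ z in coneBox n R T, N z * k z := by
    rw [← integral_div]
    refine setIntegral_mono_on ((hN.mul_continuousOn hg.continuousOn hK).div_const 2)
      (hN.mul_continuousOn hk.continuousOn hK) (measurableSet_coneBox _ _) fun z hz => ?_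
    rw [mul_div_assoc]
    exact mul_le_mul_of_nonneg_left (hkg z hz) (hN0 z)
  linarith

/-- In the weak form `f₀` appears with the factor `lam` and `f₁` with the factor `1`. As `φ ≥ 1` and
`lam ≤ 1`, both are bounded below with the common factor `lam`; the damping contribution is
nonnegative and is dropped. -/
theorem lam_mul_integral_le {lam C δ : ℝ} (hlam1 : lam ≤ 1) {φ χ : Space n → ℝ}
    (hP : IsTestPair D V lam C δ φ χ) (hlam : 0 ≤ lam) (hD : ∀ x, 0 ≤ D x)
    (hc₀ : Continuous f₀) (hc₁ : Continuous f₁) (hs₀ : Function.support f₀ ⊆ Metric.closedBall 0 R)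
    (hs₁ : Function.support f₁ ⊆ Metric.closedBall 0 R) (h₀ : ∀ x, 0 ≤ f₀ x) (h₁ : ∀ x, 0 ≤ f₁ x) :
    lam * ((∫ x, f₀ x) + ∫ x, f₁ x)
      ≤ (∫ x, f₁ x * φ x) + (∫ x, f₀ x * D x * φ x) + lam * ∫ x, f₀ x * φ x := by
  have hcs : ∀ {f : Space n → ℝ}, Function.support f ⊆ Metric.closedBall 0 R → HasCompactSupport f :=
    fun h => HasCompactSupport.of_support_subset_isCompact (isCompact_closedBall _ _) h
  have hle : ∀ {f : Space n → ℝ}, Continuous f → Function.support f ⊆ Metric.closedBall 0 R →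
      (∀ x, 0 ≤ f x) → ∫ x, f x ≤ ∫ x, f x * φ x := by
    intro f hf hfs hf0
    refine integral_mono (hf.integrable_of_hasCompactSupport (hcs hfs))
      ((hf.mul hP.continuous_φ).integrable_of_hasCompactSupport ((hcs hfs).mul_right)) fun x => ?_
    exact le_mul_of_one_le_right (hf0 x) (hP.one_le x)
  have hφ0 : ∀ x, 0 ≤ φ x := fun x => zero_le_one.trans (hP.one_le x)
  have h2 := hle hc₀ hs₀ h₀
  have h3 := hle hc₁ hs₁ h₁
  have h4 : 0 ≤ ∫ x, f₁ x := integral_nonneg h₁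
  have h5 : 0 ≤ ∫ x, f₀ x * D x * φ x :=
    integral_nonneg fun x => mul_nonneg (mul_nonneg (h₀ x) (hD x)) (hφ0 x)
  have h6 := mul_le_mul_of_nonneg_left h2 hlam
  have h7 := mul_le_of_le_one_left h4 hlam1
  linarith

/-- The integral inequality obtained from one component with the test function of frequency `lam`
on the time scale `T`. -/
def TestInequality (n : ℕ) (R : ℝ) (H : ℝ → ℝ) (κ τ M c lam T : ℝ) (X G : ℝ × Space n → ℝ) : Prop :=
  (∫ z in lightCone n R 0 T, X z * (Real.exp (-(lam * z.1)) * H (z.1 / T))) + lam * c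
    ≤ M * lam ^ τ / T *
      ∫ z in lightCone n R (T / 2) T, |G z| * (H (z.1 / T) ^ κ * envelope n lam z)

end TestInequality

/-! ### The test inequalities for the solution and for its time derivative. -/

section TestEstimate

variable {n : ℕ} {Tm : ℝ≥0∞} {ε R : ℝ} {D V f₀ f₁ : Space n → ℝ} {w wt : ℝ × Space n → ℝ}
  {dw : ℝ × Space n → Space n} {N : ℝ × Space n → ℝ}

theorem IsTestPair.χ_le_of_mem {lam C δ : ℝ} {φ χ : Space n → ℝ} (hP : IsTestPair D V lam C δ φ χ)
    (hC : 0 ≤ C) (hδ : δ ≤ 1) (hR : 0 ≤ R) {T : ℝ} (hT : 1 ≤ T) {z : ℝ × Space n}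
    (hz : z ∈ coneBox n R T) : χ z.2 ≤ C * ((2 + R) * T) ^ (1 - δ) * φ z.2 := by
  have hx : ‖z.2‖ ≤ T + R := mem_closedBall_zero_iff.1 hz.2
  have h0 : 0 ≤ φ z.2 := zero_le_one.trans (hP.one_le _)
  refine (hP.χ_le z.2).trans ?_
  gcongr
  nlinarith

theorem envelope_bound {lam C δ : ℝ} {φ χ : Space n → ℝ} (hP : IsTestPair D V lam C δ φ χ)
    (z : ℝ × Space n) : Real.exp (-(lam * z.1)) * φ z.2 ≤ C * envelope n lam z := by
  have h := mul_le_mul_of_nonneg_left (hP.le_exp z.2) (Real.exp_pos (-(lam * z.1))).le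
  refine h.trans (le_of_eq ?_)
  rw [envelope, mul_sub, sub_eq_add_neg (lam * _), Real.exp_add]
  ring

/-- Every derivative of the cutoff costs `1 / T ≤ lam`. The corrector is of size `T φ` on the box,
which its additional derivative of the cutoff compensates, and `D χ` is bounded by `φ`. So all terms
are of size `lam / T`. -/
theorem abs_testKernel_le {lam C δ CH κ : ℝ} {φ χ : Space n → ℝ} {H : ℝ → ℝ}
    (hP : IsTestPair D V lam C δ φ χ) (hH : IsProfile κ CH H) (hC : 0 ≤ C) (hCH : 0 ≤ CH)
    (hδ0 : 0 ≤ δ) (hδ : δ ≤ 1) (hR : 0 ≤ R) (hD : ∀ x, 0 ≤ D x) {T : ℝ} (hT : 1 ≤ T)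
    (hlam : 0 < lam) (hlamT : 1 ≤ lam * T) {z : ℝ × Space n} (hz : z ∈ coneBox n R T) :
    |Real.exp (-(lam * z.1)) *
        ((deriv (deriv H) (z.1 / T) / T / T - 2 * lam * (deriv H (z.1 / T) / T)) * φ z.2
          - (deriv (deriv (deriv H)) (z.1 / T) / T / T / T
            - 2 * lam * (deriv (deriv H) (z.1 / T) / T / T)) * χ z.2
          + D z.2 * (deriv (deriv H) (z.1 / T) / T / T) * χ z.2)|
      ≤ ((3 * CH + 3 * CH * (C * (2 + R)) + CH * C) * C * lam / T)
        * (H (z.1 / T) ^ κ * envelope n lam z) := by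
  have hT0 : 0 < T := by linarith
  have hs : z.1 / T ∈ Icc (0 : ℝ) 1 :=
    ⟨div_nonneg hz.1.1 hT0.le, (div_le_one hT0).2 hz.1.2⟩
  have d1 := hH.deriv₁ _ hs
  have d2 := hH.deriv₂ _ hs
  have d3 := hH.deriv₃ _ hs
  have hφ1 := hP.one_le z.2
  have hχ0 := hP.nonneg_χ z.2
  have hDχ := hP.Dχ_le z.2
  have henv := envelope_bound hP z
  have hDz := hD z.2
  have hχ : χ z.2 ≤ C * ((2 + R) * T) * φ z.2 := by
    refine (hP.χ_le_of_mem hC hδ hR hT hz).trans ?_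
    have h1 : 1 ≤ (2 + R) * T := by nlinarith
    have h2 : ((2 + R) * T) ^ (1 - δ) ≤ (2 + R) * T := by
      simpa using Real.rpow_le_rpow_of_exponent_le h1 (by linarith : 1 - δ ≤ 1)
    gcongr
  have hh0 : 0 ≤ H (z.1 / T) ^ κ := Real.rpow_nonneg (hH.nonneg _) _
  generalize deriv H (z.1 / T) = x1 at *
  generalize deriv (deriv H) (z.1 / T) = x2 at *
  generalize deriv (deriv (deriv H)) (z.1 / T) = x3 at *
  generalize H (z.1 / T) ^ κ = h at *
  generalize envelope n lam z = E at *
  generalize φ z.2 = a at *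
  generalize χ z.2 = b at *
  generalize D z.2 = d at *
  generalize Real.exp (-(lam * z.1)) = e, Real.exp_pos (-(lam * z.1)) = he at *
  have hi : 1 / T ≤ lam := by rw [div_le_iff₀ hT0]; exact hlamT
  have hi0 : 0 < 1 / T := by positivity
  have e2 : |x2 / T / T| ≤ CH * h * lam * (1 / T) := by
    have : |x2 / T / T| = |x2| * (1 / T) * (1 / T) := by
      rw [abs_div, abs_div, abs_of_pos hT0]; ring
    rw [this]; gcongr
  have e1 : |x1 / T| ≤ CH * h * (1 / T) := by
    have : |x1 / T| = |x1| * (1 / T) := by rw [abs_div, abs_of_pos hT0]; ring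
    rw [this]; gcongr
  have e3 : |x3 / T / T / T| ≤ CH * h * lam * (1 / T) * (1 / T) := by
    have : |x3 / T / T / T| = |x3| * (1 / T) * (1 / T) * (1 / T) := by
      rw [abs_div, abs_div, abs_div, abs_of_pos hT0]; ring
    rw [this]; gcongr
  have e2' : |x2 / T / T| ≤ CH * h * (1 / T) * (1 / T) := by
    have : |x2 / T / T| = |x2| * (1 / T) * (1 / T) := by
      rw [abs_div, abs_div, abs_of_pos hT0]; ring
    rw [this]; gcongr
  have t1 : |(x2 / T / T - 2 * lam * (x1 / T)) * a| ≤ 3 * CH * h * lam * (1 / T) * a := by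
    rw [abs_mul, abs_of_pos (by linarith : 0 < a)]
    gcongr
    refine (abs_sub _ _).trans ?_
    rw [abs_mul (2 * lam), abs_of_pos (by positivity : 0 < 2 * lam)]
    have := mul_le_mul_of_nonneg_left e1 (by positivity : 0 ≤ 2 * lam)
    linarith
  have t2 : |(x3 / T / T / T - 2 * lam * (x2 / T / T)) * b|
      ≤ 3 * CH * (C * (2 + R)) * h * lam * (1 / T) * a := by
    have : |x3 / T / T / T - 2 * lam * (x2 / T / T)| ≤ 3 * CH * h * lam * (1 / T) * (1 / T) := by
      refine (abs_sub _ _).trans ?_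
      rw [abs_mul (2 * lam), abs_of_pos (by positivity : 0 < 2 * lam)]
      have := mul_le_mul_of_nonneg_left e2' (by positivity : 0 ≤ 2 * lam)
      linarith
    rw [abs_mul, abs_of_nonneg hχ0]
    calc _ ≤ (3 * CH * h * lam * (1 / T) * (1 / T)) * (C * ((2 + R) * T) * a) := by gcongr
      _ = 3 * CH * (C * (2 + R)) * h * lam * (1 / T) * a * ((1 / T) * T) := by ring
      _ = _ := by rw [one_div_mul_cancel hT0.ne', mul_one]
  have t3 : |d * (x2 / T / T) * b| ≤ CH * C * h * lam * (1 / T) * a := by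
    have : |d * (x2 / T / T) * b| = (d * b) * |x2 / T / T| := by
      rw [abs_mul, abs_mul, abs_of_nonneg hχ0, abs_of_nonneg hDz]; ring
    rw [this]
    calc _ ≤ (C * a) * (CH * h * lam * (1 / T)) := by
          have : 0 ≤ d * b := mul_nonneg hDz hχ0
          gcongr
      _ = _ := by ring
  rw [abs_mul, abs_of_pos he]
  calc e * |(x2 / T / T - 2 * lam * (x1 / T)) * a
        - (x3 / T / T / T - 2 * lam * (x2 / T / T)) * b + d * (x2 / T / T) * b|
      ≤ e * (3 * CH * h * lam * (1 / T) * a + 3 * CH * (C * (2 + R)) * h * lam * (1 / T) * a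
        + CH * C * h * lam * (1 / T) * a) := by
        gcongr
        exact (abs_add_le _ _).trans (add_le_add ((abs_sub _ _).trans (add_le_add t1 t2)) t3)
    _ = ((3 * CH + 3 * CH * (C * (2 + R)) + CH * C) * lam * (1 / T) * h) * (e * a) := by ring
    _ ≤ ((3 * CH + 3 * CH * (C * (2 + R)) + CH * C) * lam * (1 / T) * h) * (C * E) := by gcongr
    _ = _ := by ring

/-- The cutoff is decreasing and `χ ≥ 0`, so the corrector only increases the test function, which
is thus at least `exp (-lam t) H`. -/
theorem test_inequality_source {lam C δ CH κ : ℝ} {φ χ : Space n → ℝ} {H : ℝ → ℝ}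
    (hP : IsTestPair D V lam C δ φ χ) (hH : IsProfile κ CH H) (hκ : 0 ≤ κ) (hC : 0 ≤ C)
    (hCH : 0 ≤ CH) (hδ0 : 0 ≤ δ) (hδ : δ ≤ 1) (hR : 0 ≤ R) (hD : ∀ x, 0 ≤ D x) {T : ℝ}
    (hT : 1 ≤ T) (hTm : ENNReal.ofReal T < Tm) (hlam : 0 < lam) (hlam1 : lam ≤ 1)
    (hlamT : 1 ≤ lam * T) (hε : 0 ≤ ε) (hf₀ : ∀ x, 0 ≤ f₀ x) (hf₁ : ∀ x, 0 ≤ f₁ x)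
    (hN : ∀ z, 0 ≤ N z) (hW : IsWaveComponent Tm ε R D V f₀ f₁ w wt dw N) :
    (∫ z in lightCone n R 0 T, N z * (Real.exp (-(lam * z.1)) * H (z.1 / T))) / 2
        + lam * (ε * ((∫ x, f₀ x) + ∫ x, f₁ x))
      ≤ ((3 * CH + 3 * CH * (C * (2 + R)) + CH * C) * C * lam / T) *
        ∫ z in lightCone n R (T / 2) T, |w z| * (H (z.1 / T) ^ κ * envelope n lam z) := by
  have hT0 : 0 < T := by linarith
  obtain ⟨q1, q2, q3⟩ := hH.deriv_scaled T
  have hzero : ∀ t, t < T / 2 → t / T < 1 / 2 := fun t ht => by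
    rw [div_lt_iff₀ hT0]; linarith
  have hHc := hH.smooth.continuous
  have h1 : ContDiff ℝ ∞ (deriv H) := (contDiff_infty_iff_deriv.1 hH.smooth).2
  have h2 : ContDiff ℝ ∞ (deriv (deriv H)) := (contDiff_infty_iff_deriv.1 h1).2
  have h3 : ContDiff ℝ ∞ (deriv (deriv (deriv H))) := (contDiff_infty_iff_deriv.1 h2).2
  have hH1c := h1.continuous
  have hH2c := h2.continuous
  have hH3c := h3.continuous
  have hφ := hP.continuous_φ
  have hχ := hP.continuous_χ
  have hd := hW.continuous_D
  have hid := hW.integral_testPair hR hT0.le hTm hP (E := fun t => H (t / T))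
    (hH.smooth.comp (contDiff_id.div_const T)) (fun t ht => hH.eq_zero _ ((one_le_div hT0).2 ht))
    (by rw [zero_div]; exact hH.eq_one _ (by norm_num))
    (by rw [q1]; simp [(hH.deriv_eq_zero (t := 0) (by norm_num)).1])
    (by rw [q2]; simp [(hH.deriv_eq_zero (t := 0) (by norm_num)).2.1])
  rw [q3, q2, q1] at hid
  have hae : ∀ᵐ z ∂(volume.restrict (coneBox n R T)), z.1 + R < ‖z.2‖ → w z = 0 :=
    ae_restrict_of_ae_restrict_of_subset (coneBox_subset_slab hTm) hW.ae_slab.1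
  have hr := integral_coneBox_le_lightCone (g := fun z => H (z.1 / T) ^ κ * envelope n lam z)
    (B := (3 * CH + 3 * CH * (C * (2 + R)) + CH * C) * C * lam / T) hT0.le
    (hW.energy.integrableOn (R := R) hTm).1 hae
    (k := fun z => Real.exp (-(lam * z.1)) *
        ((deriv (deriv H) (z.1 / T) / T / T - 2 * lam * (deriv H (z.1 / T) / T)) * φ z.2
          - (deriv (deriv (deriv H)) (z.1 / T) / T / T / T
            - 2 * lam * (deriv (deriv H) (z.1 / T) / T / T)) * χ z.2
          + D z.2 * (deriv (deriv H) (z.1 / T) / T / T) * χ z.2)) (by fun_prop)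
    (((hHc.comp (continuous_fst.div_const T)).rpow_const fun _ => Or.inr hκ).mul
      (continuous_envelope hlam.le))
    (fun z hz => by
      obtain ⟨r1, r2, r3⟩ := hH.deriv_eq_zero (hzero _ hz)
      simp [r1, r2, r3])
    (fun z hz => abs_testKernel_le hP hH hC hCH hδ0 hδ hR hD hT hlam hlamT hz)
  have hl := half_integral_lightCone_le (hW.integrableOn_source (R' := R) hT0.le hTm) hN
    (g := fun z => Real.exp (-(lam * z.1)) * H (z.1 / T))
    (k := fun z => Real.exp (-(lam * z.1)) *
      (H (z.1 / T) * φ z.2 - deriv H (z.1 / T) / T * χ z.2)) (by fun_prop) (by fun_prop)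
    (fun z _ => mul_nonneg (Real.exp_pos _).le (hH.nonneg _)) (fun z _ => by
      rw [mul_div_assoc]
      refine mul_le_mul_of_nonneg_left ?_ (Real.exp_pos _).le
      have a1 := hH.nonneg (z.1 / T)
      have a2 : deriv H (z.1 / T) / T * χ z.2 ≤ 0 := mul_nonpos_of_nonpos_of_nonneg
        (div_nonpos_of_nonpos_of_nonneg hH.antitone.deriv_nonpos hT0.le) (hP.nonneg_χ _)
      have a3 := mul_le_mul_of_nonneg_left (hP.one_le z.2) a1
      linarith)
  have hdat := mul_le_mul_of_nonneg_left (lam_mul_integral_le hlam1 hP hlam.le hD hW.continuous₀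
    hW.continuous₁ hW.supp₀ hW.supp₁ hf₀ hf₁) hε
  linarith

/-- The cutoff `η - η' / lam` is chosen because `exp (-lam t) (η - η' / lam) = -lam⁻¹ (exp (-lam t)
η)'`. As the coefficients do not depend on time, the error kernel is a time derivative too;
integrating by parts puts the kernel of `η`, divided by `lam`, against `wt`, and the factor `lam`
disappears from the bound. The price is the term `η'' χ / lam` in the test function, which may be
negative. The lower bound on the second derivative of the profile and the sublinear growth of `χ`
make its negative part at most `η φ / 2` once `T ^ δ` is large. -/
theorem test_inequality_deriv {lam C δ CH κ : ℝ} {φ χ : Space n → ℝ} {H : ℝ → ℝ}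
    (hP : IsTestPair D V lam C δ φ χ) (hH : IsProfile κ CH H) (hκ : 0 ≤ κ) (hC : 0 ≤ C)
    (hCH : 0 ≤ CH) (hδ0 : 0 ≤ δ) (hδ : δ ≤ 1) (hR : 0 ≤ R) (hD : ∀ x, 0 ≤ D x) {T : ℝ}
    (hT : 1 ≤ T) (hTδ : 2 * (CH * (C * (2 + R))) ≤ T ^ δ)
    (hTm : ENNReal.ofReal T < Tm) (hlam : 0 < lam) (hlam1 : lam ≤ 1)
    (hlamT : 1 ≤ lam * T) (hε : 0 ≤ ε) (hf₀ : ∀ x, 0 ≤ f₀ x) (hf₁ : ∀ x, 0 ≤ f₁ x)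
    (hN : ∀ z, 0 ≤ N z) (hW : IsWaveComponent Tm ε R D V f₀ f₁ w wt dw N) :
    (∫ z in lightCone n R 0 T, N z * (Real.exp (-(lam * z.1)) * H (z.1 / T))) / 2
        + lam * (ε * ((∫ x, f₀ x) + ∫ x, f₁ x))
      ≤ ((3 * CH + 3 * CH * (C * (2 + R)) + CH * C) * C / T) *
        ∫ z in lightCone n R (T / 2) T, |wt z| * (H (z.1 / T) ^ κ * envelope n lam z) := by
  have hT0 : 0 < T := by linarith
  obtain ⟨q1, q2, q3⟩ := hH.deriv_scaled T
  have hzero : ∀ t, t < T / 2 → t / T < 1 / 2 := fun t ht => by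
    rw [div_lt_iff₀ hT0]; linarith
  set η : ℝ → ℝ := fun t => H (t / T) with hη
  have hηs : ContDiff ℝ ∞ η := hH.smooth.comp (contDiff_id.div_const T)
  have h1 : ContDiff ℝ ∞ (deriv η) := (contDiff_infty_iff_deriv.1 hηs).2
  have h2 : ContDiff ℝ ∞ (deriv (deriv η)) := (contDiff_infty_iff_deriv.1 h1).2
  have h3 : ContDiff ℝ ∞ (deriv (deriv (deriv η))) := (contDiff_infty_iff_deriv.1 h2).2
  have h4 : ContDiff ℝ ∞ (deriv (deriv (deriv (deriv η)))) := (contDiff_infty_iff_deriv.1 h3).2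
  have hHc := hH.smooth.continuous
  have hc0 := hηs.continuous
  have hc1 := h1.continuous
  have hc2 := h2.continuous
  have hc3 := h3.continuous
  have hc4 := h4.continuous
  have hd0 : Differentiable ℝ η := hηs.differentiable (by simp)
  have hd1 : Differentiable ℝ (deriv η) := h1.differentiable (by simp)
  have hd2 : Differentiable ℝ (deriv (deriv η)) := h2.differentiable (by simp)
  have hd3 : Differentiable ℝ (deriv (deriv (deriv η))) := h3.differentiable (by simp)
  have hφ := hP.continuous_φ
  have hχ := hP.continuous_χ
  have hd := hW.continuous_D
  have zT : ∀ t, T ≤ t → η t = 0 := fun t ht => hH.eq_zero _ ((one_le_div hT0).2 ht)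
  have zT1 := deriv_eq_zero_of_le hd0 zT
  have zT2 := deriv_eq_zero_of_le hd1 zT1
  have zT3 := deriv_eq_zero_of_le hd2 zT2
  have z0 : η 0 = 1 := by simp only [hη]; rw [zero_div]; exact hH.eq_one _ (by norm_num)
  obtain ⟨y1, y2, y3⟩ := hH.deriv_eq_zero (t := 0) (by norm_num)
  have z1 : deriv η 0 = 0 := by rw [q1]; simp [y1]
  have z2 : deriv (deriv η) 0 = 0 := by rw [q2]; simp [y2]
  have z3 : deriv (deriv (deriv η)) 0 = 0 := by rw [q3]; simp [y3]
  have hE1 : deriv (fun t => η t - deriv η t / lam)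
      = fun t => deriv η t - deriv (deriv η) t / lam := by
    ext t; rw [deriv_fun_sub (hd0 t) ((hd1 t).div_const lam), deriv_div_const]
  have hE2 : deriv (fun t => deriv η t - deriv (deriv η) t / lam)
      = fun t => deriv (deriv η) t - deriv (deriv (deriv η)) t / lam := by
    ext t; rw [deriv_fun_sub (hd1 t) ((hd2 t).div_const lam), deriv_div_const]
  have hE3 : deriv (fun t => deriv (deriv η) t - deriv (deriv (deriv η)) t / lam)
      = fun t => deriv (deriv (deriv η)) t - deriv (deriv (deriv (deriv η))) t / lam := by
    ext t; rw [deriv_fun_sub (hd2 t) ((hd3 t).div_const lam), deriv_div_const]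
  have hid := hW.integral_testPair hR hT0.le hTm hP (E := fun t => η t - deriv η t / lam)
    (hηs.sub (h1.div_const lam)) (fun t ht => by simp [zT t ht, zT1 t ht]) (by simp [z0, z1])
    (by rw [hE1]; simp [z1, z2]) (by rw [hE1, hE2]; simp [z2, z3])
  rw [hE1, hE2, hE3] at hid
  have hw := (hW.energy.integrableOn (R := R) hTm).1
  have hwt := (hW.energy.integrableOn (R := R) hTm).2.1
  have hK := isCompact_coneBox (n := n) R T
  have key : ∀ {u : ℝ × Space n → ℝ} (_ : IntegrableOn u (coneBox n R T)) {g : ℝ × Space n → ℝ},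
      Continuous g → Integrable (fun z => u z * g z) (volume.restrict (coneBox n R T)) :=
    fun hu _ hg => hu.mul_continuousOn hg.continuousOn hK
  have hparts : ∀ {e : ℝ → ℝ} {F : Space n → ℝ}, ContDiff ℝ ∞ e → Continuous F → e 0 = 0 → e T = 0 →
      ∫ z in coneBox n R T, wt z * (Real.exp (-(lam * z.1)) * e z.1 * F z.2)
        = -∫ z in coneBox n R T,
          w z * (Real.exp (-(lam * z.1)) * (deriv e z.1 - lam * e z.1) * F z.2) := by
    intro e F he hF h0 hT'
    have := hW.time_by_parts hT0.le hTm hF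
      (contDiff_exp_mul (he.of_le (by simp)) lam) (by simp [hT'])
    rw [deriv_exp_mul (he.differentiable (by simp))] at this
    simpa [h0] using this
  have p1 := hparts (h2.sub ((contDiff_const (c := 2 * lam)).mul h1)) hφ (by simp [z1, z2])
    (by simp [zT1, zT2])
  have p2 := hparts (h3.sub ((contDiff_const (c := 2 * lam)).mul h2)) hχ (by simp [z3, z2])
    (by simp [zT3, zT2])
  have p3 := hparts (F := fun x => D x * χ x) h2 (hd.mul hχ) z2 (zT2 T le_rfl)
  have e1 : ∀ t, deriv (fun t => deriv (deriv η) t - 2 * lam * deriv η t) t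
      = deriv (deriv (deriv η)) t - 2 * lam * deriv (deriv η) t := fun t => by
    rw [deriv_fun_sub (hd2 t) ((hd1 t).const_mul _), deriv_const_mul _ (hd1 t)]
  have e2 : ∀ t, deriv (fun t => deriv (deriv (deriv η)) t - 2 * lam * deriv (deriv η) t) t
      = deriv (deriv (deriv (deriv η))) t - 2 * lam * deriv (deriv (deriv η)) t := fun t => by
    rw [deriv_fun_sub (hd3 t) ((hd2 t).const_mul _), deriv_const_mul _ (hd2 t)]
  simp only [e1] at p1
  simp only [e2] at p2
  have hrhs : ∫ z in coneBox n R T, w z * (Real.exp (-(lam * z.1)) *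
        ((deriv (deriv η) z.1 - deriv (deriv (deriv η)) z.1 / lam
            - 2 * lam * (deriv η z.1 - deriv (deriv η) z.1 / lam)) * φ z.2
          - (deriv (deriv (deriv η)) z.1 - deriv (deriv (deriv (deriv η))) z.1 / lam
            - 2 * lam * (deriv (deriv η) z.1 - deriv (deriv (deriv η)) z.1 / lam)) * χ z.2
          + D z.2 * (deriv (deriv η) z.1 - deriv (deriv (deriv η)) z.1 / lam) * χ z.2))
      = ∫ z in coneBox n R T, wt z * (lam⁻¹ * (Real.exp (-(lam * z.1)) *
        ((deriv (deriv η) z.1 - 2 * lam * deriv η z.1) * φ z.2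
          - (deriv (deriv (deriv η)) z.1 - 2 * lam * deriv (deriv η) z.1) * χ z.2
          + D z.2 * deriv (deriv η) z.1 * χ z.2))) := by
    have comb : ∀ {u : ℝ × Space n → ℝ} (_ : IntegrableOn u (coneBox n R T))
        {g₁ g₂ g₃ : ℝ × Space n → ℝ}, Continuous g₁ → Continuous g₂ → Continuous g₃ → ∀ a : ℝ,
        ∫ z in coneBox n R T, u z * (a * (g₁ z - g₂ z + g₃ z))
          = a * ((∫ z in coneBox n R T, u z * g₁ z) - (∫ z in coneBox n R T, u z * g₂ z)
            + ∫ z in coneBox n R T, u z * g₃ z) := by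
      intro u hu g₁ g₂ g₃ c₁ c₂ c₃ a
      have s1 : Integrable (fun z => u z * g₁ z - u z * g₂ z) (volume.restrict (coneBox n R T)) :=
        (key hu c₁).sub (key hu c₂)
      rw [← integral_sub (key hu c₁) (key hu c₂), ← integral_add s1 (key hu c₃),
        ← integral_const_mul]
      congr 1; ext z; ring
    have l1 := comb hw
      (g₁ := fun z => Real.exp (-(lam * z.1)) * (deriv (deriv (deriv η)) z.1
        - 2 * lam * deriv (deriv η) z.1 - lam * (deriv (deriv η) z.1 - 2 * lam * deriv η z.1)) * φ z.2)
      (g₂ := fun z => Real.exp (-(lam * z.1)) * (deriv (deriv (deriv (deriv η))) z.1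
        - 2 * lam * deriv (deriv (deriv η)) z.1
        - lam * (deriv (deriv (deriv η)) z.1 - 2 * lam * deriv (deriv η) z.1)) * χ z.2)
      (g₃ := fun z => Real.exp (-(lam * z.1)) * (deriv (deriv (deriv η)) z.1
        - lam * deriv (deriv η) z.1) * (D z.2 * χ z.2))
      (by fun_prop) (by fun_prop) (by fun_prop) (-lam⁻¹)
    have l2 := comb hwt
      (g₁ := fun z => Real.exp (-(lam * z.1)) * (deriv (deriv η) z.1 - 2 * lam * deriv η z.1) * φ z.2)
      (g₂ := fun z => Real.exp (-(lam * z.1)) *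
        (deriv (deriv (deriv η)) z.1 - 2 * lam * deriv (deriv η) z.1) * χ z.2)
      (g₃ := fun z => Real.exp (-(lam * z.1)) * deriv (deriv η) z.1 * (D z.2 * χ z.2))
      (by fun_prop) (by fun_prop) (by fun_prop) lam⁻¹
    rw [p1, p2, p3] at l2
    refine Eq.trans ?_ (l1.trans (Eq.trans ?_ (l2.symm.trans ?_)))
    · congr 1; ext z; field_simp; ring
    · ring
    · congr 1; ext z; ring
  rw [hrhs] at hid
  have hae : ∀ᵐ z ∂(volume.restrict (coneBox n R T)), z.1 + R < ‖z.2‖ → wt z = 0 :=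
    ae_restrict_of_ae_restrict_of_subset (coneBox_subset_slab hTm) hW.ae_slab.2
  have hr := integral_coneBox_le_lightCone (g := fun z => H (z.1 / T) ^ κ * envelope n lam z)
    (B := (3 * CH + 3 * CH * (C * (2 + R)) + CH * C) * C / T) hT0.le hwt hae
    (k := fun z => lam⁻¹ * (Real.exp (-(lam * z.1)) *
        ((deriv (deriv η) z.1 - 2 * lam * deriv η z.1) * φ z.2
          - (deriv (deriv (deriv η)) z.1 - 2 * lam * deriv (deriv η) z.1) * χ z.2
          + D z.2 * deriv (deriv η) z.1 * χ z.2))) (by fun_prop)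
    (((hHc.comp (continuous_fst.div_const T)).rpow_const fun _ => Or.inr hκ).mul
      (continuous_envelope hlam.le))
    (fun z hz => by
      obtain ⟨r1, r2, r3⟩ := hH.deriv_eq_zero (hzero _ hz)
      rw [q3, q2, q1]
      simp [r1, r2, r3])
    (fun z hz => by
      rw [q3, q2, q1, abs_mul, abs_of_pos (inv_pos.2 hlam)]
      refine (mul_le_mul_of_nonneg_left (abs_testKernel_le hP hH hC hCH hδ0 hδ hR hD hT hlam hlamT hz)
        (inv_pos.2 hlam).le).trans (le_of_eq ?_)
      field_simp)
  have hl := half_integral_lightCone_le (hW.integrableOn_source (R' := R) hT0.le hTm) hN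
    (g := fun z => Real.exp (-(lam * z.1)) * H (z.1 / T))
    (k := fun z => Real.exp (-(lam * z.1)) *
      ((η z.1 - deriv η z.1 / lam) * φ z.2 - (deriv η z.1 - deriv (deriv η) z.1 / lam) * χ z.2))
    (by fun_prop) (by fun_prop)
    (fun z _ => mul_nonneg (Real.exp_pos _).le (hH.nonneg _)) (fun z hz => by
      rw [mul_div_assoc]
      refine mul_le_mul_of_nonneg_left ?_ (Real.exp_pos _).le
      have a1 := hH.nonneg (z.1 / T)
      have a2 : deriv η z.1 ≤ 0 := by
        rw [q1]; exact div_nonpos_of_nonpos_of_nonneg hH.antitone.deriv_nonpos hT0.le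
      have a3 := hP.one_le z.2
      have a4 := hP.nonneg_χ z.2
      have a5 := hH.le_deriv₂ (z.1 / T) ⟨div_nonneg hz.1.1 hT0.le, (div_le_one hT0).2 hz.1.2⟩
      have a6 : χ z.2 ≤ C * (2 + R) * (T / T ^ δ) * φ z.2 := by
        refine (hP.χ_le_of_mem hC hδ hR hT hz).trans ?_
        rw [Real.mul_rpow (by linarith) hT0.le, Real.rpow_sub hT0, Real.rpow_one, ← mul_assoc]
        gcongr
        simpa using Real.rpow_le_rpow_of_exponent_le (by linarith : 1 ≤ 2 + R)
          (by linarith : 1 - δ ≤ 1)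
      have hTd : 0 < T ^ δ := Real.rpow_pos_of_pos hT0 δ
      have a7 : -(deriv (deriv η) z.1 / lam) * χ z.2 ≤ η z.1 * φ z.2 / 2 := by
        have b1 : -(deriv (deriv η) z.1 / lam) ≤ CH * η z.1 / T := by
          rw [q2]
          have : -(deriv (deriv H) (z.1 / T) / T / T / lam)
              = -deriv (deriv H) (z.1 / T) / T / (lam * T) := by field_simp
          rw [this, div_le_iff₀ (by positivity)]
          calc -deriv (deriv H) (z.1 / T) / T ≤ CH * η z.1 / T := by
                gcongr; simp only [hη]; linarith
            _ ≤ CH * η z.1 / T * (lam * T) := by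
                refine le_mul_of_one_le_right ?_ hlamT
                exact div_nonneg (mul_nonneg hCH a1) hT0.le
        have b2 : 0 ≤ CH * η z.1 / T := div_nonneg (mul_nonneg hCH a1) hT0.le
        calc -(deriv (deriv η) z.1 / lam) * χ z.2
            ≤ CH * η z.1 / T * (C * (2 + R) * (T / T ^ δ) * φ z.2) := by gcongr
          _ = (CH * (C * (2 + R)) / T ^ δ) * (η z.1 * φ z.2) := by field_simp
          _ ≤ (1 / 2) * (η z.1 * φ z.2) := by
              refine mul_le_mul_of_nonneg_right ?_ (mul_nonneg a1 (by linarith))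
              rw [div_le_iff₀ hTd]; linarith
          _ = _ := by ring
      have a8 : 0 ≤ -(deriv η z.1 / lam) * φ z.2 := mul_nonneg
        (neg_nonneg.2 (div_nonpos_of_nonpos_of_nonneg a2 hlam.le)) (by linarith)
      have a9 : 0 ≤ -deriv η z.1 * χ z.2 := mul_nonneg (by linarith) a4
      have a10 : η z.1 ≤ η z.1 * φ z.2 := le_mul_of_one_le_right a1 a3
      change η z.1 / 2 ≤ _
      linarith)
  have hdat := mul_le_mul_of_nonneg_left (lam_mul_integral_le hlam1 hP hlam.le hD hW.continuous₀
    hW.continuous₁ hW.supp₀ hW.supp₁ hf₀ hf₁) hε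
  linarith

/-- The test inequalities hold with constants that do not depend on the solution. -/
theorem exists_test_inequality (hn : 3 ≤ n) {a₁ a₂ β γ : ℝ} (ha₁ : 0 ≤ a₁) (ha₂ : 0 ≤ a₂)
    (hβ : 1 < β) (hγ : 2 < γ) (hD : IsCoefficient a₁ β D) (hV : IsCoefficient a₂ γ V) (hR : 0 ≤ R)
    {κ CH : ℝ} {H : ℝ → ℝ} (hH : IsProfile κ CH H) (hκ : 0 ≤ κ) (hCH : 0 ≤ CH)
    (hf₀ : ∀ x, 0 ≤ f₀ x) (hf₁ : ∀ x, 0 ≤ f₁ x) :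
    ∃ M T₀ : ℝ, 0 < M ∧ 1 ≤ T₀ ∧ ∀ {Tm : ℝ≥0∞} {ε : ℝ} {w wt : ℝ × Space n → ℝ}
      {dw : ℝ × Space n → Space n} {N : ℝ × Space n → ℝ}, 0 ≤ ε → (∀ z, 0 ≤ N z) →
      IsWaveComponent Tm ε R D V f₀ f₁ w wt dw N → ∀ T lam : ℝ, T₀ ≤ T → ENNReal.ofReal T < Tm →
      0 < lam → lam ≤ 1 → 1 ≤ lam * T →
      TestInequality n R H κ 1 M (ε * ((∫ x, f₀ x) + ∫ x, f₁ x)) lam T N w ∧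
      TestInequality n R H κ 0 M (ε * ((∫ x, f₀ x) + ∫ x, f₁ x)) lam T N wt := by
  obtain ⟨C, δ, hC, hδ0, hδ1, hpair⟩ := exists_testPair hn ha₁ ha₂ hβ hγ hD hV
  set B : ℝ := (3 * CH + 3 * CH * (C * (2 + R)) + CH * C) * C with hB
  have hB0 : 0 ≤ B := by positivity
  obtain ⟨T₁, hT₁⟩ := ((tendsto_rpow_atTop hδ0).eventually_ge_atTop
    (2 * (CH * (C * (2 + R))))).exists_forall_of_atTop
  -- The factor `2` undoes the halving of the source on the left, and `1` is added to make the
  -- constant positive.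
  refine ⟨2 * B + 1, max 1 T₁, by positivity, le_max_left _ _, ?_⟩
  intro Tm ε w wt dw N hε hN hW T lam hT hTm hlam hlam1 hlamT
  have hT1 : 1 ≤ T := (le_max_left _ _).trans hT
  have hT0 : 0 < T := by linarith
  obtain ⟨φ, χ, hP⟩ := hpair lam hlam hlam1
  have k1 := test_inequality_source hP hH hκ hC.le hCH hδ0.le hδ1.le hR hD.nonneg hT1 hTm hlam hlam1
    hlamT hε hf₀ hf₁ hN hW
  have k2 := test_inequality_deriv hP hH hκ hC.le hCH hδ0.le hδ1.le hR hD.nonneg hT1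
    (hT₁ T ((le_max_right _ _).trans hT)) hTm hlam hlam1 hlamT hε hf₀ hf₁ hN hW
  have hc : 0 ≤ lam * (ε * ((∫ x, f₀ x) + ∫ x, f₁ x)) :=
    mul_nonneg hlam.le (mul_nonneg hε (add_nonneg (integral_nonneg hf₀) (integral_nonneg hf₁)))
  have hpos : ∀ g : ℝ × Space n → ℝ,
      0 ≤ ∫ z in lightCone n R (T / 2) T, |g z| * (H (z.1 / T) ^ κ * envelope n lam z) := fun g =>
    integral_nonneg fun z => mul_nonneg (abs_nonneg _)
      (mul_nonneg (Real.rpow_nonneg (hH.nonneg _) _) (envelope_nonneg hlam.le z))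
  have hle : ∀ {a I x c b : ℝ}, a / 2 + c ≤ B * x / T * I → 0 ≤ c → 0 ≤ I → 0 ≤ x → b = x →
      a + c ≤ (2 * B + 1) * b / T * I := by
    intro a I x c b h hc hI hx hb
    have : 0 ≤ x / T * I := by positivity
    have e : (2 * B + 1) * x / T * I = 2 * (B * x / T * I) + x / T * I := by ring
    rw [hb, e]; linarith
  constructor
  · exact hle k1 hc (hpos w) hlam.le (Real.rpow_one lam)
  · exact hle (x := 1) (by rwa [mul_one]) hc (hpos wt) zero_le_one (Real.rpow_zero lam)

end TestEstimate

/-! ### Integrals on the outer half of the cone, dyadic sums and Hölder's inequality. -/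

section Cone

variable {n : ℕ} {R : ℝ}

/-- Integrals over a light cone of functions of the distance to its boundary. -/
theorem exists_integral_lightCone_le (hn : 0 < n) : ∃ K : ℝ, 0 < K ∧ ∀ (R a b : ℝ) (h : ℝ → ℝ),
    0 ≤ R → 0 ≤ a → a ≤ b → Continuous h → (∀ s, 0 ≤ h s) →
    ∫ z in lightCone n R a b, h (z.1 + R + 1 - ‖z.2‖)
      ≤ K * (b - a) * (b + R) ^ (n - 1) * ∫ s in (1 : ℝ)..(b + R + 1), h s := by
  have : Nonempty (Fin n) := ⟨⟨0, hn⟩⟩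
  set v : ℝ := n * (volume : Measure (Space n)).real (Metric.ball 0 1) with hv
  have hv0 : 0 ≤ v := by positivity
  refine ⟨v + 1, by positivity, fun R a b h hR ha hab hc h0 => ?_⟩
  set I := ∫ s in (1 : ℝ)..(b + R + 1), h s with hI
  have hI0 : 0 ≤ I := intervalIntegral.integral_nonneg (by linarith) fun s _ => h0 s
  set B := (b + R) ^ (n - 1) with hB
  have hB0 : 0 ≤ B := pow_nonneg (by linarith) _
  have hcont : Continuous fun z : ℝ × Space n => h (z.1 + R + 1 - ‖z.2‖) :=
    hc.comp (((continuous_fst.add continuous_const).add continuous_const).sub continuous_snd.norm)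
  have hint : IntegrableOn (fun z : ℝ × Space n => h (z.1 + R + 1 - ‖z.2‖)) (lightCone n R a b) :=
    hcont.continuousOn.integrableOn_compact (isCompact_lightCone ha)
  have hint' := hint.integrable_indicator (measurableSet_lightCone R a b)
  rw [← integral_indicator (measurableSet_lightCone R a b)]
  rw [Measure.volume_eq_prod] at hint' ⊢
  rw [integral_prod _ hint']
  have hinner : ∀ t, (∫ x : Space n, (lightCone n R a b).indicator
      (fun z : ℝ × Space n => h (z.1 + R + 1 - ‖z.2‖)) (t, x))
      ≤ (Icc a b).indicator (fun _ => v * (B * I)) t := by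
    intro t
    by_cases ht : t ∈ Icc a b
    · rw [indicator_of_mem ht]
      have e : (fun x : Space n => (lightCone n R a b).indicator
          (fun z : ℝ × Space n => h (z.1 + R + 1 - ‖z.2‖)) (t, x))
          = fun x => (Iic (t + R)).indicator (fun y => h (t + R + 1 - y)) ‖x‖ := by
        ext x
        by_cases hx : ‖x‖ ≤ t + R
        · rw [indicator_of_mem (show (t, x) ∈ lightCone n R a b from ⟨ht.1, ht.2, hx⟩),
            indicator_of_mem (show ‖x‖ ∈ Iic (t + R) from hx)]
        · rw [indicator_of_notMem (fun hm => hx hm.2.2),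
            indicator_of_notMem (show ‖x‖ ∉ Iic (t + R) from hx)]
      have hct : Continuous fun y => h (t + R + 1 - y) := hc.comp (continuous_const.sub continuous_id)
      -- Polar coordinates on the slice: the surface factor `y ^ (n - 1)` is at most `(b + R) ^ (n -
      -- 1)`, and `s = t + R + 1 - y` runs over `[1, t + R + 1]`.
      rw [e, integral_fun_norm_addHaar, finrank_euclideanSpace_fin, nsmul_eq_mul, smul_eq_mul,
        ← mul_assoc, ← hv]
      refine mul_le_mul_of_nonneg_left ?_ hv0
      have e2 : (fun y : ℝ => y ^ (n - 1) • (Iic (t + R)).indicator (fun y => h (t + R + 1 - y)) y)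
          = (Iic (t + R)).indicator (fun y => y ^ (n - 1) * h (t + R + 1 - y)) := by
        ext y
        by_cases hy : y ∈ Iic (t + R)
        · rw [indicator_of_mem hy, indicator_of_mem hy, smul_eq_mul]
        · rw [indicator_of_notMem hy, indicator_of_notMem hy, smul_zero]
      have htR : 0 ≤ t + R := by linarith [ht.1]
      rw [e2, setIntegral_indicator measurableSet_Iic, Ioi_inter_Iic,
        ← intervalIntegral.integral_of_le htR]
      calc ∫ y in (0 : ℝ)..(t + R), y ^ (n - 1) * h (t + R + 1 - y)
          ≤ ∫ y in (0 : ℝ)..(t + R), B * h (t + R + 1 - y) := by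
            refine intervalIntegral.integral_mono_on htR
              (Continuous.intervalIntegrable (by fun_prop) _ _)
              (Continuous.intervalIntegrable (by fun_prop) _ _) fun y hy => ?_
            exact mul_le_mul_of_nonneg_right
              (pow_le_pow_left₀ hy.1 (by linarith [hy.2, ht.2]) _) (h0 _)
        _ = B * ∫ s in (1 : ℝ)..(t + R + 1), h s := by
            rw [intervalIntegral.integral_const_mul,
              intervalIntegral.integral_comp_sub_left (fun s => h s)]
            congr 2 <;> ring
        _ ≤ B * I := by
            refine mul_le_mul_of_nonneg_left ?_ hB0
            refine intervalIntegral.integral_mono_interval le_rfl (by linarith)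
              (by linarith [ht.2]) (Eventually.of_forall h0) (hc.intervalIntegrable _ _)
    · rw [indicator_of_notMem ht]
      refine le_of_eq ?_
      rw [← integral_zero (Space n) ℝ (μ := volume)]
      congr 1
      ext x
      exact indicator_of_notMem (fun hm => ht ⟨hm.1, hm.2.1⟩) _
  calc _ ≤ ∫ t, (Icc a b).indicator (fun _ => v * (B * I)) t := by
        refine integral_mono hint'.integral_prod_left ?_ hinner
        exact (integrable_indicator_iff measurableSet_Icc).2 (integrableOn_const (by simp))
    _ = v * (b - a) * B * I := by
        rw [integral_indicator measurableSet_Icc, setIntegral_const, smul_eq_mul,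
          Real.volume_real_Icc_of_le hab]
        ring
    _ ≤ _ := by
        have : 0 ≤ (b - a) * B * I := mul_nonneg (mul_nonneg (by linarith) hB0) hI0
        nlinarith

theorem rpow_one_add_le {m x : ℝ} (hm : 1 ≤ m) (hx : 0 ≤ x) :
    (1 + x) ^ m ≤ (2 * m) ^ m * Real.exp (x / 2) := by
  have h1 : 1 + x ≤ 2 * m * Real.exp (x / (2 * m)) := by
    have h2 := Real.add_one_le_exp (x / (2 * m))
    have h3 : 2 * m * (x / (2 * m)) = x := by field_simp
    nlinarith
  refine (Real.rpow_le_rpow (by linarith) h1 (by linarith)).trans (le_of_eq ?_)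
  rw [Real.mul_rpow (by linarith) (Real.exp_pos _).le, ← Real.exp_mul]
  congr 2
  field_simp

/-- On the outer half of the light cone the envelope decays away from the boundary. -/
theorem exists_envelope_le (hn : 3 ≤ n) (R : ℝ) (hR : 0 ≤ R) : ∃ C : ℝ, 0 < C ∧
    ∀ (lam T : ℝ) (z : ℝ × Space n), 0 < lam → lam ≤ 1 → 0 < T → z ∈ lightCone n R (T / 2) T →
      envelope n lam z ≤ C * (lam * T) ^ (-(((n : ℝ) - 1) / 2))
        * Real.exp (-(lam * (z.1 + R + 1 - ‖z.2‖) / 2)) := by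
  set m : ℝ := ((n : ℝ) - 1) / 2 with hm
  have hn' : (3 : ℝ) ≤ n := by exact_mod_cast hn
  have hm1 : 1 ≤ m := by rw [hm]; linarith
  refine ⟨Real.exp (R + 1) * 2 ^ m * (2 * m) ^ m, by positivity, fun lam T z hlam hlam1 hT hz => ?_⟩
  set A := z.1 + R + 1 - ‖z.2‖ with hA
  have hA1 : 1 ≤ A := by linarith [hz.2.2]
  have hx := norm_nonneg z.2
  have hlA : 0 ≤ lam * A := by positivity
  -- Where `‖x‖` is small compared with `T`, the distance `A` to the boundary of the cone is of
  -- order `T`. The missing decay in `‖x‖` is therefore charged to a power of `1 + lam A`, which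
  -- half of the exponential absorbs.
  have h1 : lam * T / 2 ≤ (1 + lam * ‖z.2‖) * (1 + lam * A) := by
    have e : (1 + lam * ‖z.2‖) * (1 + lam * A)
        = 1 + lam * (z.1 + R + 1) + lam * ‖z.2‖ * (lam * A) := by rw [hA]; ring
    rw [e]
    have e1 : 0 ≤ lam * ‖z.2‖ * (lam * A) := by positivity
    have e2 : lam * (T / 2) ≤ lam * (z.1 + R + 1) :=
      mul_le_mul_of_nonneg_left (by linarith [hz.1]) hlam.le
    linarith
  have h2 : (1 + lam * ‖z.2‖) ^ (-m) ≤ 2 ^ m * (lam * T) ^ (-m) * (1 + lam * A) ^ m := by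
    have p1 : 0 < 1 + lam * ‖z.2‖ := by positivity
    have p2 : 0 < 1 + lam * A := by positivity
    have h3 := Real.rpow_le_rpow (by positivity) h1 (by linarith : 0 ≤ m)
    rw [Real.div_rpow (by positivity) (by norm_num), Real.mul_rpow p1.le p2.le] at h3
    rw [Real.rpow_neg p1.le, Real.rpow_neg (by positivity)]
    rw [div_le_iff₀ (by positivity)] at h3
    have q1 : 0 < (1 + lam * ‖z.2‖) ^ m := by positivity
    have q2 : 0 < (lam * T) ^ m := by positivity
    rw [inv_le_iff_one_le_mul₀ q1, ← div_eq_mul_inv, div_mul_eq_mul_div, div_mul_eq_mul_div,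
      one_le_div q2]
    linarith
  calc envelope n lam z
      = (1 + lam * ‖z.2‖) ^ (-m) * (Real.exp (lam * (R + 1)) * Real.exp (-(lam * A))) := by
        rw [envelope, ← Real.exp_add]; congr 2; rw [hA]; ring
    _ ≤ (2 ^ m * (lam * T) ^ (-m) * (1 + lam * A) ^ m)
        * (Real.exp (R + 1) * Real.exp (-(lam * A))) := by
        gcongr
        nlinarith
    _ ≤ (2 ^ m * (lam * T) ^ (-m) * ((2 * m) ^ m * Real.exp (lam * A / 2)))
        * (Real.exp (R + 1) * Real.exp (-(lam * A))) := by
        gcongr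
        exact rpow_one_add_le hm1 hlA
    _ = Real.exp (R + 1) * 2 ^ m * (2 * m) ^ m * (lam * T) ^ (-m)
        * (Real.exp (lam * A / 2) * Real.exp (-(lam * A))) := by ring
    _ = _ := by rw [← Real.exp_add]; congr 2; ring

/-- The sum telescopes, which makes the bound independent of the number of terms: for `g x = x ^ σ /
(1 + x ^ σ)`, with values in `[0, 1]`, the difference `g x - g (x / 2)` dominates `x ^ σ * exp (-x /
2)` up to a constant. -/
theorem exists_sum_dyadic_le {σ : ℝ} (hσ : 0 < σ) (hσ1 : σ ≤ 1) : ∃ C : ℝ, 0 < C ∧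
    ∀ (A : ℝ) (J : ℕ), 0 < A →
      ∑ j ∈ Finset.range (J + 1), ((1 / 2 : ℝ) ^ j) ^ σ * Real.exp (-((1 / 2) ^ j * A / 2))
        ≤ C * A ^ (-σ) := by
  set k : ℝ := 2 ^ σ with hk
  have hk1 : 1 < k := Real.one_lt_rpow (by norm_num) hσ
  have hk2 : k ≤ 2 := by
    simpa using Real.rpow_le_rpow_of_exponent_le (by norm_num : (1 : ℝ) ≤ 2) hσ1
  let g : ℝ → ℝ := fun x => x ^ σ / (1 + x ^ σ)
  have hstep : ∀ x : ℝ, 0 < x → x ^ σ * Real.exp (-(x / 2)) ≤ 64 / (k - 1) * (g x - g (x / 2)) := by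
    intro x hx
    have hy : 0 < x ^ σ := Real.rpow_pos_of_pos hx σ
    have hyx : x ^ σ ≤ 1 + x := by
      rcases le_total x 1 with h | h
      · linarith [Real.rpow_le_one hx.le h hσ.le]
      · have := Real.rpow_le_rpow_of_exponent_le h hσ1
        rw [Real.rpow_one] at this; linarith
    have e : g x - g (x / 2) = x ^ σ * (k - 1) / ((1 + x ^ σ) * (k + x ^ σ)) := by
      simp only [g]
      rw [Real.div_rpow hx.le (by norm_num), ← hk]
      field_simp
      ring
    have h1 : 2 + x ≤ 8 * Real.exp (x / 4) := by
      have := Real.add_one_le_exp (x / 4); linarith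
    have h2 : (1 + x ^ σ) * (k + x ^ σ) ≤ 64 * Real.exp (x / 2) := by
      calc (1 + x ^ σ) * (k + x ^ σ) ≤ (2 + x) * (3 + x) :=
            mul_le_mul (by linarith) (by linarith) (by linarith) (by linarith)
        _ ≤ (8 * Real.exp (x / 4)) * (8 * Real.exp (x / 4)) := by
            gcongr
            have := Real.add_one_le_exp (x / 4); linarith
        _ = 64 * (Real.exp (x / 4) * Real.exp (x / 4)) := by ring
        _ = _ := by rw [← Real.exp_add]; congr 2; ring
    have hk0 : 0 < k - 1 := by linarith
    rw [e, Real.exp_neg]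
    have h3 : (Real.exp (x / 2))⁻¹ ≤ 64 / ((1 + x ^ σ) * (k + x ^ σ)) := by
      rw [le_div_iff₀ (by positivity), inv_mul_le_iff₀ (Real.exp_pos _)]
      linarith
    calc x ^ σ * (Real.exp (x / 2))⁻¹ ≤ x ^ σ * (64 / ((1 + x ^ σ) * (k + x ^ σ))) := by gcongr
      _ = _ := by field_simp
  refine ⟨64 / (k - 1), div_pos (by norm_num) (by linarith), fun A J hA => ?_⟩
  rw [Real.rpow_neg hA.le, ← div_eq_mul_inv, le_div_iff₀ (Real.rpow_pos_of_pos hA σ), Finset.sum_mul]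
  have hterm : ∀ j ∈ Finset.range (J + 1),
      ((1 / 2 : ℝ) ^ j) ^ σ * Real.exp (-((1 / 2) ^ j * A / 2)) * A ^ σ
      ≤ 64 / (k - 1) * (g ((1 / 2) ^ j * A) - g ((1 / 2) ^ (j + 1) * A)) := by
    intro j _
    have := hstep ((1 / 2) ^ j * A) (by positivity)
    rw [Real.mul_rpow (by positivity) hA.le] at this
    have e : (1 / 2 : ℝ) ^ (j + 1) * A = (1 / 2) ^ j * A / 2 := by ring
    rw [e]
    linarith
  refine (Finset.sum_le_sum hterm).trans ?_
  rw [← Finset.mul_sum, Finset.sum_range_sub']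
  have hg0 : ∀ x, 0 < x → 0 ≤ g x ∧ g x ≤ 1 := fun x hx => by
    have hy : 0 < x ^ σ := Real.rpow_pos_of_pos hx σ
    exact ⟨by positivity, (div_le_one (by positivity)).2 (by linarith)⟩
  have h1 := (hg0 ((1 / 2) ^ 0 * A) (by positivity)).2
  have h2 := (hg0 ((1 / 2) ^ (J + 1) * A) (by positivity)).1
  have hk0 : 0 < 64 / (k - 1) := div_pos (by norm_num) (by linarith)
  nlinarith

/-- Hölder's inequality with `H ^ (1 / r)` attached to `G`, permitted by `0 ≤ H ≤ 1` and `1 / r ≤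
κ`. The `r`-th power then carries exactly one factor `H`, as the sources in the test inequalities
do. -/
theorem integral_mul_profile_le {κ CH r r' : ℝ} {H : ℝ → ℝ} (hH : IsProfile κ CH H)
    (hr : r.HolderConjugate r') (hκ : 1 / r ≤ κ) {a b T : ℝ} (ha : 0 ≤ a) {G Φ Θ : ℝ × Space n → ℝ}
    (hG : AEStronglyMeasurable G (volume.restrict (lightCone n R a b)))
    (hGr : IntegrableOn (fun z => |G z| ^ r) (lightCone n R a b))
    (hG1 : IntegrableOn G (lightCone n R a b))
    (hΦ : Continuous Φ) (hΘ : Continuous Θ) (hΦ0 : ∀ z, 0 ≤ Φ z) (hΘ0 : ∀ z, 0 ≤ Θ z)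
    (hΦΘ : ∀ z ∈ lightCone n R a b, Φ z ≤ Θ z) :
    ∫ z in lightCone n R a b, |G z| * (H (z.1 / T) ^ κ * Φ z)
      ≤ (∫ z in lightCone n R a b, |G z| ^ r * H (z.1 / T)) ^ (1 / r)
        * (∫ z in lightCone n R a b, Θ z ^ r') ^ (1 / r') := by
  have hr0 := hr.pos
  have hr'0 := hr.symm.pos
  have hK := isCompact_lightCone (n := n) (R := R) (b := b) ha
  have hHc : Continuous fun z : ℝ × Space n => H (z.1 / T) :=
    hH.smooth.continuous.comp (continuous_fst.div_const T)
  have hHκ : Continuous fun z : ℝ × Space n => H (z.1 / T) ^ κ :=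
    hHc.rpow_const fun _ => Or.inr ((one_div_nonneg.2 hr0.le).trans hκ)
  have hHr : Continuous fun z : ℝ × Space n => H (z.1 / T) ^ (1 / r) :=
    hHc.rpow_const fun _ => Or.inr (one_div_nonneg.2 hr0.le)
  have hfin : IsFiniteMeasure (volume.restrict (lightCone n R a b)) :=
    ⟨by rw [Measure.restrict_apply_univ]; exact hK.measure_lt_top⟩
  set f : ℝ × Space n → ℝ := fun z => |G z| * H (z.1 / T) ^ (1 / r) with hf
  have hfr : ∀ z, f z ^ r = |G z| ^ r * H (z.1 / T) := fun z => by
    simp only [hf]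
    rw [Real.mul_rpow (abs_nonneg _) (Real.rpow_nonneg (hH.nonneg _) _),
      ← Real.rpow_mul (hH.nonneg _), one_div_mul_cancel hr0.ne', Real.rpow_one]
  have hf0 : ∀ z, 0 ≤ f z := fun z => mul_nonneg (abs_nonneg _) (Real.rpow_nonneg (hH.nonneg _) _)
  have hfm : AEStronglyMeasurable f (volume.restrict (lightCone n R a b)) :=
    hG.norm.mul hHr.aestronglyMeasurable
  have hfL : MemLp f (ENNReal.ofReal r) (volume.restrict (lightCone n R a b)) := by
    rw [← integrable_norm_rpow_iff hfm (by simpa using hr0) ENNReal.ofReal_ne_top,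
      ENNReal.toReal_ofReal hr0.le]
    have e : (fun z => ‖f z‖ ^ r) = fun z => |G z| ^ r * H (z.1 / T) := by
      ext z; rw [Real.norm_of_nonneg (hf0 z), hfr]
    rw [e]
    exact IntegrableOn.mul_continuousOn hGr hHc.continuousOn hK
  obtain ⟨B, hB⟩ := hK.exists_bound_of_continuousOn hΘ.continuousOn
  have hΘL : MemLp Θ (ENNReal.ofReal r') (volume.restrict (lightCone n R a b)) :=
    MemLp.of_bound hΘ.aestronglyMeasurable B
      ((ae_restrict_iff' (measurableSet_lightCone R a b)).2 (Eventually.of_forall hB))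
  have h1 := integral_mul_le_Lp_mul_Lq_of_nonneg hr (Eventually.of_forall hf0)
    (Eventually.of_forall hΘ0) hfL hΘL
  simp only [hfr] at h1
  refine le_trans ?_ h1
  have hGn : IntegrableOn (fun z => |G z|) (lightCone n R a b) := hG1.norm
  refine setIntegral_mono_on (hGn.mul_continuousOn (hHκ.mul hΦ).continuousOn hK) ?_
    (measurableSet_lightCone R a b) fun z hz => ?_
  · have : IntegrableOn (fun z => |G z| * (H (z.1 / T) ^ (1 / r) * Θ z)) (lightCone n R a b) :=
      hGn.mul_continuousOn (hHr.mul hΘ).continuousOn hK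
    simpa only [hf, mul_assoc] using this
  · simp only [hf]
    rw [mul_assoc]
    refine mul_le_mul_of_nonneg_left (mul_le_mul ?_ (hΦΘ z hz) (hΦ0 z)
      (Real.rpow_nonneg (hH.nonneg _) _)) (abs_nonneg _)
    exact Real.rpow_le_rpow_of_exponent_ge' (hH.nonneg _) (hH.le_one _) (one_div_nonneg.2 hr0.le) hκ

end Cone

/-! ### Consequences at low, high and superposed frequencies. -/

section Consequences

variable {n : ℕ} {R : ℝ}

/-- The `L^r` size of `G` on the outer half of the light cone, weighted by the cutoff. -/
noncomputable def shellNorm (n : ℕ) (R : ℝ) (H : ℝ → ℝ) (r T : ℝ) (G : ℝ × Space n → ℝ) : ℝ :=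
  (∫ z in lightCone n R (T / 2) T, |G z| ^ r * H (z.1 / T)) ^ (1 / r)

/-- The integrability of a pair of functions on the light cone up to time `T` under which the test
inequalities are exploited. -/
structure IsConePair (n : ℕ) (R r T : ℝ) (X G : ℝ × Space n → ℝ) : Prop where
  nonneg : ∀ z, 0 ≤ X z
  integrable_left : IntegrableOn X (lightCone n R 0 T)
  integrable_right : IntegrableOn G (lightCone n R 0 T)
  integrable_rpow : IntegrableOn (fun z => |G z| ^ r) (lightCone n R 0 T)

theorem lightCone_subset {a a' b b' : ℝ} (ha : a' ≤ a) (hb : b ≤ b') :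
    lightCone n R a b ⊆ lightCone n R a' b' :=
  fun _ hz => ⟨ha.trans hz.1, hz.2.1.trans hb, hz.2.2⟩

/-- For weights dominated by a function `θ` of the distance to the boundary of the cone, Hölder's
dual factor splits: time and the tangential directions give `T ^ n`, and the direction transversal
to the boundary gives the one-dimensional integral `L`. -/
theorem exists_integral_mul_le (hn : 0 < n) (hR : 0 ≤ R) {κ CH r r' : ℝ} {H : ℝ → ℝ}
    (hH : IsProfile κ CH H) (hr : r.HolderConjugate r') (hκ : 1 / r ≤ κ) :
    ∃ C : ℝ, 0 < C ∧ ∀ {T a L : ℝ} {X G Φ : ℝ × Space n → ℝ} {θ : ℝ → ℝ}, 1 ≤ T →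
      IsConePair n R r T X G → Continuous Φ → (∀ z, 0 ≤ Φ z) → 0 ≤ a → Continuous θ →
      (∀ s, 0 ≤ θ s) → ∫ s in (1 : ℝ)..(T + R + 1), θ s ^ r' ≤ L →
      (∀ z ∈ lightCone n R (T / 2) T, Φ z ≤ a * θ (z.1 + R + 1 - ‖z.2‖)) →
      ∫ z in lightCone n R (T / 2) T, |G z| * (H (z.1 / T) ^ κ * Φ z)
        ≤ C * a * (T ^ (n : ℝ) * L) ^ (1 / r') * shellNorm n R H r T G := by
  obtain ⟨K, hK, hcone⟩ := exists_integral_lightCone_le (n := n) hn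
  have hr'0 := hr.symm.pos
  refine ⟨(K * (1 + R) ^ (n - 1)) ^ (1 / r'), by positivity, ?_⟩
  intro T a L X G Φ θ hT hXG hΦ hΦ0 ha hθ hθ0 hL hle
  have hT0 : 0 < T := by linarith
  have hsub : lightCone n R (T / 2) T ⊆ lightCone n R 0 T := lightCone_subset (by linarith) le_rfl
  have hcA : Continuous fun z : ℝ × Space n => z.1 + R + 1 - ‖z.2‖ :=
    ((continuous_fst.add continuous_const).add continuous_const).sub continuous_snd.norm
  have h1 := integral_mul_profile_le (T := T) hH hr hκ (by linarith : 0 ≤ T / 2)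
    (hXG.integrable_right.mono_set hsub).aestronglyMeasurable (hXG.integrable_rpow.mono_set hsub)
    (hXG.integrable_right.mono_set hsub) hΦ
    (Θ := fun z => a * θ (z.1 + R + 1 - ‖z.2‖)) (continuous_const.mul (hθ.comp hcA)) hΦ0
    (fun z => mul_nonneg ha (hθ0 _)) hle
  refine h1.trans ?_
  rw [mul_comm]
  refine mul_le_mul_of_nonneg_right ?_ (Real.rpow_nonneg (integral_nonneg fun z =>
    mul_nonneg (Real.rpow_nonneg (abs_nonneg _) _) (hH.nonneg _)) _)
  have h2 := hcone R (T / 2) T (fun s => θ s ^ r') hR (by linarith) (by linarith)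
    (hθ.rpow_const fun _ => Or.inr hr'0.le) (fun s => Real.rpow_nonneg (hθ0 s) _)
  have hL0 : 0 ≤ L := le_trans (intervalIntegral.integral_nonneg (by linarith)
    fun s _ => Real.rpow_nonneg (hθ0 s) _) hL
  have h3 : ∫ z in lightCone n R (T / 2) T, (a * θ (z.1 + R + 1 - ‖z.2‖)) ^ r'
      ≤ a ^ r' * ((K * (1 + R) ^ (n - 1)) * (T ^ (n : ℝ) * L)) := by
    have e : ∀ z : ℝ × Space n, (a * θ (z.1 + R + 1 - ‖z.2‖)) ^ r'
        = a ^ r' * θ (z.1 + R + 1 - ‖z.2‖) ^ r' := fun z => Real.mul_rpow ha (hθ0 _)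
    simp only [e]
    rw [integral_const_mul]
    refine mul_le_mul_of_nonneg_left (h2.trans ?_) (Real.rpow_nonneg ha _)
    have e1 : T ^ (n : ℝ) = T * T ^ (n - 1) := by
      rw [Real.rpow_natCast, ← pow_succ', Nat.sub_add_cancel hn]
    have e2 : T - T / 2 ≤ T := by linarith
    have e3 : (T + R) ^ (n - 1) ≤ (1 + R) ^ (n - 1) * T ^ (n - 1) := by
      rw [← mul_pow]
      exact pow_le_pow_left₀ (by linarith) (by nlinarith) _
    calc K * (T - T / 2) * (T + R) ^ (n - 1) * ∫ s in (1 : ℝ)..(T + R + 1), θ s ^ r'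
        ≤ K * T * ((1 + R) ^ (n - 1) * T ^ (n - 1)) * L := by
          have : 0 ≤ T - T / 2 := by linarith
          have : 0 ≤ (T + R) ^ (n - 1) := by positivity
          have : 0 ≤ ∫ s in (1 : ℝ)..(T + R + 1), θ s ^ r' :=
            intervalIntegral.integral_nonneg (by linarith) fun s _ => Real.rpow_nonneg (hθ0 s) _
          gcongr
      _ = _ := by rw [e1]; ring
  calc _ ≤ (a ^ r' * ((K * (1 + R) ^ (n - 1)) * (T ^ (n : ℝ) * L))) ^ (1 / r') := by
        refine Real.rpow_le_rpow (integral_nonneg fun z =>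
          Real.rpow_nonneg (mul_nonneg ha (hθ0 _)) _) h3 (one_div_nonneg.2 hr'0.le)
    _ = _ := by
        rw [Real.mul_rpow (by positivity) (by positivity), ← Real.rpow_mul ha,
          mul_one_div_cancel hr'0.ne', Real.rpow_one,
          Real.mul_rpow (by positivity) (by positivity)]
        ring

theorem shellNorm_nonneg {κ CH : ℝ} {H : ℝ → ℝ} (hH : IsProfile κ CH H) (r T : ℝ)
    (G : ℝ × Space n → ℝ) : 0 ≤ shellNorm n R H r T G :=
  Real.rpow_nonneg (integral_nonneg fun _ =>
    mul_nonneg (Real.rpow_nonneg (abs_nonneg _) _) (hH.nonneg _)) _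

/-- At `lam = 1 / T` the weight `exp (-lam t)` stays above `exp (-1)` and the envelope is bounded on
the cone, so the test function acts as a plain cutoff and the full volume `T ^ (n + 1)` enters. The
data term is dropped. -/
theorem exists_low_frequency_estimate (hn : 3 ≤ n) (hR : 0 ≤ R) {κ CH r r' τ M : ℝ} {H : ℝ → ℝ}
    (hH : IsProfile κ CH H) (hr : r.HolderConjugate r') (hκ : 1 / r ≤ κ) (hM : 0 < M) :
    ∃ C : ℝ, 0 < C ∧ ∀ {T c : ℝ} {X G : ℝ × Space n → ℝ}, 1 ≤ T → 0 ≤ c →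
      IsConePair n R r T X G → TestInequality n R H κ τ M c (1 / T) T X G →
      ∫ z in lightCone n R 0 T, X z * H (z.1 / T)
        ≤ C * T ^ (-1 - τ + ((n : ℝ) + 1) / r') * shellNorm n R H r T G := by
  obtain ⟨K, hK, hmul⟩ := exists_integral_mul_le (n := n) (by omega) hR hH hr hκ
  have hr'0 := hr.symm.pos
  refine ⟨Real.exp 1 * M * (K * Real.exp R * (1 + R) ^ (1 / r')), by positivity, ?_⟩
  intro T c X G hT hc hXG htest
  have hT0 : 0 < T := by linarith
  have hl0 : 0 ≤ 1 / T := by positivity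
  have h1 := hmul (θ := fun _ => 1) (L := (1 + R) * T) (a := Real.exp R) hT hXG
    (continuous_envelope hl0) (envelope_nonneg hl0)
    (Real.exp_pos R).le continuous_const (fun _ => zero_le_one)
    (by simp; nlinarith) (fun z hz => by
      rw [mul_one, envelope]
      have hm : (0 : ℝ) ≤ ((n : ℝ) - 1) / 2 := by
        have : (3 : ℝ) ≤ n := by exact_mod_cast hn
        linarith
      have e1 : (1 + 1 / T * ‖z.2‖) ^ (-(((n : ℝ) - 1) / 2)) ≤ 1 :=
        Real.rpow_le_one_of_one_le_of_nonpos
          (by have := norm_nonneg z.2; have : 0 ≤ 1 / T * ‖z.2‖ := by positivity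
              linarith) (by linarith)
      have e2 : Real.exp (1 / T * (‖z.2‖ - z.1)) ≤ Real.exp R := by
        rw [Real.exp_le_exp]
        have h1T : 1 / T ≤ 1 := (div_le_one hT0).2 hT
        calc 1 / T * (‖z.2‖ - z.1) ≤ 1 / T * R :=
              mul_le_mul_of_nonneg_left (by linarith [hz.2.2]) hl0
          _ ≤ R := mul_le_of_le_one_left hR h1T
      calc _ ≤ 1 * Real.exp R := mul_le_mul e1 e2 (Real.exp_pos _).le zero_le_one
        _ = _ := one_mul _)
  have hcX : IntegrableOn (fun z => X z * (Real.exp (-(1 / T * z.1)) * H (z.1 / T)))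
      (lightCone n R 0 T) :=
    hXG.integrable_left.mul_continuousOn (Continuous.continuousOn (by
      have := hH.smooth.continuous
      fun_prop)) (isCompact_lightCone le_rfl)
  have hcX' : IntegrableOn (fun z => X z * H (z.1 / T)) (lightCone n R 0 T) :=
    hXG.integrable_left.mul_continuousOn (Continuous.continuousOn (by
      have := hH.smooth.continuous
      fun_prop)) (isCompact_lightCone le_rfl)
  have h2 : Real.exp (-1) * (∫ z in lightCone n R 0 T, X z * H (z.1 / T))
      ≤ ∫ z in lightCone n R 0 T, X z * (Real.exp (-(1 / T * z.1)) * H (z.1 / T)) := by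
    rw [← integral_const_mul]
    refine setIntegral_mono_on (hcX'.const_mul _) hcX (measurableSet_lightCone _ _ _) fun z hz => ?_
    have e1 : Real.exp (-1) ≤ Real.exp (-(1 / T * z.1)) := by
      rw [Real.exp_le_exp]
      have : 1 / T * z.1 ≤ 1 := by
        rw [one_div_mul_eq_div]; exact (div_le_one hT0).2 hz.2.1
      linarith
    have e2 : 0 ≤ X z * H (z.1 / T) := mul_nonneg (hXG.nonneg z) (hH.nonneg _)
    calc _ ≤ Real.exp (-(1 / T * z.1)) * (X z * H (z.1 / T)) := mul_le_mul_of_nonneg_right e1 e2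
      _ = _ := by ring
  unfold TestInequality at htest
  have h3 : 0 ≤ 1 / T * c := by positivity
  have h4 : Real.exp (-1) * (∫ z in lightCone n R 0 T, X z * H (z.1 / T))
      ≤ M * (1 / T) ^ τ / T * (K * Real.exp R * (T ^ (n : ℝ) * ((1 + R) * T)) ^ (1 / r')
        * shellNorm n R H r T G) :=
    le_trans (by linarith) (mul_le_mul_of_nonneg_left h1 (by positivity))
  have e1 : (T ^ (n : ℝ) * ((1 + R) * T)) ^ (1 / r')
      = (1 + R) ^ (1 / r') * T ^ (((n : ℝ) + 1) / r') := by
    have : T ^ (n : ℝ) * ((1 + R) * T) = (1 + R) * T ^ ((n : ℝ) + 1) := by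
      rw [Real.rpow_add hT0, Real.rpow_one]; ring
    rw [this, Real.mul_rpow (by positivity) (by positivity), ← Real.rpow_mul hT0.le]
    congr 2; ring
  have e2 : (1 / T) ^ τ / T = T ^ (-1 - τ) := by
    rw [one_div, Real.inv_rpow hT0.le, ← Real.rpow_neg hT0.le, Real.rpow_sub hT0, Real.rpow_neg hT0.le,
      Real.rpow_neg_one]
    field_simp
  have e3 : T ^ (-1 - τ + ((n : ℝ) + 1) / r') = T ^ (-1 - τ) * T ^ (((n : ℝ) + 1) / r') :=
    Real.rpow_add hT0 _ _
  rw [Real.exp_neg, inv_mul_le_iff₀ (Real.exp_pos _)] at h4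
  refine h4.trans (le_of_eq ?_)
  rw [e1, e3, ← e2]
  ring

/-- At `lam = 1` the envelope has size `T ^ (-(n - 1) / 2)` and decays exponentially away from the
boundary of the cone, so only a volume `T ^ n` enters. Here the source is dropped and the data are
kept. -/
theorem exists_high_frequency_estimate (hn : 3 ≤ n) (hR : 0 ≤ R) {κ CH r r' τ M : ℝ} {H : ℝ → ℝ}
    (hH : IsProfile κ CH H) (hr : r.HolderConjugate r') (hκ : 1 / r ≤ κ) (hM : 0 < M) :
    ∃ C : ℝ, 0 < C ∧ ∀ {T c : ℝ} {X G : ℝ × Space n → ℝ}, 1 ≤ T →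
      IsConePair n R r T X G → TestInequality n R H κ τ M c 1 T X G →
      c ≤ C * T ^ (-1 - ((n : ℝ) - 1) / 2 + (n : ℝ) / r') * shellNorm n R H r T G := by
  obtain ⟨K, hK, hmul⟩ := exists_integral_mul_le (n := n) (by omega) hR hH hr hκ
  obtain ⟨B, hB, henv⟩ := exists_envelope_le (n := n) hn R hR
  have hr'0 := hr.symm.pos
  have hr'1 := hr.symm.lt
  set m : ℝ := ((n : ℝ) - 1) / 2 with hm
  refine ⟨M * K * B * 2 ^ (1 / r'), by positivity, ?_⟩
  intro T c X G hT hXG htest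
  have hT0 : 0 < T := by linarith
  have hL : ∫ s in (1 : ℝ)..(T + R + 1), Real.exp (-(s / 2)) ^ r' ≤ 2 := by
    have hle : ∫ s in (1 : ℝ)..(T + R + 1), Real.exp (-(s / 2)) ^ r'
        ≤ ∫ s in (1 : ℝ)..(T + R + 1), Real.exp (-(s / 2)) := by
      refine intervalIntegral.integral_mono_on (by linarith)
        (Continuous.intervalIntegrable ?_ _ _) (Continuous.intervalIntegrable (by fun_prop) _ _)
        fun s hs => ?_
      · exact Continuous.rpow_const (by fun_prop) fun _ => Or.inr hr'0.le
      · rw [← Real.exp_mul, Real.exp_le_exp]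
        nlinarith [hs.1]
    have heq : ∫ s in (1 : ℝ)..(T + R + 1), Real.exp (-(s / 2))
        = (-2 * Real.exp (-((T + R + 1) / 2))) - (-2 * Real.exp (-(1 / 2))) := by
      refine intervalIntegral.integral_eq_sub_of_hasDerivAt (f := fun s => -2 * Real.exp (-(s / 2)))
        (fun s _ => ?_) (Continuous.intervalIntegrable (by fun_prop) _ _)
      have h : HasDerivAt (fun s : ℝ => -(s / 2)) (-(1 / 2)) s :=
        ((hasDerivAt_id s).div_const 2).fun_neg
      exact (h.exp.const_mul (-2)).congr_deriv (by ring)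
    have h1 : Real.exp (-(1 / 2)) ≤ 1 := Real.exp_le_one_iff.2 (by norm_num)
    have h2 := Real.exp_pos (-((T + R + 1) / 2))
    linarith
  have h1 := hmul (θ := fun s => Real.exp (-(s / 2))) (L := 2) (a := B * T ^ (-m)) hT hXG
    (continuous_envelope zero_le_one) (envelope_nonneg zero_le_one)
    (by positivity) (by fun_prop) (fun s => (Real.exp_pos _).le) hL (fun z hz => by
      have := henv 1 T z one_pos le_rfl hT0 hz
      simpa using this)
  unfold TestInequality at htest
  have h2 : 0 ≤ ∫ z in lightCone n R 0 T, X z * (Real.exp (-(1 * z.1)) * H (z.1 / T)) :=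
    integral_nonneg fun z =>
      mul_nonneg (hXG.nonneg z) (mul_nonneg (Real.exp_pos _).le (hH.nonneg _))
  rw [Real.one_rpow, mul_one, one_mul] at htest
  have h3 : c ≤ M / T * (K * (B * T ^ (-m)) * (T ^ (n : ℝ) * 2) ^ (1 / r')
      * shellNorm n R H r T G) :=
    le_trans (by linarith) (mul_le_mul_of_nonneg_left h1 (by positivity))
  refine h3.trans (le_of_eq ?_)
  have e1 : (T ^ (n : ℝ) * 2) ^ (1 / r') = 2 ^ (1 / r') * T ^ ((n : ℝ) / r') := by
    rw [Real.mul_rpow (by positivity) (by norm_num), ← Real.rpow_mul hT0.le, mul_one_div]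
    ring
  have e2 : T ^ (-1 - m + (n : ℝ) / r') = T⁻¹ * T ^ (-m) * T ^ ((n : ℝ) / r') := by
    rw [Real.rpow_add hT0, sub_eq_add_neg, Real.rpow_add hT0, Real.rpow_neg_one]
  rw [e1, e2]
  ring

theorem exists_dyadic_scale {t : ℝ} {J : ℕ} (hJ : 1 ≤ J) (ht : 0 ≤ t) (htJ : t ≤ 2 ^ J) :
    ∃ j ≤ J, (2 : ℝ) ^ j ≤ 1 + t ∧ (1 / 2) ^ j * t ≤ 2 := by
  obtain ⟨j, h1, h2⟩ := exists_nat_pow_near (by linarith : 1 ≤ 1 + t) (by norm_num : (1 : ℝ) < 2)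
  refine ⟨j, ?_, h1, ?_⟩
  · by_contra hj
    have h3 : (2 : ℝ) ^ (J + 1) ≤ 2 ^ j := pow_le_pow_right₀ (by norm_num) (by omega)
    have h4 : (2 : ℝ) ^ 1 ≤ 2 ^ J := pow_le_pow_right₀ (by norm_num) hJ
    rw [pow_succ] at h3
    linarith
  · rw [one_div, inv_pow, inv_mul_le_iff₀ (by positivity)]
    rw [pow_succ] at h2
    linarith

/-- Frequencies `lam = 2 ^ (-j)` are superposed with weights `lam ^ s`. On the left the single scale
`lam ≈ 1 / (1 + t)` already gives `(1 + t) ^ (-s)`. On the right, `s` is chosen so that the powers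
of `lam` combine to `lam ^ (1 / r')`; the sum of `lam ^ (1 / r') * exp (-lam A / 2)` is of order `A
^ (-1 / r')`, whose `r'`-th power has a logarithmic integral. This is the origin of `J ^ (1 / r')`.
-/
theorem exists_dyadic_estimate (hn : 3 ≤ n) (hR : 0 ≤ R) {κ CH r r' τ M : ℝ} {H : ℝ → ℝ}
    (hH : IsProfile κ CH H) (hr : r.HolderConjugate r') (hκ : 1 / r ≤ κ) (hM : 0 < M) {s : ℝ}
    (hs : s = ((n : ℝ) - 1) / 2 + 1 / r' - τ) (hs0 : 0 ≤ s) :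
    ∃ C : ℝ, 0 < C ∧ ∀ {J : ℕ} {c : ℝ} {X G : ℝ × Space n → ℝ}, 1 ≤ J → 0 ≤ c →
      IsConePair n R r (2 ^ J) X G →
      (∀ j ≤ J, TestInequality n R H κ τ M c ((1 / 2) ^ j) (2 ^ J) X G) →
      ∫ z in lightCone n R 0 (2 ^ J), X z * (H (z.1 / 2 ^ J) * (1 + z.1) ^ (-s))
        ≤ C * (2 ^ J) ^ (-1 - ((n : ℝ) - 1) / 2 + (n : ℝ) / r') * (J : ℝ) ^ (1 / r')
          * shellNorm n R H r (2 ^ J) G := by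
  obtain ⟨K, hK, hmul⟩ := exists_integral_mul_le (n := n) (by omega) hR hH hr hκ
  obtain ⟨B, hB, henv⟩ := exists_envelope_le (n := n) hn R hR
  have hr'0 := hr.symm.pos
  have hr'1 := hr.symm.lt
  obtain ⟨S₀, hS₀, hSum⟩ := exists_sum_dyadic_le (one_div_pos.2 hr'0)
    ((div_le_one hr'0).2 hr'1.le)
  set m : ℝ := ((n : ℝ) - 1) / 2 with hm
  set ℓ : ℝ := Real.log 2 + Real.log (2 + R) with hℓ
  have hℓ0 : 0 ≤ ℓ := add_nonneg (Real.log_nonneg (by norm_num)) (Real.log_nonneg (by linarith))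
  refine ⟨Real.exp 2 * M * K * (B * S₀) * ℓ ^ (1 / r') + 1, by positivity, ?_⟩
  intro J c X G hJ hc hXG htest
  set T : ℝ := 2 ^ J with hTdef
  have hT : 1 ≤ T := one_le_pow₀ (by norm_num)
  have hT0 : 0 < T := by linarith
  have hJ1 : (1 : ℝ) ≤ J := by exact_mod_cast hJ
  have hl0 : ∀ j : ℕ, (0 : ℝ) < (1 / 2) ^ j := fun j => by positivity
  have hl1 : ∀ j : ℕ, ((1 : ℝ) / 2) ^ j ≤ 1 := fun j => pow_le_one₀ (by norm_num) (by norm_num)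
  have hHc := hH.smooth.continuous
  have hK0 := isCompact_lightCone (n := n) (R := R) (b := T) le_rfl
  have hL : ∫ x in (1 : ℝ)..(T + R + 1), (max 1 x)⁻¹ ≤ J * ℓ := by
    have e : ∫ x in (1 : ℝ)..(T + R + 1), (max 1 x)⁻¹ = Real.log (T + R + 1) := by
      rw [intervalIntegral.integral_congr (g := fun x => x⁻¹)]
      · rw [integral_inv_of_pos one_pos (by linarith), div_one]
      · intro x hx
        rw [uIcc_of_le (by linarith)] at hx
        simp only
        rw [max_eq_right hx.1]
    rw [e]
    have h1 : Real.log (T + R + 1) ≤ Real.log (T * (2 + R)) :=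
      Real.log_le_log (by linarith) (by nlinarith)
    rw [Real.log_mul hT0.ne' (by linarith), hTdef, Real.log_pow] at h1
    have h2 : Real.log (2 + R) ≤ J * Real.log (2 + R) :=
      le_mul_of_one_le_left (Real.log_nonneg (by linarith)) hJ1
    rw [hℓ]; linarith
  set Φ : ℝ × Space n → ℝ := fun z => ∑ j ∈ Finset.range (J + 1),
    ((1 / 2 : ℝ) ^ j) ^ (s + τ) * envelope n ((1 / 2) ^ j) z with hΦ
  have hΦc : Continuous Φ := continuous_finsetSum _ fun j _ =>
    continuous_const.mul (continuous_envelope (hl0 j).le)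
  have hΦ0 : ∀ z, 0 ≤ Φ z := fun z => Finset.sum_nonneg fun j _ =>
    mul_nonneg (Real.rpow_nonneg (hl0 j).le _) (envelope_nonneg (hl0 j).le z)
  have hΦle : ∀ z ∈ lightCone n R (T / 2) T,
      Φ z ≤ B * S₀ * T ^ (-m) * (max 1 (z.1 + R + 1 - ‖z.2‖)) ^ (-(1 / r')) := by
    intro z hz
    have hA : 1 ≤ z.1 + R + 1 - ‖z.2‖ := by linarith [hz.2.2]
    rw [max_eq_right hA]
    calc Φ z ≤ ∑ j ∈ Finset.range (J + 1), B * T ^ (-m) * (((1 / 2 : ℝ) ^ j) ^ (1 / r')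
          * Real.exp (-((1 / 2) ^ j * (z.1 + R + 1 - ‖z.2‖) / 2))) := by
          refine Finset.sum_le_sum fun j _ => ?_
          have h1 := henv _ T z (hl0 j) (hl1 j) hT0 hz
          have e : ((1 / 2 : ℝ) ^ j) ^ (1 / r')
              = ((1 / 2 : ℝ) ^ j) ^ (s + τ) * ((1 / 2 : ℝ) ^ j) ^ (-m) := by
            rw [← Real.rpow_add (hl0 j)]; congr 1; rw [hs]; ring
          rw [Real.mul_rpow (hl0 j).le hT0.le] at h1
          calc _ ≤ _ := mul_le_mul_of_nonneg_left h1 (Real.rpow_nonneg (hl0 j).le (s + τ))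
            _ = _ := by rw [e]; ring
      _ = B * T ^ (-m) * ∑ j ∈ Finset.range (J + 1), ((1 / 2 : ℝ) ^ j) ^ (1 / r')
          * Real.exp (-((1 / 2) ^ j * (z.1 + R + 1 - ‖z.2‖) / 2)) := by rw [Finset.mul_sum]
      _ ≤ B * T ^ (-m) * (S₀ * (z.1 + R + 1 - ‖z.2‖) ^ (-(1 / r'))) :=
          mul_le_mul_of_nonneg_left (hSum _ J (by linarith)) (by positivity)
      _ = _ := by ring
  have h1 := hmul (θ := fun x => (max 1 x) ^ (-(1 / r'))) (L := J * ℓ) (a := B * S₀ * T ^ (-m)) hT hXG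
    hΦc hΦ0 (by positivity)
    (Continuous.rpow_const (by fun_prop) fun x =>
      Or.inl (zero_lt_one.trans_le (le_max_left 1 x)).ne')
    (fun x => Real.rpow_nonneg (zero_le_one.trans (le_max_left 1 x)) _) (by
      have e : ∀ x : ℝ, ((max 1 x) ^ (-(1 / r'))) ^ r' = (max 1 x)⁻¹ := fun x => by
        rw [← Real.rpow_mul (zero_le_one.trans (le_max_left 1 x)), neg_mul,
          one_div_mul_cancel hr'0.ne', Real.rpow_neg_one]
      simpa only [e] using hL) hΦle
  have hS := shellNorm_nonneg (n := n) (R := R) hH r T G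
  set N := shellNorm n R H r T G with hN
  have key : ∀ j : ℕ, IntegrableOn (fun z => X z * (Real.exp (-((1 / 2) ^ j * z.1)) * H (z.1 / T)))
      (lightCone n R 0 T) := fun j =>
    hXG.integrable_left.mul_continuousOn (Continuous.continuousOn (by fun_prop)) hK0
  have hleft : ∫ z in lightCone n R 0 T, X z * (H (z.1 / T) * (1 + z.1) ^ (-s))
      ≤ Real.exp 2 * ∑ j ∈ Finset.range (J + 1), ((1 / 2 : ℝ) ^ j) ^ s *
        ∫ z in lightCone n R 0 T, X z * (Real.exp (-((1 / 2) ^ j * z.1)) * H (z.1 / T)) := by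
    simp only [← integral_const_mul]
    rw [← integral_finsetSum _ fun j _ => (key j).const_mul _, ← integral_const_mul]
    refine setIntegral_mono_on (hXG.integrable_left.mul_continuousOn (ContinuousOn.mul
      (Continuous.continuousOn (by fun_prop)) (ContinuousOn.rpow_const
        (Continuous.continuousOn (by fun_prop)) fun z hz => Or.inl (by linarith [hz.1]))) hK0)
      ((integrable_finsetSum _ fun j _ => (key j).const_mul _).const_mul _)
      (measurableSet_lightCone _ _ _) fun z hz => ?_
    obtain ⟨j, hj, hj1, hj2⟩ := exists_dyadic_scale hJ hz.1 hz.2.1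
    have hXH : 0 ≤ X z * H (z.1 / T) := mul_nonneg (hXG.nonneg z) (hH.nonneg _)
    have e1 : (1 + z.1) ^ (-s) ≤ ((1 / 2 : ℝ) ^ j) ^ s := by
      rw [one_div, inv_pow, Real.inv_rpow (by positivity), ← Real.rpow_neg (by positivity)]
      exact Real.rpow_le_rpow_of_nonpos (by positivity) hj1 (by linarith)
    have e2 : 1 ≤ Real.exp 2 * Real.exp (-((1 / 2) ^ j * z.1)) := by
      rw [← Real.exp_add]; exact Real.one_le_exp (by linarith)
    have e3 : ((1 / 2 : ℝ) ^ j) ^ s * (X z * (Real.exp (-((1 / 2) ^ j * z.1)) * H (z.1 / T)))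
        ≤ ∑ j ∈ Finset.range (J + 1),
          ((1 / 2 : ℝ) ^ j) ^ s * (X z * (Real.exp (-((1 / 2) ^ j * z.1)) * H (z.1 / T))) :=
      Finset.single_le_sum (f := fun j => ((1 / 2 : ℝ) ^ j) ^ s *
        (X z * (Real.exp (-((1 / 2) ^ j * z.1)) * H (z.1 / T)))) (fun j _ =>
        mul_nonneg (Real.rpow_nonneg (hl0 j).le _) (mul_nonneg (hXG.nonneg z)
          (mul_nonneg (Real.exp_pos _).le (hH.nonneg _)))) (Finset.mem_range.2 (by omega))
    calc X z * (H (z.1 / T) * (1 + z.1) ^ (-s)) = X z * H (z.1 / T) * (1 + z.1) ^ (-s) := by ring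
      _ ≤ X z * H (z.1 / T) * ((1 / 2 : ℝ) ^ j) ^ s := mul_le_mul_of_nonneg_left e1 hXH
      _ ≤ X z * H (z.1 / T) * ((1 / 2 : ℝ) ^ j) ^ s
          * (Real.exp 2 * Real.exp (-((1 / 2) ^ j * z.1))) :=
          le_mul_of_one_le_right (mul_nonneg hXH (Real.rpow_nonneg (hl0 j).le _)) e2
      _ = Real.exp 2 * (((1 / 2 : ℝ) ^ j) ^ s
          * (X z * (Real.exp (-((1 / 2) ^ j * z.1)) * H (z.1 / T)))) := by ring
      _ ≤ _ := mul_le_mul_of_nonneg_left e3 (Real.exp_pos _).le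
  have hsum : ∑ j ∈ Finset.range (J + 1), ((1 / 2 : ℝ) ^ j) ^ s *
        ∫ z in lightCone n R 0 T, X z * (Real.exp (-((1 / 2) ^ j * z.1)) * H (z.1 / T))
      ≤ M / T * ∫ z in lightCone n R (T / 2) T, |G z| * (H (z.1 / T) ^ κ * Φ z) := by
    have hG' : ∀ j : ℕ, IntegrableOn (fun z => |G z| * (H (z.1 / T) ^ κ * envelope n ((1 / 2) ^ j) z))
        (lightCone n R (T / 2) T) := fun j => by
      have h2 : IntegrableOn (fun z => |G z|) (lightCone n R (T / 2) T) :=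
        (hXG.integrable_right.mono_set (lightCone_subset (by linarith) le_rfl)).norm
      refine h2.mul_continuousOn (Continuous.continuousOn (Continuous.mul ?_
        (continuous_envelope (hl0 j).le))) (isCompact_lightCone (by linarith))
      exact (hHc.comp (continuous_fst.div_const T)).rpow_const
        fun _ => Or.inr ((one_div_nonneg.2 hr.pos.le).trans hκ)
    have e : ∫ z in lightCone n R (T / 2) T, |G z| * (H (z.1 / T) ^ κ * Φ z)
        = ∑ j ∈ Finset.range (J + 1), ((1 / 2 : ℝ) ^ j) ^ (s + τ) *
          ∫ z in lightCone n R (T / 2) T, |G z| * (H (z.1 / T) ^ κ * envelope n ((1 / 2) ^ j) z) := by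
      simp only [← integral_const_mul]
      rw [← integral_finsetSum _ fun j _ => (hG' j).const_mul _]
      congr 1; ext z
      simp only [hΦ, Finset.mul_sum]
      exact Finset.sum_congr rfl fun j _ => by ring
    rw [e, Finset.mul_sum]
    refine Finset.sum_le_sum fun j hj => ?_
    have h2 := htest j (by have := Finset.mem_range.1 hj; omega)
    unfold TestInequality at h2
    have h3 : 0 ≤ (1 / 2 : ℝ) ^ j * c := mul_nonneg (hl0 j).le hc
    rw [Real.rpow_add (hl0 j)]
    calc _ ≤ ((1 / 2 : ℝ) ^ j) ^ s * (M * ((1 / 2 : ℝ) ^ j) ^ τ / T *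
          ∫ z in lightCone n R (T / 2) T, |G z| * (H (z.1 / T) ^ κ * envelope n ((1 / 2) ^ j) z)) :=
          mul_le_mul_of_nonneg_left (by linarith) (Real.rpow_nonneg (hl0 j).le _)
      _ = _ := by ring
  have e1 : (T ^ (n : ℝ) * (J * ℓ)) ^ (1 / r')
      = ℓ ^ (1 / r') * (J : ℝ) ^ (1 / r') * T ^ ((n : ℝ) / r') := by
    rw [Real.mul_rpow (by positivity) (by positivity), Real.mul_rpow (by positivity) hℓ0,
      ← Real.rpow_mul hT0.le, mul_one_div]
    ring
  have e2 : T ^ (-1 - m + (n : ℝ) / r') = T⁻¹ * T ^ (-m) * T ^ ((n : ℝ) / r') := by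
    rw [Real.rpow_add hT0, sub_eq_add_neg, Real.rpow_add hT0, Real.rpow_neg_one]
  have h5 : 0 ≤ T ^ (-1 - m + (n : ℝ) / r') * (J : ℝ) ^ (1 / r') * N := by positivity
  calc _ ≤ Real.exp 2 * (M / T * (K * (B * S₀ * T ^ (-m)) * (T ^ (n : ℝ) * (J * ℓ)) ^ (1 / r') * N)) :=
        hleft.trans (mul_le_mul_of_nonneg_left (hsum.trans
          (mul_le_mul_of_nonneg_left h1 (by positivity))) (Real.exp_pos _).le)
    _ = Real.exp 2 * M * K * (B * S₀) * ℓ ^ (1 / r')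
        * (T ^ (-1 - m + (n : ℝ) / r') * (J : ℝ) ^ (1 / r') * N) := by
        rw [e1, e2]; ring
    _ ≤ (Real.exp 2 * M * K * (B * S₀) * ℓ ^ (1 / r') + 1)
        * (T ^ (-1 - m + (n : ℝ) / r') * (J : ℝ) ^ (1 / r') * N) :=
        mul_le_mul_of_nonneg_right (by linarith) h5
    _ = _ := by ring

end Consequences

/-! ### A discrete differential inequality with finite lifespan. -/

section DiscreteBlowup

/-- This is the tangent line inequality at `b` for the convex function `x ^ (1 - P)`; it converts
increments of a sequence into decrements of its power, as in separation of variables. -/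
theorem rpow_one_sub_sub_ge {P a b : ℝ} (hP : 1 < P) (ha : 0 < a) (hb : 0 < b) :
    (P - 1) * b ^ (-P) * (b - a) ≤ a ^ (1 - P) - b ^ (1 - P) := by
  have hu : 0 < a / b := div_pos ha hb
  have h1 : 1 + (1 - P) * (a / b - 1) ≤ (a / b) ^ (1 - P) := by
    have h2 := Real.log_le_sub_one_of_pos hu
    have h3 := Real.add_one_le_exp (Real.log (a / b) * (1 - P))
    rw [← Real.rpow_def_of_pos hu] at h3
    nlinarith
  have e1 : a ^ (1 - P) = (a / b) ^ (1 - P) * b ^ (1 - P) := by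
    rw [← Real.mul_rpow hu.le hb.le, div_mul_cancel₀ _ hb.ne']
  have e2 : b ^ (1 - P) = b ^ (-P) * b := by
    rw [sub_eq_neg_add, Real.rpow_add hb, Real.rpow_one]
  have h4 := mul_le_mul_of_nonneg_right h1 (Real.rpow_pos_of_pos hb (1 - P)).le
  rw [← e1] at h4
  have e3 : (1 + (1 - P) * (a / b - 1)) * b ^ (1 - P)
      = b ^ (1 - P) + (P - 1) * b ^ (-P) * (b - a) := by
    rw [e2]; field_simp; ring
  linarith

/-- A discrete comparison principle: increments bounded below by `δ` and by the `P`-th power of the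
sequence cannot persist. -/
theorem exists_discrete_lifespan {P x A : ℝ} (hP : 1 < P) (hx : 0 < x) (hxP : x ≤ P) (hA : 0 < A) :
    ∃ C : ℝ, 0 < C ∧ ∀ {J₀ K : ℕ} {δ : ℝ} {b : ℕ → ℝ}, 1 ≤ J₀ → 2 * J₀ ≤ K → 0 < δ →
      (∀ j, 0 ≤ b j) → (∀ j, J₀ < j → j ≤ 2 * K → δ ≤ b j - b (j - 1)) →
      (∀ j, J₀ < j → j ≤ 2 * K → b j ^ P ≤ A * (j : ℝ) ^ (P - x) * (b j - b (j - 1))) →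
      (K : ℝ) ≤ C * δ ^ (-((P - 1) / x)) := by
  set D : ℝ := A * 2 ^ (P - x) * 2 ^ (P - 1) / (P - 1) with hD
  have hD0 : 0 < D := by
    have : 0 < P - 1 := by linarith
    positivity
  refine ⟨D ^ (1 / x), by positivity, ?_⟩
  intro J₀ K δ b hJ₀ hK hδ hb0 hinc hpow
  have hK1 : (1 : ℝ) ≤ K := by exact_mod_cast (by omega : 1 ≤ K)
  have hlow : ∀ i, J₀ + i ≤ 2 * K → i * δ ≤ b (J₀ + i) := by
    intro i
    induction i with
    | zero => intro _; simpa using hb0 J₀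
    | succ i ih =>
      intro hi
      have h1 := ih (by omega)
      have h2 := hinc (J₀ + (i + 1)) (by omega) hi
      rw [show J₀ + (i + 1) - 1 = J₀ + i by omega] at h2
      push_cast
      linarith
  -- As `2 * J₀ ≤ K`, at least half of the indices up to `K` are steps of size `δ`.
  have hbK : K * δ / 2 ≤ b K := by
    have h1 := hlow (K - J₀) (by omega)
    rw [show J₀ + (K - J₀) = K by omega, Nat.cast_sub (by omega)] at h1
    have h2 : (J₀ : ℝ) ≤ K / 2 := by
      rw [le_div_iff₀ (by norm_num)]; exact_mod_cast (by omega : J₀ * 2 ≤ K)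
    nlinarith
  have hbK0 : 0 < b K := lt_of_lt_of_le (by positivity) hbK
  have hpos : ∀ i, i ≤ K → 0 < b (K + i) := by
    intro i
    induction i with
    | zero => intro _; exact hbK0
    | succ i ih =>
      intro hi
      have h1 := ih (by omega)
      have h2 := hinc (K + (i + 1)) (by omega) (by omega)
      rw [show K + (i + 1) - 1 = K + i by omega] at h2
      linarith
  -- On `(K, 2K]` the weight `j ^ (P - x)` is at most `(2K) ^ (P - x)`, so `b ^ (1 - P)` drops by at
  -- least `η` at each of `K` steps. It stays nonnegative and starts below `(K δ / 2) ^ (1 - P)`,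
  -- hence `K ^ x` is at most a constant times `δ ^ (-(P - 1))`.
  set η : ℝ := (P - 1) / (A * (2 * K) ^ (P - x)) with hη
  have hη0 : 0 < η := div_pos (by linarith) (by positivity)
  have hstep : ∀ i ∈ Finset.range K,
      η ≤ b (K + i) ^ (1 - P) - b (K + (i + 1)) ^ (1 - P) := by
    intro i hi
    have hi := Finset.mem_range.1 hi
    have h0 := hpos i (by omega)
    have h1 := hpos (i + 1) (by omega)
    have h2 := hpow (K + (i + 1)) (by omega) (by omega)
    rw [show K + (i + 1) - 1 = K + i by omega] at h2
    refine le_trans ?_ (rpow_one_sub_sub_ge hP h0 h1)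
    have h3 : ((K + (i + 1) : ℕ) : ℝ) ^ (P - x) ≤ (2 * K) ^ (P - x) := by
      refine Real.rpow_le_rpow (by positivity) ?_ (by linarith)
      exact_mod_cast (by omega : K + (i + 1) ≤ 2 * K)
    have h4 := hinc (K + (i + 1)) (by omega) (by omega)
    rw [show K + (i + 1) - 1 = K + i by omega] at h4
    have h5 : b (K + (i + 1)) ^ P ≤ A * (2 * K) ^ (P - x) * (b (K + (i + 1)) - b (K + i)) := by
      refine h2.trans ?_
      gcongr
      linarith
    rw [Real.rpow_neg h1.le, hη, div_le_iff₀ (by positivity)]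
    have h6 : 0 < b (K + (i + 1)) ^ P := Real.rpow_pos_of_pos h1 P
    have h7 : 1 ≤ (b (K + (i + 1)) ^ P)⁻¹
        * (A * (2 * K) ^ (P - x) * (b (K + (i + 1)) - b (K + i))) := by
      rw [inv_mul_eq_div, one_le_div h6]; exact h5
    have h8 := mul_le_mul_of_nonneg_left h7 (by linarith : 0 ≤ P - 1)
    linarith
  have hsum := Finset.sum_le_sum hstep
  rw [Finset.sum_const, Finset.card_range, nsmul_eq_mul,
    Finset.sum_range_sub' (fun i => b (K + i) ^ (1 - P)), add_zero] at hsum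
  have h9 : 0 ≤ b (K + K) ^ (1 - P) := Real.rpow_nonneg (hb0 _) _
  have h10 : b K ^ (1 - P) ≤ (K * δ / 2) ^ (1 - P) :=
    Real.rpow_le_rpow_of_nonpos (by positivity) hbK (by linarith)
  have h11 : K * η ≤ (K * δ / 2) ^ (1 - P) := by linarith
  have hKp : (0 : ℝ) < K := by linarith
  have h12 : (K : ℝ) ^ x ≤ D * δ ^ (-(P - 1)) := by
    have e1 : (K * δ / 2 : ℝ) ^ (1 - P) = (K : ℝ) ^ (1 - P) * δ ^ (-(P - 1)) * 2 ^ (P - 1) := by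
      rw [Real.div_rpow (by positivity) (by norm_num), Real.mul_rpow hKp.le hδ.le, neg_sub,
        show (1 : ℝ) - P = -(P - 1) by ring, Real.rpow_neg (by norm_num : (0 : ℝ) ≤ 2), div_inv_eq_mul]
    rw [e1, hη, Real.mul_rpow (by norm_num) hKp.le, ← mul_div_assoc,
      div_le_iff₀ (by positivity)] at h11
    have e2 : (K : ℝ) ^ x = K * (K : ℝ) ^ (P - 1) / (K : ℝ) ^ (P - x) := by
      rw [← Real.rpow_one_add' hKp.le (by linarith), ← Real.rpow_sub hKp]; congr 1; ring
    have e3 : (K : ℝ) ^ (1 - P) = ((K : ℝ) ^ (P - 1))⁻¹ := by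
      rw [← Real.rpow_neg hKp.le]; congr 1; ring
    rw [e3] at h11
    have p1 : 0 < (K : ℝ) ^ (P - 1) := by positivity
    have p2 : 0 < (K : ℝ) ^ (P - x) := by positivity
    rw [e2, div_le_iff₀ p2, hD]
    have h13 := mul_le_mul_of_nonneg_right h11 p1.le
    have hP1 : 0 < P - 1 := by linarith
    have e4 : ((K : ℝ) ^ (P - 1))⁻¹ * δ ^ (-(P - 1)) * 2 ^ (P - 1) * (A * (2 ^ (P - x) * (K : ℝ) ^ (P - x)))
        * (K : ℝ) ^ (P - 1) = δ ^ (-(P - 1)) * 2 ^ (P - 1) * (A * (2 ^ (P - x) * (K : ℝ) ^ (P - x))) := by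
      field_simp
    rw [e4] at h13
    rw [div_mul_eq_mul_div, div_mul_eq_mul_div, le_div_iff₀ hP1]
    linarith
  have h14 := Real.rpow_le_rpow (by positivity) h12 (one_div_pos.2 hx).le
  rw [← Real.rpow_mul hKp.le, mul_one_div_cancel hx.ne', Real.rpow_one,
    Real.mul_rpow hD0.le (by positivity), ← Real.rpow_mul hδ.le] at h14
  refine h14.trans (le_of_eq ?_)
  congr 2
  ring

end DiscreteBlowup

/-! ### The coupled inequalities and the subcritical bound. -/

section System

variable {n : ℕ} {R : ℝ}

/-- The pair of test inequalities satisfied by a solution of the system at time scale `T`: the powers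
`|G'| ^ r'` and `|G| ^ r` are the sources of the equations tested against `G` and `G'`. -/
structure IsTestedSystem (n : ℕ) (R : ℝ) (H : ℝ → ℝ) (κ r τ M c r₂ τ₂ M₂ c₂ T : ℝ)
    (G G₂ : ℝ × Space n → ℝ) : Prop where
  pair₁ : IsConePair n R r T (fun z => |G₂ z| ^ r₂) G
  pair₂ : IsConePair n R r₂ T (fun z => |G z| ^ r) G₂
  test₁ : ∀ lam : ℝ, 0 < lam → lam ≤ 1 → 1 ≤ lam * T →
    TestInequality n R H κ τ M c lam T (fun z => |G₂ z| ^ r₂) G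
  test₂ : ∀ lam : ℝ, 0 < lam → lam ≤ 1 → 1 ≤ lam * T →
    TestInequality n R H κ τ₂ M₂ c₂ lam T (fun z => |G z| ^ r) G₂

theorem IsTestedSystem.symm {H : ℝ → ℝ} {κ r τ M c r₂ τ₂ M₂ c₂ T : ℝ} {G G₂ : ℝ × Space n → ℝ}
    (h : IsTestedSystem n R H κ r τ M c r₂ τ₂ M₂ c₂ T G G₂) :
    IsTestedSystem n R H κ r₂ τ₂ M₂ c₂ r τ M c T G₂ G :=
  ⟨h.pair₂, h.pair₁, h.test₂, h.test₁⟩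

theorem shellNorm_rpow {κ CH r T : ℝ} {H : ℝ → ℝ} (hH : IsProfile κ CH H) (hr : 0 < r)
    (G : ℝ × Space n → ℝ) :
    shellNorm n R H r T G ^ r = ∫ z in lightCone n R (T / 2) T, |G z| ^ r * H (z.1 / T) := by
  rw [shellNorm, ← Real.rpow_mul (integral_nonneg fun _ =>
    mul_nonneg (Real.rpow_nonneg (abs_nonneg _) _) (hH.nonneg _)), one_div_mul_cancel hr.ne',
    Real.rpow_one]

theorem shellNorm_rpow_le {κ CH r r₂ T : ℝ} {H : ℝ → ℝ} (hH : IsProfile κ CH H) (hr : 0 < r)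
    {G G₂ : ℝ × Space n → ℝ} (hT : 0 ≤ T) (hG : IsConePair n R r₂ T (fun z => |G z| ^ r) G₂) :
    shellNorm n R H r T G ^ r ≤ ∫ z in lightCone n R 0 T, |G z| ^ r * H (z.1 / T) := by
  rw [shellNorm_rpow hH hr]
  have hHc := hH.smooth.continuous
  refine setIntegral_mono_set (hG.integrable_left.mul_continuousOn
    (Continuous.continuousOn (by fun_prop)) (isCompact_lightCone le_rfl)) (Eventually.of_forall
    fun z => mul_nonneg (hG.nonneg z) (hH.nonneg _))
    (lightCone_subset (by linarith) le_rfl).eventuallyLE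

/-- The exponent governing the blow-up rate. -/
noncomputable def blowupExponent (n : ℕ) (r τ r₂ τ₂ : ℝ) : ℝ :=
  (r₂ * τ₂ + τ + 1 + 1 / r) / (r * r₂ - 1) - ((n : ℝ) - 1) / 2

/-- Restricting the source in the low-frequency estimate to the outer shell gives both sides the
same form, so that the estimates of the two components can be composed. -/
theorem exists_shell_transfer (hn : 3 ≤ n) (hR : 0 ≤ R) {κ CH r r' r₂ τ M : ℝ}
    {H : ℝ → ℝ} (hH : IsProfile κ CH H) (hr : r.HolderConjugate r') (hr₂ : 0 < r₂)
    (hκ : 1 / r ≤ κ) (hM : 0 < M) :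
    ∃ C : ℝ, 0 < C ∧ ∀ {T c τ₂ M₂ c₂ : ℝ} {G G₂ : ℝ × Space n → ℝ}, 1 ≤ T → 0 ≤ c →
      IsTestedSystem n R H κ r τ M c r₂ τ₂ M₂ c₂ T G G₂ →
      shellNorm n R H r₂ T G₂ ^ r₂
        ≤ C * T ^ (-1 - τ + ((n : ℝ) + 1) / r') * shellNorm n R H r T G := by
  obtain ⟨C, hC, h⟩ := exists_low_frequency_estimate hn hR hH hr hκ (τ := τ) hM
  refine ⟨C, hC, fun {T c τ₂ M₂ c₂ G G₂} hT hc hS => ?_⟩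
  have hT0 : 0 < T := by linarith
  exact (shellNorm_rpow_le hH hr₂ hT0.le hS.pair₁).trans
    (h hT hc hS.pair₁ (hS.test₁ _ (by positivity) ((div_le_one hT0).2 hT)
      (by rw [one_div_mul_cancel hT0.ne'])))

theorem le_rpow_of_rpow_le_mul {S A P : ℝ} (hP : 1 < P) (hS : 0 ≤ S) (hA : 0 ≤ A)
    (h : S ^ P ≤ A * S) : S ≤ A ^ (1 / (P - 1)) := by
  rcases hS.eq_or_lt with h0 | h0
  · rw [← h0]; positivity
  have h1 : S ^ (P - 1) ≤ A := by
    rw [Real.rpow_sub h0, Real.rpow_one, div_le_iff₀ h0]; exact h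
  have h2 := Real.rpow_le_rpow (by positivity) h1 (by
    have : 0 < P - 1 := by linarith
    positivity : 0 ≤ 1 / (P - 1))
  rwa [← Real.rpow_mul hS, mul_one_div_cancel (by linarith), Real.rpow_one] at h2

/-- The data are bounded by a power of the time scale. -/
theorem exists_data_le (hn : 3 ≤ n) (hR : 0 ≤ R) {κ CH r r' r₂ r₂' τ τ₂ M M₂ : ℝ} {H : ℝ → ℝ}
    (hH : IsProfile κ CH H) (hr : r.HolderConjugate r') (hr₂ : r₂.HolderConjugate r₂')
    (hκ : 1 / r ≤ κ) (hκ₂ : 1 / r₂ ≤ κ) (hM : 0 < M) (hM₂ : 0 < M₂) :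
    ∃ C : ℝ, 0 < C ∧ ∀ {T c c₂ : ℝ} {G G₂ : ℝ × Space n → ℝ}, 1 ≤ T → 0 ≤ c → 0 ≤ c₂ →
      IsTestedSystem n R H κ r τ M c r₂ τ₂ M₂ c₂ T G G₂ →
      c ≤ C * T ^ (-blowupExponent n r τ r₂ τ₂) := by
  obtain ⟨B, hB, h1⟩ := exists_shell_transfer hn hR hH hr hr₂.pos hκ (τ := τ) hM
  obtain ⟨B₂, hB₂, h2⟩ := exists_shell_transfer hn hR hH hr₂ hr.pos hκ₂ (τ := τ₂) hM₂
  obtain ⟨A, hA, h3⟩ := exists_high_frequency_estimate hn hR hH hr hκ (τ := τ) hM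
  have hr1 := hr.lt
  have hr₂1 := hr₂.lt
  have hr0 := hr.pos
  have hr₂0 := hr₂.pos
  have hP : 1 < r * r₂ := by nlinarith
  refine ⟨A * (B₂ ^ r₂ * B) ^ (1 / (r * r₂ - 1)), by positivity, ?_⟩
  intro T c c₂ G G₂ hT hc hc₂ hS
  have hT0 : 0 < T := by linarith
  have k1 := h1 hT hc hS
  have k2 := h2 hT hc₂ hS.symm
  have k3 := h3 hT hS.pair₁ (hS.test₁ 1 one_pos le_rfl (by linarith))
  have hS1 := shellNorm_nonneg (n := n) (R := R) hH r T G
  have hS2 := shellNorm_nonneg (n := n) (R := R) hH r₂ T G₂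
  set S := shellNorm n R H r T G
  set S₂ := shellNorm n R H r₂ T G₂
  set α := -1 - τ + ((n : ℝ) + 1) / r' with hα
  set α₂ := -1 - τ₂ + ((n : ℝ) + 1) / r₂' with hα₂
  -- Going once around the system returns to `S` with the power `r r₂ > 1` on the left; cancelling
  -- one `S` bounds it by a power of `T` without reference to the data.
  have k4 : S ^ (r * r₂) ≤ (B₂ ^ r₂ * B * T ^ (α₂ * r₂ + α)) * S := by
    rw [Real.rpow_mul hS1]
    calc (S ^ r) ^ r₂ ≤ (B₂ * T ^ α₂ * S₂) ^ r₂ := Real.rpow_le_rpow (by positivity) k2 hr₂0.le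
      _ = B₂ ^ r₂ * T ^ (α₂ * r₂) * S₂ ^ r₂ := by
          rw [Real.mul_rpow (by positivity) hS2, Real.mul_rpow hB₂.le (by positivity),
            ← Real.rpow_mul hT0.le]
      _ ≤ B₂ ^ r₂ * T ^ (α₂ * r₂) * (B * T ^ α * S) := by gcongr
      _ = _ := by rw [Real.rpow_add hT0 (α₂ * r₂) α]; ring
  have k5 := le_rpow_of_rpow_le_mul hP hS1 (by positivity) k4
  refine k3.trans ((mul_le_mul_of_nonneg_left k5 (by positivity)).trans (le_of_eq ?_))
  rw [Real.mul_rpow (by positivity) (by positivity), ← Real.rpow_mul hT0.le]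
  have e : T ^ (-blowupExponent n r τ r₂ τ₂)
      = T ^ (-1 - ((n : ℝ) - 1) / 2 + n / r') * T ^ ((α₂ * r₂ + α) * (1 / (r * r₂ - 1))) := by
    rw [← Real.rpow_add hT0]
    congr 1
    have e1 : 1 / r' = 1 - 1 / r := by
      have := hr.inv_add_inv_eq_one; rw [one_div, one_div]; linarith
    have e2 : 1 / r₂' = 1 - 1 / r₂ := by
      have := hr₂.inv_add_inv_eq_one; rw [one_div, one_div]; linarith
    have q1 : ∀ x : ℝ, x / r' = x * (1 - 1 / r) := fun x => by rw [div_eq_mul_one_div, e1]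
    have q2 : ∀ x : ℝ, x / r₂' = x * (1 - 1 / r₂) := fun x => by rw [div_eq_mul_one_div, e2]
    rw [blowupExponent, hα, hα₂, q1, q1, q2]
    have hP' : r * r₂ - 1 ≠ 0 := by linarith
    -- Eliminating `r₂` in favour of `ρ = r r₂ - 1` leaves an identity of rational functions in `r`
    -- and `ρ` with simple denominators.
    obtain ⟨ρ, hρ⟩ : ∃ ρ, ρ = r * r₂ - 1 := ⟨_, rfl⟩
    rw [← hρ] at hP' ⊢
    obtain rfl : r₂ = (ρ + 1) / r := by rw [eq_div_iff hr0.ne']; linarith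
    have : ρ + 1 ≠ 0 := fun h => by rw [h, zero_div] at hr₂0; exact lt_irrefl _ hr₂0
    field_simp
    ring
  rw [e]
  ring

end System

/-! ### The critical cases: difference inequalities in the dyadic time. -/

section Critical

variable {n : ℕ} {R : ℝ}

/-- The weighted size of the source `X` on the light cone up to time `2 ^ j`. -/
noncomputable def dyadicIntegral (n : ℕ) (R : ℝ) (H : ℝ → ℝ) (s : ℝ) (X : ℝ × Space n → ℝ) (j : ℕ) : ℝ :=
  ∫ z in lightCone n R 0 (2 ^ j), X z * (H (z.1 / 2 ^ j) * (1 + z.1) ^ (-s))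

theorem dyadicIntegral_nonneg {κ CH : ℝ} {H : ℝ → ℝ} (hH : IsProfile κ CH H) (s : ℝ)
    {X : ℝ × Space n → ℝ} (hX : ∀ z, 0 ≤ X z) (j : ℕ) : 0 ≤ dyadicIntegral n R H s X j :=
  setIntegral_nonneg (measurableSet_lightCone _ _ _) fun z hz =>
    mul_nonneg (hX z) (mul_nonneg (hH.nonneg _) (Real.rpow_nonneg (by linarith [hz.1]) _))

/-- Before `T / 2` the cutoff at scale `T` equals `1` and dominates the one at scale `T / 2`; after
`T / 2` the latter vanishes. The increment therefore contains the whole outer shell, where `1 + t ≤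
2 T`. -/
theorem integral_shell_le_increment {κ CH s T : ℝ} {H : ℝ → ℝ} (hH : IsProfile κ CH H) (hs : 0 ≤ s)
    (hT : 1 ≤ T) {X : ℝ × Space n → ℝ} (hX0 : ∀ z, 0 ≤ X z) (hX : IntegrableOn X (lightCone n R 0 T)) :
    (∫ z in lightCone n R 0 (T / 2), X z * (H (z.1 / (T / 2)) * (1 + z.1) ^ (-s)))
        + (2 * T) ^ (-s) * ∫ z in lightCone n R (T / 2) T, X z * H (z.1 / T)
      ≤ ∫ z in lightCone n R 0 T, X z * (H (z.1 / T) * (1 + z.1) ^ (-s)) := by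
  have hT0 : 0 < T := by linarith
  have hHc := hH.smooth.continuous
  have hK := isCompact_lightCone (n := n) (R := R) (b := T) le_rfl
  have hint : ∀ T' : ℝ, IntegrableOn (fun z => X z * (H (z.1 / T') * (1 + z.1) ^ (-s)))
      (lightCone n R 0 T) := fun T' =>
    hX.mul_continuousOn (ContinuousOn.mul (Continuous.continuousOn (by fun_prop))
      (ContinuousOn.rpow_const (Continuous.continuousOn (by fun_prop))
        fun z hz => Or.inl (by linarith [hz.1]))) hK
  have hint' : IntegrableOn (fun z => X z * H (z.1 / T)) (lightCone n R 0 T) :=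
    hX.mul_continuousOn (Continuous.continuousOn (by fun_prop)) hK
  have hsub : lightCone n R (T / 2) T ⊆ lightCone n R 0 T := lightCone_subset (by linarith) le_rfl
  have hm := measurableSet_lightCone (n := n) R (T / 2) T
  set A : Set (ℝ × Space n) := lightCone n R 0 T \ lightCone n R (T / 2) T with hA
  have hAm : MeasurableSet A := (measurableSet_lightCone R 0 T).diff hm
  have hAt : ∀ z ∈ A, 0 ≤ z.1 ∧ z.1 < T / 2 ∧ ‖z.2‖ ≤ z.1 + R := by
    intro z hz
    refine ⟨hz.1.1, ?_, hz.1.2.2⟩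
    by_contra h
    exact hz.2 ⟨not_lt.1 h, hz.1.2.1, hz.1.2.2⟩
  have hw : ∀ z ∈ lightCone n R 0 T, 0 ≤ (1 + z.1) ^ (-s) := fun z hz =>
    Real.rpow_nonneg (by linarith [hz.1]) _
  have e1 : ∫ z in lightCone n R 0 (T / 2), X z * (H (z.1 / (T / 2)) * (1 + z.1) ^ (-s))
      = ∫ z in A, X z * (H (z.1 / (T / 2)) * (1 + z.1) ^ (-s)) := by
    refine setIntegral_eq_of_subset_of_forall_sdiff_eq_zero (measurableSet_lightCone _ _ _)
      (fun z hz => ⟨(hAt z hz).1, (hAt z hz).2.1.le, (hAt z hz).2.2⟩) fun z hz => ?_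
    have : T / 2 ≤ z.1 := by
      by_contra h
      refine hz.2 ⟨⟨hz.1.1, by linarith, hz.1.2.2⟩, fun h' => h h'.1⟩
    rw [hH.eq_zero _ ((one_le_div (by linarith)).2 this), zero_mul, mul_zero]
  have e2 : ∫ z in lightCone n R 0 T, X z * (H (z.1 / T) * (1 + z.1) ^ (-s))
      = (∫ z in lightCone n R (T / 2) T, X z * (H (z.1 / T) * (1 + z.1) ^ (-s)))
        + ∫ z in A, X z * (H (z.1 / T) * (1 + z.1) ^ (-s)) := by
    rw [← integral_inter_add_sdiff hm (hint T), inter_eq_self_of_subset_right hsub]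
  have h1 : ∫ z in A, X z * (H (z.1 / (T / 2)) * (1 + z.1) ^ (-s))
      ≤ ∫ z in A, X z * (H (z.1 / T) * (1 + z.1) ^ (-s)) := by
    refine setIntegral_mono_on ((hint _).mono_set sdiff_subset) ((hint _).mono_set sdiff_subset)
      hAm fun z hz => ?_
    rw [hH.eq_one (z.1 / T) (by rw [div_le_iff₀ hT0]; linarith [(hAt z hz).2.1])]
    exact mul_le_mul_of_nonneg_left (mul_le_mul_of_nonneg_right (hH.le_one _) (hw z hz.1)) (hX0 z)
  have h2 : (2 * T) ^ (-s) * ∫ z in lightCone n R (T / 2) T, X z * H (z.1 / T)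
      ≤ ∫ z in lightCone n R (T / 2) T, X z * (H (z.1 / T) * (1 + z.1) ^ (-s)) := by
    rw [← integral_const_mul]
    refine setIntegral_mono_on ((hint'.mono_set hsub).const_mul _) ((hint _).mono_set hsub) hm
      fun z hz => ?_
    have h3 : (2 * T) ^ (-s) ≤ (1 + z.1) ^ (-s) :=
      Real.rpow_le_rpow_of_nonpos (by linarith [hz.1]) (by linarith [hz.2.1]) (by linarith)
    have h4 : 0 ≤ X z * H (z.1 / T) := mul_nonneg (hX0 z) (hH.nonneg _)
    calc _ ≤ (1 + z.1) ^ (-s) * (X z * H (z.1 / T)) := mul_le_mul_of_nonneg_right h3 h4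
      _ = _ := by ring
  rw [e1, e2]
  linarith

theorem rpow_shellNorm_le_increment {κ CH s r r₂ : ℝ} {H : ℝ → ℝ} (hH : IsProfile κ CH H) (hs : 0 ≤ s)
    (hr₂ : 0 < r₂) {J : ℕ} (hJ : 1 ≤ J) {G G₂ : ℝ × Space n → ℝ}
    (hG : IsConePair n R r (2 ^ J) (fun z => |G₂ z| ^ r₂) G) :
    (2 ^ J : ℝ) ^ (-s) * shellNorm n R H r₂ (2 ^ J) G₂ ^ r₂
      ≤ 2 ^ s * (dyadicIntegral n R H s (fun z => |G₂ z| ^ r₂) J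
        - dyadicIntegral n R H s (fun z => |G₂ z| ^ r₂) (J - 1)) := by
  have h := integral_shell_le_increment hH hs (one_le_pow₀ (by norm_num : (1 : ℝ) ≤ 2)) hG.nonneg
    hG.integrable_left
  have e : (2 : ℝ) ^ J / 2 = 2 ^ (J - 1) := by
    obtain ⟨k, rfl⟩ : ∃ k, J = k + 1 := ⟨J - 1, by omega⟩
    rw [pow_succ]; simp
  rw [← shellNorm_rpow hH hr₂, e] at h
  rw [Real.mul_rpow (by norm_num) (by positivity), Real.rpow_neg (by norm_num : (0 : ℝ) ≤ 2)] at h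
  have h2 : (2 ^ s)⁻¹ * (2 ^ J : ℝ) ^ (-s) * shellNorm n R H r₂ (2 ^ J) G₂ ^ r₂
      ≤ dyadicIntegral n R H s (fun z => |G₂ z| ^ r₂) J
        - dyadicIntegral n R H s (fun z => |G₂ z| ^ r₂) (J - 1) := by
    unfold dyadicIntegral; linarith
  rwa [mul_assoc, inv_mul_le_iff₀ (by positivity)] at h2

/-- Algebra shared by two uses: `y` is the weighted source integral, with `K` the logarithmic
factor, or the size of the data, with `K = 1`. The transfer replaces the first shell norm by the
second, whose power is an increment. -/
theorem rpow_le_of_le_shellNorm {r r₂ T A B K a b y S S₂ : ℝ} (hr : 0 < r) (hr₂ : 0 < r₂) (hT : 0 < T)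
    (hA : 0 ≤ A) (hB : 0 ≤ B) (hK : 0 ≤ K) (hy : 0 ≤ y) (hS : 0 ≤ S) (hS₂ : 0 ≤ S₂)
    (h1 : y ≤ A * T ^ a * K * S) (h2 : S ^ r ≤ B * T ^ b * S₂) :
    y ^ (r * r₂) ≤ (A ^ r * B) ^ r₂ * K ^ (r * r₂) * (T ^ ((a * r + b) * r₂) * S₂ ^ r₂) := by
  have h3 : y ^ r ≤ A ^ r * B * K ^ r * T ^ (a * r + b) * S₂ := by
    calc y ^ r ≤ (A * T ^ a * K * S) ^ r := Real.rpow_le_rpow hy h1 hr.le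
      _ = A ^ r * T ^ (a * r) * K ^ r * S ^ r := by
          rw [Real.mul_rpow (by positivity) hS, Real.mul_rpow (by positivity) hK,
            Real.mul_rpow hA (by positivity), ← Real.rpow_mul hT.le]
      _ ≤ A ^ r * T ^ (a * r) * K ^ r * (B * T ^ b * S₂) := by gcongr
      _ = _ := by rw [Real.rpow_add hT]; ring
  rw [Real.rpow_mul hy]
  refine (Real.rpow_le_rpow (by positivity) h3 hr₂.le).trans (le_of_eq ?_)
  rw [Real.mul_rpow (by positivity) hS₂, Real.mul_rpow (by positivity) (by positivity),
    Real.mul_rpow (by positivity) (by positivity), ← Real.rpow_mul hK, ← Real.rpow_mul hT.le]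
  ring

theorem exists_critical_increment (hn : 3 ≤ n) (hR : 0 ≤ R) {κ CH r r' r₂ r₂' τ τ₂ M M₂ s : ℝ}
    {H : ℝ → ℝ} (hH : IsProfile κ CH H) (hr : r.HolderConjugate r') (hr₂ : r₂.HolderConjugate r₂')
    (hκ : 1 / r ≤ κ) (hκ₂ : 1 / r₂ ≤ κ) (hM : 0 < M) (hM₂ : 0 < M₂)
    (hs : s = ((n : ℝ) - 1) / 2 + 1 / r' - τ) (hs0 : 0 ≤ s) (hF : blowupExponent n r τ r₂ τ₂ = 0) :
    ∃ C : ℝ, 0 < C ∧ ∀ {J : ℕ} {c c₂ : ℝ} {G G₂ : ℝ × Space n → ℝ}, 1 ≤ J → 0 ≤ c → 0 ≤ c₂ →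
      IsTestedSystem n R H κ r τ M c r₂ τ₂ M₂ c₂ (2 ^ J) G G₂ →
      dyadicIntegral n R H s (fun z => |G₂ z| ^ r₂) J ^ (r * r₂)
        ≤ C * (J : ℝ) ^ (r * r₂ - r₂) * (dyadicIntegral n R H s (fun z => |G₂ z| ^ r₂) J
          - dyadicIntegral n R H s (fun z => |G₂ z| ^ r₂) (J - 1)) ∧
      c ^ (r * r₂) ≤ C * (dyadicIntegral n R H s (fun z => |G₂ z| ^ r₂) J
          - dyadicIntegral n R H s (fun z => |G₂ z| ^ r₂) (J - 1)) := by
  obtain ⟨B, hB, h2⟩ := exists_shell_transfer hn hR hH hr₂ hr.pos hκ₂ (τ := τ₂) hM₂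
  obtain ⟨A, hA, h3⟩ := exists_high_frequency_estimate hn hR hH hr hκ (τ := τ) hM
  obtain ⟨A₁, hA₁, h4⟩ := exists_dyadic_estimate hn hR hH hr hκ hM hs hs0
  have hr0 := hr.pos
  have hr₂0 := hr₂.pos
  have hP : 1 < r * r₂ := by nlinarith [hr.lt, hr₂.lt]
  set A₂ := max A A₁ with hA₂
  have hA₂0 : 0 < A₂ := lt_max_of_lt_left hA
  refine ⟨(A₂ ^ r * B) ^ r₂ * 2 ^ s, by positivity, ?_⟩
  intro J c c₂ G G₂ hJ hc hc₂ hS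
  set T : ℝ := 2 ^ J with hTdef
  have hT : 1 ≤ T := one_le_pow₀ (by norm_num)
  have hT0 : 0 < T := by linarith
  have hS1 := shellNorm_nonneg (n := n) (R := R) hH r T G
  have hS2 := shellNorm_nonneg (n := n) (R := R) hH r₂ T G₂
  have k2 := h2 hT hc₂ hS.symm
  have k3 := h3 hT hS.pair₁ (hS.test₁ 1 one_pos le_rfl (by linarith))
  have k4 := h4 hJ hc hS.pair₁ (fun j hj => hS.test₁ _ (by positivity)
    (pow_le_one₀ (by norm_num) (by norm_num)) (by
      rw [one_div, inv_pow, inv_mul_eq_div, one_le_div (by positivity)]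
      exact pow_le_pow_right₀ (by norm_num) hj))
  have k5 := rpow_shellNorm_le_increment hH hs0 hr₂0 hJ hS.pair₁
  rw [← hTdef] at k4 k5
  set a : ℝ := -1 - ((n : ℝ) - 1) / 2 + n / r' with ha
  -- Criticality enters here: the accumulated power of `T` is exactly the weight `T ^ (-s)` of the
  -- shell in the increment, so no power of `T` is left.
  have hexp : (a * r + (-1 - τ₂ + ((n : ℝ) + 1) / r₂')) * r₂ = -s := by
    have e1 : 1 / r' = 1 - 1 / r := by
      have := hr.inv_add_inv_eq_one; rw [one_div, one_div]; linarith
    have e2 : 1 / r₂' = 1 - 1 / r₂ := by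
      have := hr₂.inv_add_inv_eq_one; rw [one_div, one_div]; linarith
    rw [blowupExponent, sub_eq_zero, div_eq_iff (by linarith)] at hF
    rw [ha, hs, div_eq_mul_one_div (n : ℝ) r', div_eq_mul_one_div _ r₂', e1, e2]
    have e3 : r * (1 / r) = 1 := mul_one_div_cancel hr0.ne'
    have e4 : r₂ * (1 / r₂) = 1 := mul_one_div_cancel hr₂0.ne'
    linear_combination (-1) * hF - n * r₂ * e3 - ((n : ℝ) + 1) * e4
  have hb0 : 0 ≤ dyadicIntegral n R H s (fun z => |G₂ z| ^ r₂) J :=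
    dyadicIntegral_nonneg hH s (fun z => Real.rpow_nonneg (abs_nonneg _) _) J
  have hJr : (((J : ℝ) ^ (1 / r')) ^ (r * r₂)) = (J : ℝ) ^ (r * r₂ - r₂) := by
    rw [← Real.rpow_mul (by positivity)]
    congr 1
    have e1 : 1 / r' = 1 - 1 / r := by
      have := hr.inv_add_inv_eq_one; rw [one_div, one_div]; linarith
    rw [e1]; field_simp
  have q1 := rpow_le_of_le_shellNorm (y := dyadicIntegral n R H s (fun z => |G₂ z| ^ r₂) J)
    (K := (J : ℝ) ^ (1 / r')) hr0 hr₂0 hT0 hA₂0.le hB.le (by positivity) hb0 hS1 hS2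
    (k4.trans (by gcongr; exact le_max_right _ _)) k2
  have q2 := rpow_le_of_le_shellNorm (K := 1) hr0 hr₂0 hT0 hA₂0.le hB.le zero_le_one hc hS1 hS2
    (k3.trans (by rw [mul_one]; gcongr; exact le_max_left _ _)) k2
  rw [hexp] at q1 q2
  rw [hJr] at q1
  rw [Real.one_rpow, mul_one] at q2
  constructor
  · refine q1.trans ((mul_le_mul_of_nonneg_left k5 (by positivity)).trans (le_of_eq ?_))
    ring
  · refine q2.trans ((mul_le_mul_of_nonneg_left k5 (by positivity)).trans (le_of_eq ?_))
    ring

/-- The high-frequency estimate of the second component bounds its data by its own shell norm,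
without passing through the other one. The increment thus dominates the power `r₂` of the data
instead of `r r₂`. -/
theorem exists_doubly_critical_increment (hn : 3 ≤ n) (hR : 0 ≤ R) {κ CH r r₂ r₂' τ τ₂ M M₂ s : ℝ}
    {H : ℝ → ℝ} (hH : IsProfile κ CH H) (hr₂ : r₂.HolderConjugate r₂') (hκ₂ : 1 / r₂ ≤ κ)
    (hM₂ : 0 < M₂) (hs0 : 0 ≤ s)
    (hs : (-1 - ((n : ℝ) - 1) / 2 + n / r₂') * r₂ = -s) :
    ∃ C : ℝ, 0 < C ∧ ∀ {J : ℕ} {c c₂ : ℝ} {G G₂ : ℝ × Space n → ℝ}, 1 ≤ J → 0 ≤ c₂ →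
      IsTestedSystem n R H κ r τ M c r₂ τ₂ M₂ c₂ (2 ^ J) G G₂ →
      c₂ ^ r₂ ≤ C * (dyadicIntegral n R H s (fun z => |G₂ z| ^ r₂) J
          - dyadicIntegral n R H s (fun z => |G₂ z| ^ r₂) (J - 1)) := by
  obtain ⟨A, hA, h3⟩ := exists_high_frequency_estimate hn hR hH hr₂ hκ₂ (τ := τ₂) hM₂
  have hr₂0 := hr₂.pos
  refine ⟨A ^ r₂ * 2 ^ s, by positivity, ?_⟩
  intro J c c₂ G G₂ hJ hc₂ hS
  have hT : (1 : ℝ) ≤ 2 ^ J := one_le_pow₀ (by norm_num)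
  have hS2 := shellNorm_nonneg (n := n) (R := R) hH r₂ (2 ^ J) G₂
  have k3 := h3 hT hS.pair₂ (hS.test₂ 1 one_pos le_rfl (by linarith))
  have k5 := rpow_shellNorm_le_increment hH hs0 hr₂0 hJ hS.pair₁
  have k6 := Real.rpow_le_rpow hc₂ k3 hr₂0.le
  rw [Real.mul_rpow (by positivity) hS2, Real.mul_rpow hA.le (by positivity),
    ← Real.rpow_mul (by positivity), hs, mul_assoc] at k6
  refine k6.trans ((mul_le_mul_of_nonneg_left k5 (by positivity)).trans (le_of_eq ?_))
  ring

/-- In the critical case the dyadic logarithm of the existence time is bounded by a power of the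
size of the data. -/
theorem exists_critical_lifespan (hn : 3 ≤ n) (hR : 0 ≤ R) {κ CH r r' r₂ r₂' τ τ₂ M M₂ s : ℝ}
    {H : ℝ → ℝ} (hH : IsProfile κ CH H) (hr : r.HolderConjugate r') (hr₂ : r₂.HolderConjugate r₂')
    (hκ : 1 / r ≤ κ) (hκ₂ : 1 / r₂ ≤ κ) (hM : 0 < M) (hM₂ : 0 < M₂)
    (hs : s = ((n : ℝ) - 1) / 2 + 1 / r' - τ) (hs0 : 0 ≤ s) (hF : blowupExponent n r τ r₂ τ₂ = 0) :
    ∃ C : ℝ, 0 < C ∧ ∀ {J₀ K : ℕ} {c c₂ : ℝ} {G G₂ : ℝ × Space n → ℝ}, 1 ≤ J₀ → 2 * J₀ ≤ K →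
      0 < c → 0 < c₂ → (∀ j, J₀ < j → j ≤ 2 * K →
        IsTestedSystem n R H κ r τ M c r₂ τ₂ M₂ c₂ (2 ^ j) G G₂) →
      (K : ℝ) ≤ C * c ^ (-(r * (r * r₂ - 1))) ∧
      ((-1 - ((n : ℝ) - 1) / 2 + n / r₂') * r₂ = -s → (K : ℝ) ≤ C * c₂ ^ (-(r * r₂ - 1))) := by
  obtain ⟨A, hA, h1⟩ := exists_critical_increment hn hR hH hr hr₂ hκ hκ₂ hM hM₂ hs hs0 hF
  have hr0 := hr.pos
  have hr₂0 := hr₂.pos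
  have hr1 := hr.lt
  have hP : 1 < r * r₂ := by nlinarith [hr₂.lt]
  -- The choice `x = r₂` makes `P - x` the power of the logarithm in the increment inequality; `x ≤
  -- P` amounts to `r ≥ 1`.
  obtain ⟨B, hB, h2⟩ := exists_discrete_lifespan (P := r * r₂) (x := r₂) hP hr₂0 (by nlinarith) hA
  -- Outside the doubly critical case the constant is irrelevant and is set to `1`, so that one
  -- constant serves both conclusions.
  obtain ⟨A₂, hA₂, h3⟩ : ∃ A₂ : ℝ, 0 < A₂ ∧ ((-1 - ((n : ℝ) - 1) / 2 + n / r₂') * r₂ = -s →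
      ∀ {J : ℕ} {c c₂ : ℝ} {G G₂ : ℝ × Space n → ℝ}, 1 ≤ J → 0 ≤ c₂ →
      IsTestedSystem n R H κ r τ M c r₂ τ₂ M₂ c₂ (2 ^ J) G G₂ →
      c₂ ^ r₂ ≤ A₂ * (dyadicIntegral n R H s (fun z => |G₂ z| ^ r₂) J
          - dyadicIntegral n R H s (fun z => |G₂ z| ^ r₂) (J - 1))) := by
    by_cases h : (-1 - ((n : ℝ) - 1) / 2 + n / r₂') * r₂ = -s
    · obtain ⟨A₂, hA₂, h3⟩ := exists_doubly_critical_increment hn hR hH hr₂ hκ₂ hM₂ hs0 h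
        (r := r) (τ := τ) (τ₂ := τ₂) (M := M)
      exact ⟨A₂, hA₂, fun _ => h3⟩
    · exact ⟨1, one_pos, fun h' => absurd h' h⟩
  have hfin : ∀ {D y e : ℝ}, 0 < D → 0 < y →
      (y ^ e / D) ^ (-((r * r₂ - 1) / r₂))
        = D ^ ((r * r₂ - 1) / r₂) * y ^ (-(e * ((r * r₂ - 1) / r₂))) := by
    intro D y e hD hy
    rw [Real.div_rpow (by positivity) hD.le, ← Real.rpow_mul hy.le, Real.rpow_neg hD.le,
      div_inv_eq_mul, mul_neg, mul_comm]
  set D₁ := B * A ^ ((r * r₂ - 1) / r₂) with hD₁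
  set D₂ := B * A₂ ^ ((r * r₂ - 1) / r₂) with hD₂
  have hD₁0 : 0 < D₁ := by positivity
  have hD₂0 : 0 < D₂ := by positivity
  refine ⟨D₁ + D₂, by positivity, ?_⟩
  intro J₀ K c c₂ G G₂ hJ₀ hK hc hc₂ hS
  have hb0 : ∀ j, 0 ≤ dyadicIntegral n R H s (fun z => |G₂ z| ^ r₂) j := fun j =>
    dyadicIntegral_nonneg hH s (fun z => Real.rpow_nonneg (abs_nonneg _) _) j
  have hpow : ∀ j, J₀ < j → j ≤ 2 * K → _ := fun j hj hj' =>
    (h1 (by omega) hc.le hc₂.le (hS j hj hj')).1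
  constructor
  · have h4 := h2 (δ := c ^ (r * r₂) / A) hJ₀ hK (by positivity) hb0 (fun j hj hj' => by
      rw [div_le_iff₀' hA]
      exact (h1 (by omega) hc.le hc₂.le (hS j hj hj')).2) hpow
    rw [hfin hA hc, ← mul_assoc, ← hD₁] at h4
    have e : r * r₂ * ((r * r₂ - 1) / r₂) = r * (r * r₂ - 1) := by field_simp
    rw [e] at h4
    refine h4.trans (mul_le_mul_of_nonneg_right (by linarith) (by positivity))
  · intro h
    have h4 := h2 (δ := c₂ ^ r₂ / A₂) hJ₀ hK (by positivity) hb0 (fun j hj hj' => by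
      rw [div_le_iff₀' hA₂]
      exact h3 h (by omega) hc₂.le (hS j hj hj')) hpow
    rw [hfin hA₂ hc₂, ← mul_assoc, ← hD₂] at h4
    have e : r₂ * ((r * r₂ - 1) / r₂) = r * r₂ - 1 := by field_simp
    rw [e] at h4
    refine h4.trans (mul_le_mul_of_nonneg_right (by linarith) (by positivity))

end Critical

/-! ### From the test inequalities to bounds on the supremum of existence times. -/

section Lifespan

variable {n : ℕ} {p q R : ℝ} {D₁ D₂ V₁ V₂ u₀ u₁ v₀ v₁ : Space n → ℝ}

theorem IsData.integral_pos {f₀ f₁ : Space n → ℝ} (h : IsData R f₀ f₁) :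
    0 < (∫ x, f₀ x) + ∫ x, f₁ x := by
  have hcs : ∀ {f : Space n → ℝ}, Function.support f ⊆ Metric.closedBall 0 R → HasCompactSupport f :=
    fun h => HasCompactSupport.of_support_subset_isCompact (isCompact_closedBall _ _) h
  have hpos : ∀ {f : Space n → ℝ}, ContDiff ℝ ∞ f → Function.support f ⊆ Metric.closedBall 0 R →
      (∀ x, 0 ≤ f x) → f ≠ 0 → 0 < ∫ x, f x := by
    intro f hf hs h0 hne
    obtain ⟨x, hx⟩ := Function.ne_iff.1 hne
    exact hf.continuous.integral_pos_of_hasCompactSupport_nonneg_nonzero (hcs hs) h0 hx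
  have i₀ : 0 ≤ ∫ x, f₀ x := integral_nonneg h.nonneg₀
  have i₁ : 0 ≤ ∫ x, f₁ x := integral_nonneg h.nonneg₁
  rcases h.nontrivial with h' | h'
  · linarith [hpos h.smooth₀ h.supp₀ h.nonneg₀ h']
  · linarith [hpos h.smooth₁ h.supp₁ h.nonneg₁ h']

theorem IsWeakSolution.isWaveComponent {ε : ℝ} {Tm : ℝ≥0∞} {u ut v vt : ℝ × Space n → ℝ}
    {du dv : ℝ × Space n → Space n} (hp : 1 < p) (hq : 1 < q)
    (hu : IsData R u₀ u₁) (hv : IsData R v₀ v₁) (hD₁ : Continuous D₁) (hD₂ : Continuous D₂)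
    (hV₁ : Continuous V₁) (hV₂ : Continuous V₂)
    (h : IsWeakSolution p q D₁ D₂ V₁ V₂ R u₀ u₁ v₀ v₁ ε Tm u ut du v vt dv) :
    IsWaveComponent Tm ε R D₁ V₁ u₀ u₁ u ut du (fun z => |v z| ^ q) ∧
      IsWaveComponent Tm ε R D₂ V₂ v₀ v₁ v vt dv (fun z => |ut z| ^ p) := by
  obtain ⟨U, -, -, hU, -⟩ := h.energy_v
  have hv0 := ae_slab_of_forall_ae hU.1 (R := R) (Eventually.of_forall fun t ht => by
    filter_upwards [h.finite_speed t ht] with x hx hx' using (hx hx').2)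
  have hWu : IsWaveComponent Tm ε R D₁ V₁ u₀ u₁ u ut du (fun z => |v z| ^ q) :=
    { energy := h.energy_u
      init := h.init_u
      eq := h.eq_u
      speed := fun t ht => by
        filter_upwards [h.finite_speed t ht] with x hx hx' using (hx hx').1
      speed_source := by
        filter_upwards [hv0] with z hz hz'
        rw [hz hz', abs_zero, Real.zero_rpow (by linarith)]
      continuous_D := hD₁
      continuous_V := hV₁
      continuous₀ := hu.smooth₀.continuous
      continuous₁ := hu.smooth₁.continuous
      supp₀ := hu.supp₀
      supp₁ := hu.supp₁ }
  refine ⟨hWu,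
    { energy := h.energy_v
      init := h.init_v
      eq := h.eq_v
      speed := fun t ht => by
        filter_upwards [h.finite_speed t ht] with x hx hx' using (hx hx').2
      speed_source := by
        filter_upwards [hWu.ae_slab.2] with z hz hz'
        rw [hz hz', abs_zero, Real.zero_rpow (by linarith)]
      continuous_D := hD₂
      continuous_V := hV₂
      continuous₀ := hv.smooth₀.continuous
      continuous₁ := hv.smooth₁.continuous
      supp₀ := hv.supp₀
      supp₁ := hv.supp₁ }⟩

/-- Every weak solution satisfies the test inequalities of the system at all large time scales. -/
theorem exists_isTestedSystem (hn : 3 ≤ n) (hp : 1 < p) (hq : 1 < q) {a₁ a₂ β γ : ℝ} (ha₁ : 0 ≤ a₁)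
    (ha₂ : 0 ≤ a₂) (hβ : 1 < β) (hγ : 2 < γ) (hD₁ : IsCoefficient a₁ β D₁)
    (hD₂ : IsCoefficient a₁ β D₂) (hV₁ : IsCoefficient a₂ γ V₁) (hV₂ : IsCoefficient a₂ γ V₂)
    (hR : 0 ≤ R) (hu : IsData R u₀ u₁) (hv : IsData R v₀ v₁) :
    ∃ (H : ℝ → ℝ) (κ CH M M₂ T₀ : ℝ), IsProfile κ CH H ∧ 1 / p ≤ κ ∧ 1 / q ≤ κ ∧ 0 < M ∧ 0 < M₂ ∧
      1 ≤ T₀ ∧ ∀ {ε : ℝ} {Tm : ℝ≥0∞} {u ut v vt : ℝ × Space n → ℝ} {du dv : ℝ × Space n → Space n},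
        0 ≤ ε → IsWeakSolution p q D₁ D₂ V₁ V₂ R u₀ u₁ v₀ v₁ ε Tm u ut du v vt dv →
        ∀ T, T₀ ≤ T → ENNReal.ofReal T < Tm →
          IsTestedSystem n R H κ p 0 M (ε * ((∫ x, u₀ x) + ∫ x, u₁ x)) q 1 M₂
            (ε * ((∫ x, v₀ x) + ∫ x, v₁ x)) T ut v := by
  have hp0 : 0 < p := by linarith
  have hq0 : 0 < q := by linarith
  -- A single profile must serve the Hölder exponents of both components, hence the maximum.
  have hκ1 : max (1 / p) (1 / q) < 1 :=
    max_lt ((div_lt_one hp0).2 hp) ((div_lt_one hq0).2 hq)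
  have hκ0 : 0 ≤ max (1 / p) (1 / q) := le_max_of_le_left (by positivity)
  obtain ⟨H, CH, hCH, hH⟩ := exists_profile hκ1
  obtain ⟨M, T₁, hM, hT₁, h1⟩ := exists_test_inequality hn ha₁ ha₂ hβ hγ hD₁ hV₁ hR hH hκ0 hCH.le
    hu.nonneg₀ hu.nonneg₁
  obtain ⟨M₂, T₂, hM₂, hT₂, h2⟩ := exists_test_inequality hn ha₁ ha₂ hβ hγ hD₂ hV₂ hR hH hκ0 hCH.le
    hv.nonneg₀ hv.nonneg₁
  refine ⟨H, max (1 / p) (1 / q), CH, M, M₂, max T₁ T₂, hH, le_max_left _ _, le_max_right _ _, hM, hM₂,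
    le_max_of_le_left hT₁, ?_⟩
  intro ε Tm u ut v vt du dv hε hsol T hT hTm
  obtain ⟨hWu, hWv⟩ := hsol.isWaveComponent hp hq hu hv hD₁.continuous hD₂.continuous hV₁.continuous
    hV₂.continuous
  have hT0 : 0 ≤ T := by linarith [(le_max_left T₁ T₂).trans hT]
  have hsub := lightCone_subset_coneBox (n := n) (R := R) (a := 0) (b := T) le_rfl
  have hY := (hWu.integrableOn_source (R' := R) hT0 hTm).mono_set hsub
  have hX := (hWv.integrableOn_source (R' := R) hT0 hTm).mono_set hsub
  have n1 : ∀ z, 0 ≤ |v z| ^ q := fun z => Real.rpow_nonneg (abs_nonneg _) _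
  have n2 : ∀ z, 0 ≤ |ut z| ^ p := fun z => Real.rpow_nonneg (abs_nonneg _) _
  exact
    { pair₁ := ⟨n1, hY, (hWu.energy.integrableOn (R := R) hTm).2.1.mono_set hsub, hX⟩
      pair₂ := ⟨n2, hX, (hWv.energy.integrableOn (R := R) hTm).1.mono_set hsub, hY⟩
      test₁ := fun lam h0 h1' h2' =>
        (h1 hε n1 hWu T lam ((le_max_left _ _).trans hT) hTm h0 h1' h2').2
      test₂ := fun lam h0 h1' h2' =>
        (h2 hε n2 hWv T lam ((le_max_right _ _).trans hT) hTm h0 h1' h2').1 }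

/-- Here the data of `u` are estimated through `u_t`, which carries `(p, 0)`; exchanging the roles
of `u_t` and `v`, which carries `(q, 1)`, yields the other exponent. -/
theorem blowupExponent_eq_FSG1 : blowupExponent n p 0 q 1 = FSG1 n p q := by
  rw [blowupExponent, FSG1, div_eq_mul_inv]; ring

theorem blowupExponent_eq_FSG2 : blowupExponent n q 1 p 0 = FSG2 n p q := by
  rw [blowupExponent, FSG2, div_eq_mul_inv, mul_comm q p]; ring

theorem sSup_le_of_forall_le {S : Set ℝ≥0∞} {T₀ B : ℝ} (hT₀ : 0 ≤ T₀) (hB : 0 ≤ B)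
    (h : ∀ Tm ∈ S, ∀ T, T₀ ≤ T → ENNReal.ofReal T < Tm → T ≤ B) :
    sSup S ≤ ENNReal.ofReal (T₀ + B + 1) := by
  refine sSup_le fun Tm hTm => ?_
  by_contra hlt
  have := h Tm hTm (T₀ + B + 1) (by linarith) (not_le.1 hlt)
  linarith

theorem sSup_le_of_data_le {S : Set ℝ≥0∞} {T₀ C F c ε : ℝ} (hT₀ : 1 ≤ T₀) (hC : 0 < C) (hF : 0 < F)
    (hc : 0 < c) (hε : 0 < ε)
    (h : ∀ Tm ∈ S, ∀ T, T₀ ≤ T → ENNReal.ofReal T < Tm → ε * c ≤ C * T ^ (-F)) :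
    sSup S ≤ ENNReal.ofReal (T₀ + (C / c) ^ F⁻¹ * ε ^ (-F⁻¹) + 1) := by
  refine sSup_le_of_forall_le (by linarith) (by positivity) fun Tm hTm T hT hTm' => ?_
  have hT0 : 0 < T := by linarith
  have h1 := h Tm hTm T hT hTm'
  rw [Real.rpow_neg hT0.le, ← div_eq_mul_inv, le_div_iff₀ (by positivity)] at h1
  have h2 : T ^ F ≤ C / c * ε⁻¹ := by
    rw [← div_eq_mul_inv, div_div, le_div_iff₀ (by positivity)]
    linarith
  have h3 := Real.rpow_le_rpow (by positivity) h2 (inv_pos.2 hF).le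
  rwa [← Real.rpow_mul hT0.le, mul_inv_cancel₀ hF.ne', Real.rpow_one,
    Real.mul_rpow (by positivity) (by positivity), Real.inv_rpow hε.le, ← Real.rpow_neg hε.le] at h3

/-- The discrete argument at index `K` uses times up to `2 ^ (2 * K) = 4 ^ K`, so a time is placed
between consecutive powers of `4`. Being beyond `2 ^ (4 * J₀)` it forces `2 * J₀ ≤ K`. -/
theorem sSup_le_of_dyadic {S : Set ℝ≥0∞} {J₀ : ℕ} {B : ℝ}
    (h : ∀ Tm ∈ S, ∀ K : ℕ, 2 * J₀ ≤ K → ENNReal.ofReal (2 ^ (2 * K)) < Tm → (K : ℝ) ≤ B) :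
    sSup S ≤ ENNReal.ofReal (2 ^ (4 * J₀) + Real.exp (Real.log 4 * (B + 1)) + 1) := by
  refine sSup_le_of_forall_le (by positivity) (Real.exp_pos _).le fun Tm hTm T hT hTm' => ?_
  have hT1 : 1 ≤ T := (one_le_pow₀ (by norm_num)).trans hT
  obtain ⟨K, hK1, hK2⟩ := exists_nat_pow_near hT1 (by norm_num : (1 : ℝ) < 4)
  have e4 : ∀ k : ℕ, (4 : ℝ) ^ k = 2 ^ (2 * k) := fun k => by rw [pow_mul]; norm_num
  have hK : 2 * J₀ ≤ K := by
    have h1 : (4 : ℝ) ^ (2 * J₀) < 4 ^ (K + 1) := by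
      rw [e4, show 2 * (2 * J₀) = 4 * J₀ by ring]; exact hT.trans_lt hK2
    have := (pow_lt_pow_iff_right₀ (by norm_num : (1 : ℝ) < 4)).1 h1
    omega
  have h2 := h Tm hTm K hK ((ENNReal.ofReal_le_ofReal (by rw [← e4]; exact hK1)).trans_lt hTm')
  have h3 : (4 : ℝ) ^ (K + 1) = Real.exp (Real.log 4 * (K + 1)) := by
    rw [← Real.rpow_natCast, Real.rpow_def_of_pos (by norm_num)]; push_cast; rfl
  rw [h3] at hK2
  refine hK2.le.trans (Real.exp_le_exp.2 (mul_le_mul_of_nonneg_left (by linarith) ?_))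
  exact Real.log_nonneg (by norm_num)

/-- For `ε < 1` the power `ε ^ (-y)` is at least `1`, so additive constants can be moved into its
coefficient in the exponent. -/
theorem le_exp_of_lt_one {A B y ε : ℝ} (hA : 0 ≤ A) (hB : 0 ≤ B) (hy : 0 ≤ y) (hε : 0 < ε)
    (hε1 : ε < 1) : A + Real.exp (Real.log 4 * (B * ε ^ (-y) + 1)) + 1
      ≤ Real.exp ((A + Real.log 4 * (B + 1) + 1) * ε ^ (-y)) := by
  have h1 : 1 ≤ ε ^ (-y) := Real.one_le_rpow_of_pos_of_le_one_of_nonpos hε hε1.le (by linarith)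
  have hl : 0 ≤ Real.log 4 := Real.log_nonneg (by norm_num)
  set x := Real.log 4 * (B * ε ^ (-y) + 1) with hx
  have hx0 : 0 ≤ x := by positivity
  have h2 : A + Real.exp x + 1 ≤ Real.exp (x + (A + 1)) := by
    have h3 := Real.add_one_le_exp (A + 1)
    have h4 := Real.one_le_exp hx0
    rw [Real.exp_add]
    nlinarith
  refine h2.trans (Real.exp_le_exp.2 ?_)
  have h5 : x ≤ Real.log 4 * ((B + 1) * ε ^ (-y)) := mul_le_mul_of_nonneg_left (by linarith) hl
  nlinarith

end Lifespan

/-! ### Exponential lifespan bounds in the critical cases. -/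

section Bounds

variable {n : ℕ} {p q R : ℝ} {D₁ D₂ V₁ V₂ u₀ u₁ v₀ v₁ : Space n → ℝ}

theorem exists_lifespan_le_of_critical (hn : 3 ≤ n) (hR : 0 ≤ R) {κ CH T₀ r r' r₂ r₂' τ τ₂ M M₂ s I I₂ : ℝ}
    {H : ℝ → ℝ} (hH : IsProfile κ CH H) (hr : r.HolderConjugate r') (hr₂ : r₂.HolderConjugate r₂')
    (hκ : 1 / r ≤ κ) (hκ₂ : 1 / r₂ ≤ κ) (hM : 0 < M) (hM₂ : 0 < M₂) (hI : 0 < I) (hI₂ : 0 < I₂)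
    (hs : s = ((n : ℝ) - 1) / 2 + 1 / r' - τ) (hs0 : 0 ≤ s) (hF : blowupExponent n r τ r₂ τ₂ = 0) :
    ∃ A B : ℝ, 0 ≤ A ∧ 0 < B ∧ ∀ {ε : ℝ} {S : Set ℝ≥0∞}, 0 < ε →
      (∀ Tm ∈ S, ∃ G G₂ : ℝ × Space n → ℝ, ∀ T, T₀ ≤ T → ENNReal.ofReal T < Tm →
        IsTestedSystem n R H κ r τ M (ε * I) r₂ τ₂ M₂ (ε * I₂) T G G₂) →
      sSup S ≤ ENNReal.ofReal
        (A + Real.exp (Real.log 4 * (B * ε ^ (-(r * (r * r₂ - 1))) + 1)) + 1) ∧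
      ((-1 - ((n : ℝ) - 1) / 2 + n / r₂') * r₂ = -s → sSup S ≤ ENNReal.ofReal
        (A + Real.exp (Real.log 4 * (B * ε ^ (-(r * r₂ - 1)) + 1)) + 1)) := by
  obtain ⟨C, hC, h⟩ := exists_critical_lifespan hn hR hH hr hr₂ hκ hκ₂ hM hM₂ hs hs0 hF
  obtain ⟨J₀, hJ₀⟩ := pow_unbounded_of_one_lt T₀ (by norm_num : (1 : ℝ) < 2)
  set B₁ := C * I ^ (-(r * (r * r₂ - 1))) with hB₁
  set B₂ := C * I₂ ^ (-(r * r₂ - 1)) with hB₂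
  have hB₁0 : 0 < B₁ := by positivity
  have hB₂0 : 0 < B₂ := by positivity
  refine ⟨2 ^ (4 * (J₀ + 1)), B₁ + B₂, by positivity, by positivity, fun {ε S} hε hS => ?_⟩
  have key : ∀ Tm ∈ S, ∀ K : ℕ, 2 * (J₀ + 1) ≤ K → ENNReal.ofReal (2 ^ (2 * K)) < Tm →
      (K : ℝ) ≤ C * (ε * I) ^ (-(r * (r * r₂ - 1))) ∧
      ((-1 - ((n : ℝ) - 1) / 2 + n / r₂') * r₂ = -s →
        (K : ℝ) ≤ C * (ε * I₂) ^ (-(r * r₂ - 1))) := by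
    intro Tm hTm K hK hKT
    obtain ⟨G, G₂, hG⟩ := hS Tm hTm
    refine h (J₀ := J₀ + 1) (by omega) hK (by positivity) (by positivity) fun j hj hj' =>
      hG _ ?_ ?_
    · exact hJ₀.le.trans (pow_le_pow_right₀ (by norm_num) (by omega))
    · exact (ENNReal.ofReal_le_ofReal (pow_le_pow_right₀ (by norm_num) hj')).trans_lt hKT
  constructor
  · refine sSup_le_of_dyadic (J₀ := J₀ + 1) fun Tm hTm K hK hKT =>
      ((key Tm hTm K hK hKT).1).trans ?_
    rw [Real.mul_rpow hε.le hI.le, mul_left_comm, ← hB₁, mul_comm]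
    exact mul_le_mul_of_nonneg_right (by linarith) (by positivity)
  · intro he
    refine sSup_le_of_dyadic (J₀ := J₀ + 1) fun Tm hTm K hK hKT =>
      ((key Tm hTm K hK hKT).2 he).trans ?_
    rw [Real.mul_rpow hε.le hI₂.le, mul_left_comm, ← hB₂, mul_comm]
    exact mul_le_mul_of_nonneg_right (by linarith) (by positivity)

/-- If both exponents vanish, the two equations combine to `(n - 1) / 2 * (q - 1) = 1 / p`. Then the
power of `T` in the high-frequency estimate of `v`, multiplied by `q`, is minus the weight exponent
`s` of the dyadic integrals. -/
theorem doubly_critical_exponent (hp : 1 < p) (hq : 1 < q) (h1 : FSG1 n p q = 0)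
    (h2 : FSG2 n p q = 0) :
    (-1 - ((n : ℝ) - 1) / 2 + n / q.conjExponent) * q
      = -(((n : ℝ) - 1) / 2 + 1 / p.conjExponent - 0) := by
  have hp0 : 0 < p := by linarith
  have hq0 : 0 < q := by linarith
  have hP : 0 < p * q - 1 := by nlinarith
  have ep : 1 / p.conjExponent = 1 - 1 / p := by
    have := (Real.HolderConjugate.conjExponent hp).inv_add_inv_eq_one; rw [one_div, one_div]; linarith
  have eq : 1 / q.conjExponent = 1 - 1 / q := by
    have := (Real.HolderConjugate.conjExponent hq).inv_add_inv_eq_one; rw [one_div, one_div]; linarith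
  rw [FSG1, sub_eq_zero, ← div_eq_mul_inv, div_eq_iff hP.ne'] at h1
  rw [FSG2, sub_eq_zero, ← div_eq_mul_inv, div_eq_iff hP.ne'] at h2
  rw [div_eq_mul_one_div (n : ℝ) q.conjExponent, ep, eq]
  have e3 : p * (1 / p) = 1 := mul_one_div_cancel hp0.ne'
  have e4 : q * (1 / q) = 1 := mul_one_div_cancel hq0.ne'
  set a := 1 / p
  set b := 1 / q
  have key : ((p * q - 1)) * (((n : ℝ) - 1) / 2 * (q - 1) - a) = 0 := by
    linear_combination (-(q - 1)) * h2 + (h1 - h2) - q * e3 + e4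
  have key' := (mul_eq_zero.1 key).resolve_left hP.ne'
  linear_combination key' - (n : ℝ) * e4

end Bounds

end MixedWave

/-! ### Assembly of the lifespan bounds. -/

theorem theorem1p3 (n : ℕ) (hn : 3 ≤ n) (p q : ℝ) (hp : 1 < p) (hq : 1 < q)
    (a₁ a₂ β γ : ℝ) (ha₁ : 0 ≤ a₁) (ha₂ : 0 ≤ a₂) (hβ : 1 < β) (hγ : 2 < γ)
    (D₁ D₂ V₁ V₂ : MixedWave.Space n → ℝ)
    (hD₁ : MixedWave.IsCoefficient a₁ β D₁) (hD₂ : MixedWave.IsCoefficient a₁ β D₂)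
    (hV₁ : MixedWave.IsCoefficient a₂ γ V₁) (hV₂ : MixedWave.IsCoefficient a₂ γ V₂)
    (R : ℝ) (hR : 0 < R) (u₀ u₁ v₀ v₁ : MixedWave.Space n → ℝ)
    (hu : MixedWave.IsData R u₀ u₁) (hv : MixedWave.IsData R v₀ v₁)
    (hΓ : 0 ≤ MixedWave.GammaSG n p q) :
    (∀ ε : ℝ, 0 < ε →
      MixedWave.lifespan p q D₁ D₂ V₁ V₂ R u₀ u₁ v₀ v₁ ε < ⊤) ∧
    ∃ ε₀ : ℝ, 0 < ε₀ ∧ ∃ C : ℝ, 0 < C ∧ ∀ ε : ℝ, 0 < ε → ε < ε₀ →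
      (0 < MixedWave.GammaSG n p q →
        MixedWave.lifespan p q D₁ D₂ V₁ V₂ R u₀ u₁ v₀ v₁ ε
          ≤ ENNReal.ofReal (C * ε ^ (-(MixedWave.GammaSG n p q)⁻¹))) ∧
      (MixedWave.FSG1 n p q = 0 → MixedWave.FSG2 n p q < 0 →
        MixedWave.lifespan p q D₁ D₂ V₁ V₂ R u₀ u₁ v₀ v₁ ε
          ≤ ENNReal.ofReal (Real.exp (C * ε ^ (-(p * (p * q - 1)))))) ∧
      (MixedWave.FSG2 n p q = 0 → MixedWave.FSG1 n p q < 0 →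
        MixedWave.lifespan p q D₁ D₂ V₁ V₂ R u₀ u₁ v₀ v₁ ε
          ≤ ENNReal.ofReal (Real.exp (C * ε ^ (-(q * (p * q - 1)))))) ∧
      (MixedWave.FSG1 n p q = 0 → MixedWave.FSG2 n p q = 0 →
        MixedWave.lifespan p q D₁ D₂ V₁ V₂ R u₀ u₁ v₀ v₁ ε
          ≤ ENNReal.ofReal (Real.exp (C * ε ^ (-(p * q - 1))))) := by
  have hR0 := hR.le
  obtain ⟨H, κ, CH, M, M₂, T₀, hH, hκp, hκq, hM, hM₂, hT₀, hsys⟩ := MixedWave.exists_isTestedSystem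
    hn hp hq ha₁ ha₂ hβ hγ hD₁ hD₂ hV₁ hV₂ hR0 hu hv
  have hp' := Real.HolderConjugate.conjExponent hp
  have hq' := Real.HolderConjugate.conjExponent hq
  have hp0 : 0 < p := by linarith
  have hq0 : 0 < q := by linarith
  have hP : 0 < p * q - 1 := by nlinarith
  have hI := hu.integral_pos
  have hI₂ := hv.integral_pos
  set I := (∫ x, u₀ x) + ∫ x, u₁ x
  set I₂ := (∫ x, v₀ x) + ∫ x, v₁ x
  have hn3 : (3 : ℝ) ≤ n := by exact_mod_cast hn
  set S : ℝ → Set ℝ≥0∞ := fun ε => {T | ∃ (u ut : ℝ × MixedWave.Space n → ℝ)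
    (du : ℝ × MixedWave.Space n → MixedWave.Space n) (v vt : ℝ × MixedWave.Space n → ℝ)
    (dv : ℝ × MixedWave.Space n → MixedWave.Space n),
    MixedWave.IsWeakSolution p q D₁ D₂ V₁ V₂ R u₀ u₁ v₀ v₁ ε T u ut du v vt dv} with hS
  have hlife : ∀ ε, MixedWave.lifespan p q D₁ D₂ V₁ V₂ R u₀ u₁ v₀ v₁ ε = sSup (S ε) := fun _ => rfl
  have hS₁ : ∀ {ε : ℝ}, 0 < ε → ∀ Tm ∈ S ε, ∃ G G₂ : ℝ × MixedWave.Space n → ℝ, ∀ T, T₀ ≤ T →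
      ENNReal.ofReal T < Tm →
      MixedWave.IsTestedSystem n R H κ p 0 M (ε * I) q 1 M₂ (ε * I₂) T G G₂ := by
    rintro ε hε Tm ⟨u, ut, du, v, vt, dv, hsol⟩
    exact ⟨ut, v, hsys hε.le hsol⟩
  have hS₂ : ∀ {ε : ℝ}, 0 < ε → ∀ Tm ∈ S ε, ∃ G G₂ : ℝ × MixedWave.Space n → ℝ, ∀ T, T₀ ≤ T →
      ENNReal.ofReal T < Tm →
      MixedWave.IsTestedSystem n R H κ q 1 M₂ (ε * I₂) p 0 M (ε * I) T G G₂ := by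
    intro ε hε Tm hTm
    obtain ⟨G, G₂, h⟩ := hS₁ hε Tm hTm
    exact ⟨G₂, G, fun T hT hTm' => (h T hT hTm').symm⟩
  -- the subcritical bound
  have hsub : 0 < MixedWave.GammaSG n p q → ∃ K : ℝ, 0 ≤ K ∧ ∀ ε : ℝ, 0 < ε →
      sSup (S ε) ≤ ENNReal.ofReal (T₀ + K * ε ^ (-(MixedWave.GammaSG n p q)⁻¹) + 1) := by
    intro hpos
    -- Each order of the two components gives a bound with its own exponent; the order realising the
    -- maximum is used.
    rcases le_total (MixedWave.FSG2 n p q) (MixedWave.FSG1 n p q) with hle | hle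
    · have e : MixedWave.GammaSG n p q = MixedWave.FSG1 n p q := max_eq_left hle
      rw [e] at hpos ⊢
      obtain ⟨C, hC, h⟩ := MixedWave.exists_data_le hn hR0 hH hp' hq' hκp hκq hM hM₂
        (τ := 0) (τ₂ := 1)
      refine ⟨(C / I) ^ (MixedWave.FSG1 n p q)⁻¹, by positivity, fun ε hε =>
        MixedWave.sSup_le_of_data_le hT₀ hC hpos hI hε fun Tm hTm T hT hTm' => ?_⟩
      obtain ⟨G, G₂, hG⟩ := hS₁ hε Tm hTm
      rw [← MixedWave.blowupExponent_eq_FSG1]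
      exact h (hT₀.trans hT) (by positivity) (by positivity) (hG T hT hTm')
    · have e : MixedWave.GammaSG n p q = MixedWave.FSG2 n p q := max_eq_right hle
      rw [e] at hpos ⊢
      obtain ⟨C, hC, h⟩ := MixedWave.exists_data_le hn hR0 hH hq' hp' hκq hκp hM₂ hM
        (τ := 1) (τ₂ := 0)
      refine ⟨(C / I₂) ^ (MixedWave.FSG2 n p q)⁻¹, by positivity, fun ε hε =>
        MixedWave.sSup_le_of_data_le hT₀ hC hpos hI₂ hε fun Tm hTm T hT hTm' => ?_⟩
      obtain ⟨G, G₂, hG⟩ := hS₂ hε Tm hTm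
      rw [← MixedWave.blowupExponent_eq_FSG2]
      exact h (hT₀.trans hT) (by positivity) (by positivity) (hG T hT hTm')
  -- the critical bounds
  have hcrit₁ : MixedWave.FSG1 n p q = 0 → _ := fun hF =>
    MixedWave.exists_lifespan_le_of_critical (T₀ := T₀) hn hR0 hH hp' hq' hκp hκq hM hM₂ hI hI₂
      (τ := 0) (τ₂ := 1) rfl (by
        have := one_div_pos.2 hp'.symm.pos
        linarith) (by rw [MixedWave.blowupExponent_eq_FSG1, hF])
  have hcrit₂ : MixedWave.FSG2 n p q = 0 → _ := fun hF =>
    MixedWave.exists_lifespan_le_of_critical (T₀ := T₀) hn hR0 hH hq' hp' hκq hκp hM₂ hM hI₂ hI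
      (τ := 1) (τ₂ := 0) rfl (by
        have := one_div_pos.2 hq'.symm.pos
        linarith) (by rw [MixedWave.blowupExponent_eq_FSG2, hF])
  have hC₀ : ∃ C₀ : ℝ, 0 < C₀ ∧ (0 < MixedWave.GammaSG n p q → ∀ ε : ℝ, 0 < ε → ε < 1 →
      sSup (S ε) ≤ ENNReal.ofReal (C₀ * ε ^ (-(MixedWave.GammaSG n p q)⁻¹))) := by
    by_cases hpos : 0 < MixedWave.GammaSG n p q
    · obtain ⟨K, hK, h⟩ := hsub hpos
      refine ⟨T₀ + K + 1, by linarith, fun _ ε hε hε1 =>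
        (h ε hε).trans (ENNReal.ofReal_le_ofReal ?_)⟩
      have h1 : 1 ≤ ε ^ (-(MixedWave.GammaSG n p q)⁻¹) :=
        Real.one_le_rpow_of_pos_of_le_one_of_nonpos hε hε1.le (by
          have := inv_pos.2 hpos
          linarith)
      nlinarith
    · exact ⟨1, one_pos, fun h => absurd h hpos⟩
  have hC₁ : ∃ C₁ : ℝ, 0 < C₁ ∧ (MixedWave.FSG1 n p q = 0 → ∀ ε : ℝ, 0 < ε → ε < 1 →
      sSup (S ε) ≤ ENNReal.ofReal (Real.exp (C₁ * ε ^ (-(p * (p * q - 1))))) ∧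
      (MixedWave.FSG2 n p q = 0 →
        sSup (S ε) ≤ ENNReal.ofReal (Real.exp (C₁ * ε ^ (-(p * q - 1)))))) := by
    by_cases hF : MixedWave.FSG1 n p q = 0
    · obtain ⟨A, B, hA, hB, h⟩ := hcrit₁ hF
      have hl : 0 ≤ Real.log 4 := Real.log_nonneg (by norm_num)
      refine ⟨A + Real.log 4 * (B + 1) + 1, by positivity, fun _ ε hε hε1 => ⟨?_, fun hF₂ => ?_⟩⟩
      · exact (h hε (hS₁ hε)).1.trans (ENNReal.ofReal_le_ofReal
          (MixedWave.le_exp_of_lt_one hA hB.le (by positivity) hε hε1))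
      · exact ((h hε (hS₁ hε)).2 (MixedWave.doubly_critical_exponent hp hq hF hF₂)).trans
          (ENNReal.ofReal_le_ofReal (MixedWave.le_exp_of_lt_one hA hB.le hP.le hε hε1))
    · exact ⟨1, one_pos, fun h => absurd h hF⟩
  have hC₂ : ∃ C₂ : ℝ, 0 < C₂ ∧ (MixedWave.FSG2 n p q = 0 → ∀ ε : ℝ, 0 < ε → ε < 1 →
      sSup (S ε) ≤ ENNReal.ofReal (Real.exp (C₂ * ε ^ (-(q * (p * q - 1)))))) := by
    by_cases hF : MixedWave.FSG2 n p q = 0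
    · obtain ⟨A, B, hA, hB, h⟩ := hcrit₂ hF
      have hl : 0 ≤ Real.log 4 := Real.log_nonneg (by norm_num)
      refine ⟨A + Real.log 4 * (B + 1) + 1, by positivity, fun _ ε hε hε1 => ?_⟩
      rw [mul_comm p q]
      exact (h hε (hS₂ hε)).1.trans (ENNReal.ofReal_le_ofReal
        (MixedWave.le_exp_of_lt_one hA hB.le (mul_nonneg hq0.le (by linarith)) hε hε1))
    · exact ⟨1, one_pos, fun h => absurd h hF⟩
  obtain ⟨C₀, hC₀0, hC₀⟩ := hC₀
  obtain ⟨C₁, hC₁0, hC₁⟩ := hC₁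
  obtain ⟨C₂, hC₂0, hC₂⟩ := hC₂
  simp only [hlife]
  -- The threshold `ε < 1` serves only to absorb additive constants. Finiteness of the lifespan for
  -- every `ε` follows from the bounds before this absorption.
  refine ⟨fun ε hε => ?_, 1, one_pos, C₀ + C₁ + C₂, by positivity, fun ε hε hε1 =>
    ⟨fun hpos => (hC₀ hpos ε hε hε1).trans (ENNReal.ofReal_le_ofReal ?_),
      fun hF₁ _ => (hC₁ hF₁ ε hε hε1).1.trans (ENNReal.ofReal_le_ofReal (Real.exp_le_exp.2 ?_)),
      fun hF₂ _ => (hC₂ hF₂ ε hε hε1).trans (ENNReal.ofReal_le_ofReal (Real.exp_le_exp.2 ?_)),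
      fun hF₁ hF₂ => ((hC₁ hF₁ ε hε hε1).2 hF₂).trans
        (ENNReal.ofReal_le_ofReal (Real.exp_le_exp.2 ?_))⟩⟩
  · rcases hΓ.lt_or_eq with hpos | h0
    · obtain ⟨K, -, h⟩ := hsub hpos
      exact (h ε hε).trans_lt ENNReal.ofReal_lt_top
    · rcases max_choice (MixedWave.FSG1 n p q) (MixedWave.FSG2 n p q) with h | h
      · obtain ⟨A, B, -, -, h'⟩ := hcrit₁ (h.symm.trans h0.symm)
        exact (h' hε (hS₁ hε)).1.trans_lt ENNReal.ofReal_lt_top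
      · obtain ⟨A, B, -, -, h'⟩ := hcrit₂ (h.symm.trans h0.symm)
        exact (h' hε (hS₂ hε)).1.trans_lt ENNReal.ofReal_lt_top
  all_goals exact mul_le_mul_of_nonneg_right (by linarith) (by positivity)
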